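/- **Conventions.** A *forest* on a finite set $I$ is a set of non-planar rooted binary trees whose leaves are, all together, bijectively labelled by $I$. $V(F)$ is the set of inner vertices of the forest $F$. An *orientation* of a finite set $X$ is a generator of $\Lambda^{|X|}\mathbb{Z}X$; its degree is the number of its wedge signs. *Operads (over $\mathbb{Q}$).* $\operatorname{Det}(I)$ is the line spanned by the orientations of $I$, in degree $|I|-1$, with composition $(x\wedge\star)\circ_\star y=x\wedge y$. $\operatorname{Gri}(I)$, in degree $0$, has as basis the rooted binary trees with leaves labelled by $I$, with composition given by grafting; it is freely generated by the tree $\omega_{i,j}$ with two leaves $i,j$. $B$ is the operad on $\operatorname{Det}\circ\operatorname{Gri}$ defined by the distributive law $$\omega_{i,\star}\circ_\star e_{j,k}=e_{j,\star}\circ_\star\omega_{i,k}-e_{k,\star}\circ_\star\omega_{i,j},\qquad e_{j,k}=j\wedge k ;$$ $B(I)$ has as basis the tensor products $o\otimes F$ of a forest $F$ on $I$ with an orientation $o$ of its set of roots (one for each $F$). $\operatorname{Bess}=\operatorname{Det}\otimes B$ is the tensor product of graded operads, with $(a\otimes x)\circ_i(b\otimes y)=(-1)^{\deg x\deg b}(a\circ_i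 b)\otimes(x\circ_i y)$, and $\Omega_{\star,\#}=(\star\wedge\#)\otimes\omega_{\star,\#}\in\operatorname{Bess}(\{\star,\#\})$. *Inner-oriented forests.* An inner-oriented forest $o\otimes F$ is a forest $F$ with a global orientation $o$, i.e. an orientation of $V(F)\sqcup\{R\}$ where $R=R_F$ is an auxiliary element, and with (implicit) local orientations $o_v$, i.e. orientations of the set of the three half-edges at $v$, for all $v\in V(F)$. It is identified with the following element $o'\otimes o''\otimes F$ of $\operatorname{Bess}(I)$, where $o'$ is an orientation of $I$ and $o''$ an orientation of the set of roots. In $o'\wedge R\wedge o''$, remove all pairs $\ell\wedge r$ where $\ell$ is a leaf and $r$ a root that are related by an edge, and add the pairs $e^+\wedge e^-$ (upper and lower half-edge) for all edges $e$ between two inner vertices; here a leaf or a root adjacent to an inner vertex stands for the corresponding half-edge at this vertex. The result is required to be the exterior product obtained from $o$ by replacing each $v\in V(F)$ by $o_v$. This determines $o'\otimes o''$. *The operation $\vee$.* For trees $T_1,T_2$, $T_1\vee T_2$ is the tree obtained by grafting $T_1$ and $T_2$ on the two leaves of the tree with one inner vertex $v$. For forests $F_1=T_1^1\sqcup\dots\sqcup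 T_1^m$ and $F_2=T_2^1\sqcup\dots\sqcup T_2^n$, with trees $T^a_1$, $T^b_2$, $F_1\vee F_2$ is the sum of forests $$F_1\vee F_2=\sum_{a=1}^m\sum_{b=1}^n\Big((T_1^a\vee T_2^b)\sqcup\bigsqcup_{a'\neq a}T_1^{a'}\sqcup\bigsqcup_{b'\neq b}T_2^{b'}\Big).$$ **Proposition.** Let $o_1\otimes F_1$ and $o_2\otimes F_2$ be two inner-oriented forests, on finite sets $I_1$ and $I_2$. Then, in $\operatorname{Bess}(I_1\sqcup I_2)$, $$\Omega_{\star,\#}\circ_\star(o_1\otimes F_1)\circ_\#(o_2\otimes F_2)=(o_1\vee o_2)\otimes(F_1\vee F_2),$$ where in each term of $F_1\vee F_2$ the global orientation $o_1\vee o_2$ is $(-1)^{\deg o_1}\,o_1\wedge o_2$ with $R_{F_1}\wedge R_{F_2}$ replaced by $R\wedge v$, $v$ being the new inner vertex of the term; the local orientations are unchanged at the vertices of $F_1$ and $F_2$, and the local orientation at $v$ is the one of $\Omega$, namely $v^+\wedge e_1^-\wedge e_2^-$, where $v^+$ is the outgoing half-edge at $v$ and $e_1^-$, $e_2^-$ are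 the incoming half-edges on the side of $F_1$ and of $F_2$. -/

import Mathlib

open scoped TensorProduct

noncomputable section

namespace BesselOperad

/-! ### Exterior algebras and orientations of finite sets -/

/-- The exterior algebra of the rational vector space with basis `X`. -/
abbrev Ext (X : Type*) : Type _ := ExteriorAlgebra ℚ (X →₀ ℚ)

/-- The generator of the exterior algebra given by an element of `X`. -/
def gen {X : Type*} (x : X) : Ext X := ExteriorAlgebra.ι ℚ (Finsupp.single x 1)

/-- The exterior product `x₁ ∧ ⋯ ∧ xₙ` of a list of elements. -/
def wedge {X : Type*} (l : List X) : Ext X := (l.map gen).prod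

/-- `o` is an orientation of the finite set `s`: up to sign it is the exterior product of all
elements of `s` (in some order), i.e. a generator of the top exterior power of `ℤ s`. -/
def IsOrientation {X : Type*} (s : Finset X) (o : Ext X) : Prop :=
  ∃ l : List X, l.Nodup ∧ (∀ x, x ∈ l ↔ x ∈ s) ∧ (o = wedge l ∨ o = -wedge l)

/-- The determinant line of the finite set `s`, spanned by the orientations of `s`. -/
def detSpace {X : Type*} (s : Finset X) : Submodule ℚ (Ext X) :=
  Submodule.span ℚ {o | IsOrientation s o}

section exterior

variable {X Y Z : Type*}

@[simp] theorem wedge_nil : wedge ([] : List X) = 1 := rfl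

@[simp] theorem wedge_cons (x : X) (l : List X) : wedge (x :: l) = gen x * wedge l := by
  simp [wedge]

@[simp] theorem wedge_append (l l' : List X) : wedge (l ++ l') = wedge l * wedge l' := by
  simp [wedge]

theorem gen_mul_self (x : X) : gen x * gen x = 0 := ExteriorAlgebra.ι_sq_zero _

theorem gen_swap (x y : X) : gen x * gen y = -(gen y * gen x) :=
  eq_neg_of_add_eq_zero_left (ExteriorAlgebra.ι_add_mul_swap _ _)

theorem wedge_perm {l l' : List X} (h : l.Perm l') : wedge l = wedge l' ∨ wedge l = -wedge l' := by
  induction h with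
  | nil => simp
  | cons x _ ih => rcases ih with h | h <;> simp [h]
  | swap x y l => right; simp only [wedge_cons, ← mul_assoc, gen_swap y x, neg_mul]
  | trans _ _ h1 h2 => rcases h1 with h1 | h1 <;> rcases h2 with h2 | h2 <;> simp [h1, h2]

theorem contractLeft_wedge [DecidableEq X] (x : X) (l : List X) (h : x ∉ l) :
    CliffordAlgebra.contractLeft (Finsupp.lapply x) (wedge l) = 0 := by
  induction l with
  | nil => simp
  | cons y l ih =>
    simp only [List.mem_cons, not_or] at h
    rw [wedge_cons, gen]
    have := CliffordAlgebra.contractLeft_ι_mul (Q := (0 : QuadraticForm ℚ (X →₀ ℚ)))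
      (Finsupp.lapply x) (Finsupp.single y 1) (wedge l)
    refine this.trans ?_
    rw [ih h.2]
    simp [Ne.symm h.1]

theorem contractRight_wedge [DecidableEq X] (x : X) (l : List X) (h : x ∉ l) :
    CliffordAlgebra.contractRight (wedge l) (Finsupp.lapply x) = 0 := by
  induction l using List.reverseRecOn with
  | nil => simp
  | append_singleton l y ih =>
    simp only [List.mem_append, List.mem_singleton, not_or] at h
    rw [wedge_append, wedge_cons, wedge_nil, mul_one, gen]
    have := CliffordAlgebra.contractRight_mul_ι (Q := (0 : QuadraticForm ℚ (X →₀ ℚ)))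
      (Finsupp.lapply x) (Finsupp.single y 1) (wedge l)
    refine this.trans ?_
    rw [ih h.1]
    simp [Ne.symm h.2]

theorem contractRight_wedge_append [DecidableEq X] (x : X) (l : List X) (h : x ∉ l) :
    CliffordAlgebra.contractRight (wedge (l ++ [x])) (Finsupp.lapply x) = wedge l := by
  rw [wedge_append, wedge_cons, wedge_nil, mul_one, gen]
  refine (CliffordAlgebra.contractRight_mul_ι (Q := (0 : QuadraticForm ℚ (X →₀ ℚ)))
      (Finsupp.lapply x) (Finsupp.single x 1) (wedge l)).trans ?_
  rw [contractRight_wedge x l h]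
  simp

theorem wedge_ne_zero {l : List X} (h : l.Nodup) : wedge l ≠ 0 := by
  classical
  induction l with
  | nil => simp
  | cons x l ih =>
    simp only [List.nodup_cons] at h
    intro h0
    apply ih h.2
    have := CliffordAlgebra.contractLeft_ι_mul (Q := (0 : QuadraticForm ℚ (X →₀ ℚ)))
      (Finsupp.lapply x) (Finsupp.single x 1) (wedge l)
    rw [contractLeft_wedge x l h.1] at this
    rw [wedge_cons, gen] at h0
    have h1 : CliffordAlgebra.contractLeft (Finsupp.lapply x)
      ((CliffordAlgebra.ι (0 : QuadraticForm ℚ (X →₀ ℚ))) (Finsupp.single x 1) * wedge l) = 0 := by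
      erw [h0]; simp
    rw [h1] at this
    simpa using this.symm

theorem IsOrientation.neg {s : Finset X} {o : Ext X} (h : IsOrientation s o) :
    IsOrientation s (-o) := by
  obtain ⟨l, h1, h2, h3⟩ := h
  refine ⟨l, h1, h2, ?_⟩
  rcases h3 with rfl | rfl <;> simp

theorem isOrientation_wedge {s : Finset X} {l : List X} (h1 : l.Nodup) (h2 : ∀ x, x ∈ l ↔ x ∈ s) :
    IsOrientation s (wedge l) := ⟨l, h1, h2, Or.inl rfl⟩

theorem isOrientation_gen (x : X) : IsOrientation {x} (gen x) :=
  ⟨[x], by simp, by simp, by simp⟩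

theorem isOrientation_one : IsOrientation (∅ : Finset X) 1 := ⟨[], by simp, by simp, by simp⟩

theorem IsOrientation.sign_smul {s : Finset X} {o : Ext X} (h : IsOrientation s o) (n : ℕ) :
    IsOrientation s ((-1 : ℚ) ^ n • o) := by
  rcases neg_one_pow_eq_or ℚ n with h1 | h1 <;> rw [h1]
  · simpa using h
  · simpa using h.neg

theorem IsOrientation.ne_zero {s : Finset X} {o : Ext X} (h : IsOrientation s o) : o ≠ 0 := by
  obtain ⟨l, h1, h2, h3⟩ := h
  rcases h3 with rfl | rfl
  · exact wedge_ne_zero h1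
  · exact neg_ne_zero.mpr (wedge_ne_zero h1)

theorem IsOrientation.eq_or_neg {s : Finset X} {o o' : Ext X} (h : IsOrientation s o)
    (h' : IsOrientation s o') : o' = o ∨ o' = -o := by
  obtain ⟨l, h1, h2, h3⟩ := h
  obtain ⟨l', h1', h2', h3'⟩ := h'
  have hp : l'.Perm l := (List.perm_ext_iff_of_nodup h1' h1).2 fun x => by rw [h2, h2']
  rcases wedge_perm hp with h | h <;> rcases h3 with rfl | rfl <;> rcases h3' with rfl | rfl <;>
    simp [h]

theorem IsOrientation.mul [DecidableEq X] {s t : Finset X} {o o' : Ext X} (h : IsOrientation s o)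
    (h' : IsOrientation t o') (hd : Disjoint s t) : IsOrientation (s ∪ t) (o * o') := by
  obtain ⟨l, h1, h2, h3⟩ := h
  obtain ⟨l', h1', h2', h3'⟩ := h'
  refine ⟨l ++ l', ?_, by simp [h2, h2'], ?_⟩
  · rw [List.nodup_append']
    refine ⟨h1, h1', fun x hx hx' => ?_⟩
    exact Finset.disjoint_left.1 hd ((h2 x).1 hx) ((h2' x).1 hx')
  · rcases h3 with rfl | rfl <;> rcases h3' with rfl | rfl <;> simp

theorem isOrientation_list_prod [DecidableEq Y] (f : X → Ext Y) (t : X → Finset Y) (l : List X)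
    (hl : l.Nodup) (hf : ∀ x ∈ l, IsOrientation (t x) (f x))
    (hd : ∀ x ∈ l, ∀ y ∈ l, x ≠ y → Disjoint (t x) (t y)) (u : Finset Y)
    (hu : ∀ y, y ∈ u ↔ ∃ x ∈ l, y ∈ t x) :
    IsOrientation u (l.map f).prod := by
  induction l generalizing u with
  | nil =>
    have : u = ∅ := by ext y; simp [hu]
    simpa [this] using isOrientation_one
  | cons x l ih =>
    simp only [List.nodup_cons] at hl
    classical
    have hi := ih hl.2 (fun y hy => hf y (by simp [hy]))
      (fun y hy z hz => hd y (by simp [hy]) z (by simp [hz])) (l.toFinset.biUnion t)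
      (by simp)
    have hu' : u = t x ∪ l.toFinset.biUnion t := by ext y; simp [hu]
    rw [hu', List.map_cons, List.prod_cons]
    refine (hf x (by simp)).mul hi ?_
    rw [Finset.disjoint_biUnion_right]
    intro y hy
    rw [List.mem_toFinset] at hy
    exact hd x (by simp) y (by simp [hy]) (by rintro rfl; exact hl.1 hy)

theorem IsOrientation.contractRight [DecidableEq X] {s : Finset X} {o : Ext X}
    (h : IsOrientation s o) {x : X} (hx : x ∈ s) :
    IsOrientation (s.erase x) (CliffordAlgebra.contractRight o (Finsupp.lapply x)) := by
  obtain ⟨l, h1, h2, h3⟩ := h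
  have hx' : x ∈ l := (h2 x).2 hx
  have hp : l.Perm (l.erase x ++ [x]) :=
    (List.perm_cons_erase hx').trans (List.perm_append_singleton x (l.erase x)).symm
  have hn : x ∉ l.erase x := fun h => (h1.mem_erase_iff.1 h).1 rfl
  refine ⟨l.erase x, h1.erase x, fun y => ?_, ?_⟩
  · rw [h1.mem_erase_iff, Finset.mem_erase, h2]
  · have hc := contractRight_wedge_append x (l.erase x) hn
    rcases wedge_perm hp with h | h <;> rcases h3 with rfl | rfl <;> rw [h]
    · exact Or.inl hc
    · right
      rw [← hc]
      simp only [map_neg, LinearMap.neg_apply]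
    · right
      rw [← hc]
      simp only [map_neg, LinearMap.neg_apply]
    · left
      rw [← hc, neg_neg]

end exterior

/-- The algebra morphism of exterior algebras that replaces each `x` by `f x`, where the
elements `f x` anticommute. -/
def substHom {X Y : Type*} (f : X → Ext Y) (hf : ∀ x y, f x * f y = -(f y * f x)) :
    Ext X →ₐ[ℚ] Ext Y :=
  ExteriorAlgebra.lift ℚ ⟨Finsupp.linearCombination ℚ f, by
    have key : ∀ m n : X →₀ ℚ, Finsupp.linearCombination ℚ f m * Finsupp.linearCombination ℚ f n =
        -(Finsupp.linearCombination ℚ f n * Finsupp.linearCombination ℚ f m) := by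
      intro m n
      induction m using Finsupp.induction_linear with
      | zero => simp
      | add a b ha hb => simp only [map_add, add_mul, mul_add, ha, hb]; abel
      | single x a =>
        induction n using Finsupp.induction_linear with
        | zero => simp
        | add c d hc hd => simp only [map_add, add_mul, mul_add, hc, hd]; abel
        | single y b =>
          simp only [Finsupp.linearCombination_single, smul_mul_assoc, mul_smul_comm, hf x y,
            smul_neg]
          rw [smul_comm]
    intro m
    have h2 : (2 : ℚ) • (Finsupp.linearCombination ℚ f m * Finsupp.linearCombination ℚ f m) = 0 := by
      rw [two_smul]
      exact eq_neg_iff_add_eq_zero.1 (key m m)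
    exact (smul_eq_zero.1 h2).resolve_left two_ne_zero⟩

/-- The algebra morphism of exterior algebras that renames `x` to `y` if `p x = some y`, and
kills `x` if `p x = none`. -/
def rename {X Y : Type*} (p : X → Option Y) : Ext X →ₐ[ℚ] Ext Y :=
  substHom (fun x => (p x).elim 0 gen) (by
    intro x y
    rcases p x with _ | a <;> rcases p y with _ | b
    · simp
    · simp
    · simp
    · exact gen_swap a b)

section exterior

variable {X Y Z : Type*}

@[simp] theorem substHom_gen (f : X → Ext Y) (hf) (x : X) : substHom f hf (gen x) = f x := by
  simp [substHom, gen]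

theorem substHom_wedge (f : X → Ext Y) (hf) (l : List X) :
    substHom f hf (wedge l) = (l.map f).prod := by
  induction l with
  | nil => simp
  | cons x l ih => simp [ih]

theorem IsOrientation.substHom [DecidableEq Y] {s : Finset X} {o : Ext X} (h : IsOrientation s o)
    (f : X → Ext Y) (hf : ∀ x y, f x * f y = -(f y * f x)) (t : X → Finset Y)
    (ht : ∀ x ∈ s, IsOrientation (t x) (f x))
    (hd : ∀ x ∈ s, ∀ y ∈ s, x ≠ y → Disjoint (t x) (t y)) :
    IsOrientation (s.biUnion t) (substHom f hf o) := by
  obtain ⟨l, h1, h2, h3⟩ := h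
  have := isOrientation_list_prod f t l h1 (fun x hx => ht x ((h2 x).1 hx))
    (fun x hx y hy => hd x ((h2 x).1 hx) y ((h2 y).1 hy)) (s.biUnion t) (by simp [h2])
  rw [← substHom_wedge f hf] at this
  rcases h3 with rfl | rfl
  · exact this
  · rw [map_neg]; exact this.neg

theorem IsOrientation.rename [DecidableEq Y] {s : Finset X} {o : Ext X} (h : IsOrientation s o)
    (p : X → Option Y) (u : Finset Y) (hp : ∀ x ∈ s, ∃ y, p x = some y)
    (hi : ∀ x ∈ s, ∀ x' ∈ s, p x = p x' → x = x') (hu : ∀ y, y ∈ u ↔ ∃ x ∈ s, p x = some y) :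
    IsOrientation u (rename p o) := by
  have hu' : u = s.biUnion (fun x => (p x).toFinset) := by
    ext y; simp [hu]
  rw [hu']
  refine h.substHom _ _ _ ?_ ?_
  · intro x hx
    obtain ⟨y, hy⟩ := hp x hx
    simpa [hy] using isOrientation_gen y
  · intro x hx x' hx' hne
    rw [Finset.disjoint_left]
    intro y hy hy'
    simp only [Option.mem_toFinset, Option.mem_def] at hy hy'
    exact hne (hi x hx x' hx' (hy.trans hy'.symm))

theorem wedge_mul_wedge (l l' : List X) :
    wedge l * wedge l' = (-1 : ℚ) ^ (l.length * l'.length) • (wedge l' * wedge l) := by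
  have h1 : ∀ (x : X) (l' : List X), gen x * wedge l' = (-1 : ℚ) ^ l'.length • (wedge l' * gen x) := by
    intro x l'
    induction l' with
    | nil => simp
    | cons y l' ih =>
      rw [wedge_cons, ← mul_assoc, gen_swap, neg_mul, mul_assoc, ih, mul_smul_comm, ← mul_assoc,
        List.length_cons, pow_succ]
      simp
  induction l with
  | nil => simp
  | cons x l ih =>
    rw [wedge_cons, mul_assoc, ih, mul_smul_comm, ← mul_assoc, h1, smul_mul_assoc, smul_smul,
      mul_assoc, List.length_cons, ← pow_add]
    congr 2
    ring

theorem IsOrientation.anticomm {s t : Finset X} {o o' : Ext X} (h : IsOrientation s o)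
    (h' : IsOrientation t o') (hs : Odd s.card) (ht : Odd t.card) : o * o' = -(o' * o) := by
  classical
  obtain ⟨l, h1, h2, h3⟩ := h
  obtain ⟨l', h1', h2', h3'⟩ := h'
  have e1 : l.length = s.card := by
    rw [← List.toFinset_card_of_nodup h1]; congr 1; ext x; simp [h2]
  have e2 : l'.length = t.card := by
    rw [← List.toFinset_card_of_nodup h1']; congr 1; ext x; simp [h2']
  have := wedge_mul_wedge l l'
  rw [e1, e2, (hs.mul ht).neg_one_pow] at this
  rcases h3 with rfl | rfl <;> rcases h3' with rfl | rfl <;> simp [this]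

theorem IsOrientation.mem {s : Finset X} {o : Ext X} (h : IsOrientation s o) : o ∈ detSpace s :=
  Submodule.subset_span h

end exterior

/-- The composition rule of determinants: `(x ∧ a) ∘_a y = x ∧ y`, where the elements of `X` other
than `a` are renamed by `p` and the elements of `Y` by `q`. The factor `x` is obtained from `x ∧ a`
by contracting with the coordinate form of `a` on the right. -/
def extComp {X Y Z : Type*} (a : X) (p : X → Option Z) (q : Y → Z) :
    Ext X →ₗ[ℚ] Ext Y →ₗ[ℚ] Ext Z :=
  (LinearMap.mul ℚ (Ext Z)).compl₁₂
    ((rename p).toLinearMap ∘ₗ (CliffordAlgebra.contractRight.flip (Finsupp.lapply a)))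
    (rename (fun y => some (q y))).toLinearMap

theorem extComp_apply {X Y Z : Type*} (a : X) (p : X → Option Z) (q : Y → Z) (x : Ext X)
    (y : Ext Y) : extComp a p q x y =
      rename p (CliffordAlgebra.contractRight x (Finsupp.lapply a)) *
        rename (fun y => some (q y)) y := rfl

theorem extComp_mem {X Y Z : Type*} [DecidableEq X] [DecidableEq Z] (a : X) (p : X → Option Z)
    (q : Y → Z) (s : Finset X) (t : Finset Y) (u : Finset Z) (ha : a ∈ s)
    (hp : ∀ x ∈ s, x ≠ a → ∃ z, p x = some z)
    (hpi : ∀ x ∈ s, x ≠ a → ∀ x' ∈ s, x' ≠ a → p x = p x' → x = x')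
    (hq : ∀ y ∈ t, ∀ y' ∈ t, q y = q y' → y = y')
    (hpq : ∀ x ∈ s, x ≠ a → ∀ y ∈ t, p x ≠ some (q y))
    (hu : ∀ z, z ∈ u ↔ (∃ x ∈ s, x ≠ a ∧ p x = some z) ∨ ∃ y ∈ t, q y = z)
    {x : Ext X} {y : Ext Y} (hx : x ∈ detSpace s) (hy : y ∈ detSpace t) :
    extComp a p q x y ∈ detSpace u := by
  refine LinearMap.BilinMap.apply_apply_mem_of_mem_span (detSpace u) _ _ _ ?_ x y hx hy
  intro o ho o' ho'
  rw [extComp_apply]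
  have h1 := (IsOrientation.contractRight ho ha).rename p (u.filter fun z => ∃ x ∈ s, x ≠ a ∧ p x = some z)
    (fun x hx => hp x (Finset.mem_of_mem_erase hx) (Finset.ne_of_mem_erase hx))
    (fun x hx x' hx' => hpi x (Finset.mem_of_mem_erase hx) (Finset.ne_of_mem_erase hx) x'
      (Finset.mem_of_mem_erase hx') (Finset.ne_of_mem_erase hx'))
    (by
      intro z
      simp only [Finset.mem_filter, hu, Finset.mem_erase]
      constructor
      · rintro ⟨-, x, hx, h1, h2⟩; exact ⟨x, ⟨h1, hx⟩, h2⟩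
      · rintro ⟨x, ⟨h1, hx⟩, h2⟩; exact ⟨Or.inl ⟨x, hx, h1, h2⟩, x, hx, h1, h2⟩)
  have h2 := IsOrientation.rename ho' (fun y => some (q y)) (u.filter fun z => ∃ y ∈ t, q y = z)
    (by simp) (by simpa using hq)
    (by
      intro z
      simp only [Finset.mem_filter, hu, Option.some.injEq]
      constructor
      · rintro ⟨-, h⟩; exact h
      · intro h; exact ⟨Or.inr h, h⟩)
  have h3 := h1.mul h2 (by
    rw [Finset.disjoint_left]
    rintro z hz hz'
    simp only [Finset.mem_filter] at hz hz'
    obtain ⟨-, x, hx, hxa, hxz⟩ := hz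
    obtain ⟨-, y, hy, hyz⟩ := hz'
    exact hpq x hx hxa y hy (by rw [hxz, hyz]))
  have h4 : (u.filter fun z => ∃ x ∈ s, x ≠ a ∧ p x = some z) ∪
      (u.filter fun z => ∃ y ∈ t, q y = z) = u := by
    rw [← Finset.filter_or]
    exact Finset.filter_true_of_mem fun z hz => (hu z).1 hz
  rw [h4] at h3
  exact h3.mem
/-! ### Forests of rooted binary trees -/

/-- A forest of rooted binary trees, not planar, with leaves bijectively labelled by `I`.
An edge of the forest is encoded by its cluster, the set of the leaves above it; the clusters of
a forest are exactly the nonempty pairwise nested-or-disjoint sets, containing all singletons,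
each of which is a singleton or the disjoint union of two other ones. An inner vertex is encoded by
the cluster of its outgoing edge, so that inner vertices are the clusters with at least two
elements, and the trees (or the roots) of the forest are the maximal clusters. -/
@[ext]
structure Forest (I : Type*) [Fintype I] [DecidableEq I] where
  clusters : Finset (Finset I)
  singleton_mem : ∀ i, {i} ∈ clusters
  nonempty : ∀ A ∈ clusters, A.Nonempty
  laminar : ∀ A ∈ clusters, ∀ B ∈ clusters, A ⊆ B ∨ B ⊆ A ∨ Disjoint A B
  split : ∀ A ∈ clusters, 1 < A.card →
    ∃ B ∈ clusters, ∃ C ∈ clusters, Disjoint B C ∧ B ∪ C = A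

namespace Forest

variable {I J K : Type*} [Fintype I] [DecidableEq I] [Fintype J] [DecidableEq J]
  [Fintype K] [DecidableEq K]

instance : DecidableEq (Forest I) := fun F G => decidable_of_iff (F.clusters = G.clusters)
  ⟨Forest.ext, fun h => by rw [h]⟩

instance : Fintype (Forest I) :=
  Fintype.ofInjective Forest.clusters fun _ _ h => Forest.ext h

/-- The inner vertices. -/
def verts (F : Forest I) : Finset (Finset I) := F.clusters.filter fun A => 1 < A.card

/-- The roots, i.e. the trees. -/
def roots (F : Forest I) : Finset (Finset I) :=
  F.clusters.filter fun A => ∀ B ∈ F.clusters, A ⊆ B → A = B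

/-- The edges between two inner vertices. -/
def innerEdges (F : Forest I) : Finset (Finset I) := F.verts.filter fun A => A ∉ F.roots

/-- The roots of the trees without inner vertex, where the leaf is joined to the root. -/
def trivialTrees (F : Forest I) : Finset (Finset I) := F.roots.filter fun A => A ∉ F.verts

/-- The root of the tree that contains the leaf `i`. -/
def rootOf (F : Forest I) (i : I) : Finset I := (F.clusters.filter fun A => i ∈ A).sup id

/-- The two incoming edges of the inner vertex `v`. -/
def children (F : Forest I) (v : Finset I) : Finset (Finset I) :=
  F.clusters.filter fun C => C ⊂ v ∧ ∀ D ∈ F.clusters, C ⊂ D → ¬ D ⊂ v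

/-- The inner vertices on the path from the leaf `i` to the root of its tree. -/
def path (F : Forest I) (i : I) : Finset (Finset I) := F.verts.filter fun A => i ∈ A

/-- The set of leaves of the branch that is joined, at the inner vertex `D`, to the path from the
leaf `i` to the root. -/
def branch (F : Forest I) (i : I) (D : Finset I) : Finset I :=
  D.filter fun x => ∀ E ∈ F.clusters, i ∈ E → E ⊂ D → x ∉ E


section lemmas

variable (F : Forest I)

theorem mem_verts {A : Finset I} : A ∈ F.verts ↔ A ∈ F.clusters ∧ 1 < A.card := by
  simp [verts]

theorem mem_roots {A : Finset I} :
    A ∈ F.roots ↔ A ∈ F.clusters ∧ ∀ B ∈ F.clusters, A ⊆ B → A = B := by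
  simp [roots]

theorem mem_path {i : I} {A : Finset I} :
    A ∈ F.path i ↔ A ∈ F.clusters ∧ 1 < A.card ∧ i ∈ A := by
  simp [path, mem_verts, and_assoc]

theorem mem_children {v C : Finset I} : C ∈ F.children v ↔
    C ∈ F.clusters ∧ C ⊂ v ∧ ∀ D ∈ F.clusters, C ⊂ D → ¬ D ⊂ v := by
  simp [children]

theorem mem_branch {i x : I} {D : Finset I} : x ∈ F.branch i D ↔
    x ∈ D ∧ ∀ E ∈ F.clusters, i ∈ E → E ⊂ D → x ∉ E := by
  simp [branch]

theorem chain {A B : Finset I} (hA : A ∈ F.clusters) (hB : B ∈ F.clusters) {x : I} (h : x ∈ A)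
    (h' : x ∈ B) : A ⊆ B ∨ B ⊆ A := by
  rcases F.laminar A hA B hB with h1 | h1 | h1
  · exact Or.inl h1
  · exact Or.inr h1
  · exact absurd h' (Finset.disjoint_left.1 h1 h)

theorem exists_root {A : Finset I} (hA : A ∈ F.clusters) : ∃ r ∈ F.roots, A ⊆ r := by
  obtain ⟨r, hr, hm⟩ := (F.clusters.filter fun B => A ⊆ B).exists_max_image Finset.card
    ⟨A, by simp [hA]⟩
  simp only [Finset.mem_filter, and_imp] at hr hm
  exact ⟨r, F.mem_roots.2 ⟨hr.1, fun B hB hrB =>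
    Finset.eq_of_subset_of_card_le hrB (hm B hB (hr.2.trans hrB))⟩, hr.2⟩

theorem subset_root {r C : Finset I} (hr : r ∈ F.roots) (hC : C ∈ F.clusters) {x : I}
    (h : x ∈ r) (h' : x ∈ C) : C ⊆ r := by
  rw [mem_roots] at hr
  rcases F.chain hr.1 hC h h' with h1 | h1
  · exact (hr.2 C hC h1).ge
  · exact h1

theorem root_unique {r r' : Finset I} (hr : r ∈ F.roots) (hr' : r' ∈ F.roots) {x : I}
    (h : x ∈ r) (h' : x ∈ r') : r = r' :=
  (F.subset_root hr' (F.mem_roots.1 hr).1 h' h).antisymm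
    (F.subset_root hr (F.mem_roots.1 hr').1 h h')

theorem rootOf_eq {r : Finset I} (hr : r ∈ F.roots) {i : I} (h : i ∈ r) : F.rootOf i = r := by
  apply le_antisymm
  · refine Finset.sup_le fun A hA => ?_
    simp only [Finset.mem_filter] at hA
    exact F.subset_root hr hA.1 h hA.2
  · exact Finset.le_sup (f := id) (b := r) (by simp [(F.mem_roots.1 hr).1, h])

theorem rootOf_mem (i : I) : F.rootOf i ∈ F.roots := by
  obtain ⟨r, hr, hi⟩ := F.exists_root (F.singleton_mem i)
  rwa [F.rootOf_eq hr (hi (by simp))]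

theorem mem_rootOf (i : I) : i ∈ F.rootOf i := by
  obtain ⟨r, hr, hi⟩ := F.exists_root (F.singleton_mem i)
  rw [F.rootOf_eq hr (hi (by simp))]
  exact hi (by simp)

theorem ne_rootOf {r : Finset I} (hr : r ∈ F.roots) {i : I} : r ≠ F.rootOf i ↔ i ∉ r := by
  constructor
  · exact fun h h' => h (F.rootOf_eq hr h').symm
  · rintro h rfl
    exact h (F.mem_rootOf i)

theorem exists_branch {i : I} {D : Finset I} (hD : D ∈ F.path i) :
    ∃ B ∈ F.clusters, F.branch i D ∈ F.clusters ∧ i ∈ B ∧ Disjoint B (F.branch i D) ∧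
      B ∪ F.branch i D = D := by
  rw [mem_path] at hD
  have key : ∀ B ∈ F.clusters, ∀ C ∈ F.clusters, Disjoint B C → B ∪ C = D → i ∈ B →
      F.branch i D = C := by
    intro B hB C hC hd hu hi
    ext x
    rw [mem_branch]
    constructor
    · rintro ⟨hx, h⟩
      have hBD : B ⊂ D := by
        rw [← hu]
        refine Finset.ssubset_iff_subset_ne.2 ⟨Finset.subset_union_left, fun h => ?_⟩
        obtain ⟨y, hy⟩ := F.nonempty C hC
        exact Finset.disjoint_left.1 hd (h ▸ Finset.mem_union_right _ hy) hy
      have := h B hB hi hBD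
      rw [← hu, Finset.mem_union] at hx
      tauto
    · intro hx
      refine ⟨hu ▸ Finset.mem_union_right _ hx, fun E hE hiE hED hxE => ?_⟩
      have hiC : i ∉ C := Finset.disjoint_left.1 hd hi
      rcases F.chain hE hC hxE hx with h1 | h1
      · exact hiC (h1 hiE)
      · rcases F.chain hE hB hiE hi with h2 | h2
        · exact Finset.disjoint_left.1 hd (h2 hxE) hx
        · exact hED.2 (hu ▸ Finset.union_subset h2 h1)
  obtain ⟨B, hB, C, hC, hd, hu⟩ := F.split D hD.1 hD.2.1
  rcases Finset.mem_union.1 (hu ▸ hD.2.2 : i ∈ B ∪ C) with hi | hi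
  · have := key B hB C hC hd hu hi
    exact ⟨B, hB, this ▸ hC, hi, this ▸ hd, this ▸ hu⟩
  · rw [Finset.union_comm] at hu
    have := key C hC B hB hd.symm hu hi
    exact ⟨C, hC, this ▸ hB, hi, this ▸ hd.symm, this ▸ hu⟩

theorem branch_mem {i : I} {D : Finset I} (hD : D ∈ F.path i) : F.branch i D ∈ F.clusters := by
  obtain ⟨B, hB, h1, -⟩ := F.exists_branch hD
  exact h1

theorem branch_subset {i : I} {D : Finset I} : F.branch i D ⊆ D := Finset.filter_subset _ _

theorem notMem_branch {i : I} {D : Finset I} (hD : D ∈ F.path i) : i ∉ F.branch i D := by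
  obtain ⟨B, hB, h1, hi, hd, -⟩ := F.exists_branch hD
  exact Finset.disjoint_left.1 hd hi

theorem subset_of_mem_branch {i x : I} {C D : Finset I} (hD : D ∈ F.path i)
    (hC : C ∈ F.clusters) (hi : i ∈ C) (hx : x ∈ F.branch i D) (hxC : x ∈ C) : D ⊆ C := by
  rw [mem_branch] at hx
  rcases F.chain ((F.mem_path.1 hD).1) hC (F.mem_path.1 hD).2.2 hi with h | h
  · exact h
  · by_contra h'
    exact hx.2 C hC hi ⟨h, h'⟩ hxC

theorem branch_unique {i x : I} {D D' : Finset I} (hD : D ∈ F.path i) (hD' : D' ∈ F.path i)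
    (h : x ∈ F.branch i D) (h' : x ∈ F.branch i D') : D = D' := by
  have h1 := F.mem_path.1 hD
  have h2 := F.mem_path.1 hD'
  exact (F.subset_of_mem_branch hD h2.1 h2.2.2 h (F.branch_subset h')).antisymm
    (F.subset_of_mem_branch hD' h1.1 h1.2.2 h' (F.branch_subset h))

theorem exists_mem_branch {i x : I} {C : Finset I} (hC : C ∈ F.clusters) (hi : i ∈ C) (hx : x ∈ C)
    (hxi : x ≠ i) : ∃ D ∈ F.path i, D ⊆ C ∧ x ∈ F.branch i D := by
  obtain ⟨D, hD, hm⟩ := (F.clusters.filter fun D => i ∈ D ∧ x ∈ D).exists_min_image Finset.card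
    ⟨C, by simp [hC, hi, hx]⟩
  simp only [Finset.mem_filter, and_imp] at hD hm
  have hDp : D ∈ F.path i :=
    F.mem_path.2 ⟨hD.1, Finset.one_lt_card.2 ⟨x, hD.2.2, i, hD.2.1, hxi⟩, hD.2.1⟩
  have hxb : x ∈ F.branch i D := F.mem_branch.2 ⟨hD.2.2, fun E hE hiE hED hxE =>
    absurd (Finset.card_lt_card hED) (not_lt.2 (hm E hE hiE hxE))⟩
  exact ⟨D, hDp, F.subset_of_mem_branch hDp hC hi hxb hx, hxb⟩

theorem subset_branch {i x : I} {C D : Finset I} (hD : D ∈ F.path i) (hC : C ∈ F.clusters)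
    (hi : i ∉ C) (hx : x ∈ F.branch i D) (hxC : x ∈ C) : C ⊆ F.branch i D := by
  obtain ⟨B, hB, h1, hiB, hd, hu⟩ := F.exists_branch hD
  have hDc := (F.mem_path.1 hD)
  have hCD : C ⊆ D := by
    rcases F.chain hC hDc.1 hxC (F.branch_subset hx) with h | h
    · exact h
    · exact absurd (h hDc.2.2) hi
  have hxB : x ∉ B := fun h => Finset.disjoint_left.1 hd h hx
  have hCB : Disjoint C B := by
    rcases F.laminar C hC B hB with h | h | h
    · exact absurd (h hxC) hxB
    · exact absurd (h hiB) hi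
    · exact h
  intro y hy
  have := hCD hy
  rw [← hu, Finset.mem_union] at this
  exact this.resolve_left (Finset.disjoint_left.1 hCB hy)

theorem exists_children {v : Finset I} (hv : v ∈ F.verts) : ∃ B ∈ F.clusters, ∃ C ∈ F.clusters,
    Disjoint B C ∧ B ∪ C = v ∧ B ≠ C ∧ F.children v = {B, C} := by
  rw [mem_verts] at hv
  obtain ⟨B, hB, C, hC, hd, hu⟩ := F.split v hv.1 hv.2
  obtain ⟨b, hb⟩ := F.nonempty B hB
  obtain ⟨c, hc⟩ := F.nonempty C hC
  have hbC : b ∉ C := Finset.disjoint_left.1 hd hb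
  have hcB : c ∉ B := fun h => Finset.disjoint_left.1 hd h hc
  have hBv : B ⊂ v := ⟨hu ▸ Finset.subset_union_left, fun h =>
    hcB (h (hu ▸ Finset.mem_union_right _ hc))⟩
  have hCv : C ⊂ v := ⟨hu ▸ Finset.subset_union_right, fun h =>
    hbC (h (hu ▸ Finset.mem_union_left _ hb))⟩
  refine ⟨B, hB, C, hC, hd, hu, fun h => hbC (h ▸ hb), ?_⟩
  have sub : ∀ D ∈ F.clusters, D ⊂ v → D ⊆ B ∨ D ⊆ C := by
    intro D hD hDv
    rcases F.laminar D hD B hB with h | h | h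
    · exact Or.inl h
    · rcases F.laminar D hD C hC with h' | h' | h'
      · exact Or.inr h'
      · exact absurd (hu ▸ Finset.union_subset h h') hDv.2
      · left
        intro x hx
        have := hDv.1 hx
        rw [← hu, Finset.mem_union] at this
        exact this.resolve_right (Finset.disjoint_left.1 h' hx)
    · right
      intro x hx
      have := hDv.1 hx
      rw [← hu, Finset.mem_union] at this
      exact this.resolve_left (Finset.disjoint_left.1 h hx)
  ext D
  rw [mem_children, Finset.mem_insert, Finset.mem_singleton]
  constructor
  · rintro ⟨hD, hDv, hm⟩
    rcases sub D hD hDv with h | h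
    · left
      by_contra hne
      exact hm B hB (Finset.ssubset_iff_subset_ne.2 ⟨h, hne⟩) hBv
    · right
      by_contra hne
      exact hm C hC (Finset.ssubset_iff_subset_ne.2 ⟨h, hne⟩) hCv
  · rintro (rfl | rfl)
    · refine ⟨hB, hBv, fun E hE hDE hEv => ?_⟩
      rcases sub E hE hEv with h | h
      · exact hDE.2 h
      · exact hbC (h (hDE.1 hb))
    · refine ⟨hC, hCv, fun E hE hDE hEv => ?_⟩
      rcases sub E hE hEv with h | h
      · exact hcB (h (hDE.1 hc))
      · exact hDE.2 h

theorem children_unique {v w C : Finset I} (hv : v ∈ F.clusters) (hw : w ∈ F.clusters)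
    (h : C ∈ F.children v) (h' : C ∈ F.children w) : v = w := by
  rw [mem_children] at h h'
  obtain ⟨x, hx⟩ := F.nonempty C h.1
  rcases F.chain hv hw (h.2.1.1 hx) (h'.2.1.1 hx) with h1 | h1
  · by_contra hne
    exact h'.2.2 v hv h.2.1 (Finset.ssubset_iff_subset_ne.2 ⟨h1, hne⟩)
  · by_contra hne
    exact h.2.2 w hw h'.2.1 (Finset.ssubset_iff_subset_ne.2 ⟨h1, Ne.symm hne⟩)

theorem exists_parent {C : Finset I} (hC : C ∈ F.clusters) (hr : C ∉ F.roots) :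
    ∃ v ∈ F.verts, C ∈ F.children v := by
  have : ∃ B ∈ F.clusters, C ⊂ B := by
    by_contra! hn
    exact hr (F.mem_roots.2 ⟨hC, fun B hB hCB => by
      by_contra hne
      exact hn B hB (Finset.ssubset_iff_subset_ne.2 ⟨hCB, hne⟩)⟩)
  obtain ⟨B, hB, hCB⟩ := this
  obtain ⟨v, hv, hm⟩ := (F.clusters.filter fun D => C ⊂ D).exists_min_image Finset.card
    ⟨B, by simp [hB, hCB]⟩
  simp only [Finset.mem_filter, and_imp] at hv hm
  refine ⟨v, F.mem_verts.2 ⟨hv.1, ?_⟩, F.mem_children.2 ⟨hC, hv.2, fun D hD hCD hDv =>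
    absurd (Finset.card_lt_card hDv) (not_lt.2 (hm D hD hCD))⟩⟩
  have h1 := Finset.card_lt_card hv.2
  have h2 := Finset.card_pos.2 (F.nonempty C hC)
  omega

theorem notMem_roots_of_mem_children {v C : Finset I} (hv : v ∈ F.clusters)
    (h : C ∈ F.children v) : C ∉ F.roots := by
  rw [mem_children] at h
  intro hr
  exact h.2.1.ne ((F.mem_roots.1 hr).2 v hv h.2.1.1)

theorem roots_eq (s : Finset (Finset I)) (h1 : ∀ A ∈ s, A ∈ F.clusters)
    (h2 : ∀ A ∈ F.clusters, ∃ B ∈ s, A ⊆ B)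
    (h3 : ∀ A ∈ s, ∀ B ∈ s, ∀ x, x ∈ A → x ∈ B → A = B) : F.roots = s := by
  ext A
  rw [mem_roots]
  constructor
  · rintro ⟨hA, hm⟩
    obtain ⟨B, hB, hAB⟩ := h2 A hA
    rwa [hm B (h1 B hB) hAB]
  · intro hA
    refine ⟨h1 A hA, fun B hB hAB => ?_⟩
    obtain ⟨C, hC, hBC⟩ := h2 B hB
    obtain ⟨x, hx⟩ := F.nonempty A (h1 A hA)
    have := h3 A hA C hC x hx (hBC (hAB hx))
    exact hAB.antisymm (this ▸ hBC)

end lemmas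

/-! ### Grafting -/

/-- For a bijection `e` of `(I ∖ {i}) ⊔ J` with `K`, the subset `(S ∖ {i}) ⊔ A` of `K`. -/
def glue {i : I} (e : {x : I // x ≠ i} ⊕ J ≃ K) (S : Finset I) (A : Finset J) : Finset K :=
  ((S.subtype (fun x => x ≠ i)).disjSum A).map e.toEmbedding

section glue

variable {i : I} (e : {x : I // x ≠ i} ⊕ J ≃ K)

@[simp] theorem mem_glue_inl {S : Finset I} {A : Finset J} {x : {x : I // x ≠ i}} :
    e (Sum.inl x) ∈ glue e S A ↔ x.1 ∈ S := by
  simp [glue]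

@[simp] theorem mem_glue_inr {S : Finset I} {A : Finset J} {y : J} :
    e (Sum.inr y) ∈ glue e S A ↔ y ∈ A := by
  simp [glue]

theorem forall_glue {p : K → Prop} :
    (∀ k, p k) ↔ (∀ x, p (e (Sum.inl x))) ∧ ∀ y, p (e (Sum.inr y)) := by
  rw [← e.forall_congr_right, Sum.forall]

theorem glue_subset {S S' : Finset I} {A A' : Finset J} :
    glue e S A ⊆ glue e S' A' ↔ (∀ x ∈ S, x ≠ i → x ∈ S') ∧ A ⊆ A' := by
  simp only [Finset.subset_iff, forall_glue e, mem_glue_inl, mem_glue_inr, Subtype.forall]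
  tauto

theorem glue_disjoint {S S' : Finset I} {A A' : Finset J} :
    Disjoint (glue e S A) (glue e S' A') ↔ (∀ x ∈ S, x ≠ i → x ∉ S') ∧ Disjoint A A' := by
  simp only [Finset.disjoint_left, forall_glue e, mem_glue_inl, mem_glue_inr, Subtype.forall]
  tauto

theorem glue_union {S S' : Finset I} {A A' : Finset J} :
    glue e S A ∪ glue e S' A' = glue e (S ∪ S') (A ∪ A') := by
  rw [Finset.ext_iff, forall_glue e]
  simp

theorem exists_mem_glue {S : Finset I} {A : Finset J} {p : K → Prop} :
    (∃ k ∈ glue e S A, p k) ↔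
      (∃ x, ∃ h : x ≠ i, x ∈ S ∧ p (e (Sum.inl ⟨x, h⟩))) ∨ ∃ y ∈ A, p (e (Sum.inr y)) := by
  constructor
  · rintro ⟨k, hk, hp⟩
    obtain ⟨z, rfl⟩ := e.surjective k
    rcases z with ⟨x, hx⟩ | y
    · exact Or.inl ⟨x, hx, by simpa using hk, hp⟩
    · exact Or.inr ⟨y, by simpa using hk, hp⟩
  · rintro (⟨x, hx, h1, h2⟩ | ⟨y, h1, h2⟩)
    · exact ⟨_, by simpa using h1, h2⟩
    · exact ⟨_, by simpa using h1, h2⟩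

theorem glue_singleton_left (x : {x : I // x ≠ i}) :
    glue e {x.1} ∅ = {e (Sum.inl x)} := by
  rw [Finset.ext_iff, forall_glue e]
  simp [Subtype.ext_iff]

theorem glue_singleton_right (y : J) : glue e ∅ {y} = {e (Sum.inr y)} := by
  rw [Finset.ext_iff, forall_glue e]
  simp

end glue

section graft

variable (F : Forest I) (i : I) (G : Forest J)
  (c : {D // D ∈ F.path i} → {A // A ∈ G.roots})

/-- The union of the branches that are joined to the path from `i` to the root at those inner
vertices `D ⊆ C` to which the tree `A` is assigned by `c`. -/
def lump (C : Finset I) (A : Finset J) : Finset I :=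
  (Finset.univ.filter fun D : {D // D ∈ F.path i} => D.1 ⊆ C ∧ (c D).1 = A).biUnion
    fun D => F.branch i D.1

theorem mem_lump {C : Finset I} {A : Finset J} {x : I} : x ∈ lump F i G c C A ↔
    ∃ D : {D // D ∈ F.path i}, (D.1 ⊆ C ∧ (c D).1 = A) ∧ x ∈ F.branch i D.1 := by
  simp [lump]

variable {i}
variable (e : {x : I // x ≠ i} ⊕ J ≃ K)

/-- The clusters of a graft, see `Forest.graft`. -/
def graftClusters : Finset (Finset K) :=
  ((F.clusters.filter fun C => i ∉ C).image fun C => glue e C ∅) ∪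
    (G.clusters.image fun A => glue e ∅ A) ∪
    Finset.univ.image fun D : {D // D ∈ F.path i} => glue e (lump F i G c D.1 (c D).1) (c D).1

theorem mem_graftClusters {S : Finset K} : S ∈ graftClusters F G c e ↔
    (∃ C ∈ F.clusters, i ∉ C ∧ S = glue e C ∅) ∨ (∃ A ∈ G.clusters, S = glue e ∅ A) ∨
      ∃ D : {D // D ∈ F.path i}, S = glue e (lump F i G c D.1 (c D).1) (c D).1 := by
  simp only [graftClusters, Finset.mem_union, Finset.mem_image, Finset.mem_filter,
    Finset.mem_univ, true_and, or_assoc, eq_comm (a := S), and_assoc]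

theorem lump_subset {C : Finset I} {A : Finset J} {x : I} (hC : C ∈ F.clusters) (hi : i ∉ C)
    {B : Finset I} (hx : x ∈ C) (hx' : x ∈ lump F i G c B A) : C ⊆ lump F i G c B A := by
  rw [mem_lump] at hx'
  obtain ⟨D, hD, hxD⟩ := hx'
  intro y hy
  exact (mem_lump F i G c).2 ⟨D, hD, F.subset_branch D.2 hC hi hxD hx hy⟩

theorem lump_disjoint {C C' : Finset I} {A A' : Finset J} (h : A ≠ A') {x : I}
    (hx : x ∈ lump F i G c C A) : x ∉ lump F i G c C' A' := by
  rw [mem_lump] at hx ⊢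
  rintro ⟨D', hD', hx'⟩
  obtain ⟨D, hD, hx⟩ := hx
  have : D = D' := Subtype.ext (F.branch_unique D.2 D'.2 hx hx')
  subst this
  exact h (hD.2.symm.trans hD'.2)

theorem notMem_lump {C : Finset I} {A : Finset J} : i ∉ lump F i G c C A := by
  rw [mem_lump]
  rintro ⟨D, -, h⟩
  exact F.notMem_branch D.2 h

theorem root_disjoint {A A' : Finset J} (hA : A ∈ G.roots) (hA' : A' ∈ G.roots) (h : A ≠ A') :
    Disjoint A A' := by
  rw [Finset.disjoint_left]
  exact fun x hx hx' => h (G.root_unique hA hA' hx hx')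

/-- Let `T` be the tree of `F` that contains the leaf `i`. The forest obtained by grafting the
trees of `G` into `F`, when the tree `c D` is assigned to each inner vertex `D` of the path from
`i` to the root of `T`: the trees of `F` other than `T` are kept, the path is removed from `T`, and
then, going down along the path, the branch of `T` at the inner vertex `D` is joined by a new
inner vertex to the tree that contains `c D`. The leaves are labelled by `K` through `e`. -/
def graft : Forest K where
  clusters := graftClusters F G c e
  singleton_mem := by
    rw [forall_glue e]
    refine ⟨fun x => ?_, fun y => ?_⟩
    · rw [mem_graftClusters, ← glue_singleton_left]
      exact Or.inl ⟨{x.1}, F.singleton_mem _, by simpa using x.2.symm, rfl⟩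
    · rw [mem_graftClusters, ← glue_singleton_right]
      exact Or.inr (Or.inl ⟨_, G.singleton_mem _, rfl⟩)
  nonempty := by
    intro S hS
    rw [mem_graftClusters] at hS
    rcases hS with ⟨C, hC, hi, rfl⟩ | ⟨A, hA, rfl⟩ | ⟨D, rfl⟩
    · obtain ⟨x, hx⟩ := F.nonempty C hC
      exact ⟨e (Sum.inl ⟨x, fun h => hi (h ▸ hx)⟩), by simpa using hx⟩
    · obtain ⟨y, hy⟩ := G.nonempty A hA
      exact ⟨e (Sum.inr y), by simpa using hy⟩
    · obtain ⟨y, hy⟩ := G.nonempty _ (G.mem_roots.1 (c D).2).1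
      exact ⟨e (Sum.inr y), by simpa using hy⟩
  laminar := by
    have c13 : ∀ C ∈ F.clusters, i ∉ C → ∀ D : {D // D ∈ F.path i},
        glue e C ∅ ⊆ glue e (lump F i G c D.1 (c D).1) (c D).1 ∨
        Disjoint (glue e C ∅) (glue e (lump F i G c D.1 (c D).1) (c D).1) := by
      intro C hC hi D
      rw [glue_subset, glue_disjoint]
      by_cases h : ∃ x ∈ C, x ∈ lump F i G c D.1 (c D).1
      · obtain ⟨x, hx, hx'⟩ := h
        exact Or.inl ⟨fun y hy _ => lump_subset F G c hC hi hx hx' hy, by simp⟩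
      · push Not at h
        exact Or.inr ⟨fun y hy _ => h y hy, by simp⟩
    have c23 : ∀ A ∈ G.clusters, ∀ D : {D // D ∈ F.path i},
        glue e ∅ A ⊆ glue e (lump F i G c D.1 (c D).1) (c D).1 ∨
        Disjoint (glue e ∅ A) (glue e (lump F i G c D.1 (c D).1) (c D).1) := by
      intro A hA D
      rw [glue_subset, glue_disjoint]
      by_cases h : ∃ x ∈ A, x ∈ (c D).1
      · obtain ⟨x, hx, hx'⟩ := h
        exact Or.inl ⟨by simp, G.subset_root (c D).2 hA hx' hx⟩
      · push Not at h
        exact Or.inr ⟨by simp, Finset.disjoint_left.2 h⟩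
    have c33 : ∀ D D' : {D // D ∈ F.path i}, D.1 ⊆ D'.1 →
        glue e (lump F i G c D.1 (c D).1) (c D).1 ⊆ glue e (lump F i G c D'.1 (c D').1) (c D').1 ∨
        Disjoint (glue e (lump F i G c D.1 (c D).1) (c D).1)
          (glue e (lump F i G c D'.1 (c D').1) (c D').1) := by
      intro D D' h
      rw [glue_subset, glue_disjoint]
      by_cases hc : c D = c D'
      · rw [hc]
        refine Or.inl ⟨fun x hx _ => ?_, subset_rfl⟩
        rw [mem_lump] at hx ⊢
        obtain ⟨E, hE, hx⟩ := hx
        exact ⟨E, ⟨hE.1.trans h, hE.2⟩, hx⟩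
      · have hc' : (c D).1 ≠ (c D').1 := fun h => hc (Subtype.ext h)
        exact Or.inr ⟨fun x hx _ => lump_disjoint F G c hc' hx,
          root_disjoint G (c D).2 (c D').2 hc'⟩
    intro S hS S' hS'
    rw [mem_graftClusters] at hS hS'
    rcases hS with ⟨C, hC, hi, rfl⟩ | ⟨A, hA, rfl⟩ | ⟨D, rfl⟩ <;>
      rcases hS' with ⟨C', hC', hi', rfl⟩ | ⟨A', hA', rfl⟩ | ⟨D', rfl⟩
    · simp only [glue_subset, glue_disjoint]
      rcases F.laminar C hC C' hC' with h | h | h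
      · exact Or.inl ⟨fun x hx _ => h hx, by simp⟩
      · exact Or.inr (Or.inl ⟨fun x hx _ => h hx, by simp⟩)
      · exact Or.inr (Or.inr ⟨fun x hx _ => Finset.disjoint_left.1 h hx, by simp⟩)
    · exact Or.inr (Or.inr ((glue_disjoint e).2 ⟨by simp, by simp⟩))
    · rcases c13 C hC hi D' with h | h
      · exact Or.inl h
      · exact Or.inr (Or.inr h)
    · exact Or.inr (Or.inr ((glue_disjoint e).2 ⟨by simp, by simp⟩))
    · simp only [glue_subset, glue_disjoint]
      rcases G.laminar A hA A' hA' with h | h | h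
      · exact Or.inl ⟨by simp, h⟩
      · exact Or.inr (Or.inl ⟨by simp, h⟩)
      · exact Or.inr (Or.inr ⟨by simp, h⟩)
    · rcases c23 A hA D' with h | h
      · exact Or.inl h
      · exact Or.inr (Or.inr h)
    · rcases c13 C' hC' hi' D with h | h
      · exact Or.inr (Or.inl h)
      · exact Or.inr (Or.inr h.symm)
    · rcases c23 A' hA' D with h | h
      · exact Or.inr (Or.inl h)
      · exact Or.inr (Or.inr h.symm)
    · have h1 := F.mem_path.1 D.2
      have h2 := F.mem_path.1 D'.2
      rcases F.chain h1.1 h2.1 h1.2.2 h2.2.2 with h | h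
      · rcases c33 D D' h with h | h
        · exact Or.inl h
        · exact Or.inr (Or.inr h)
      · rcases c33 D' D h with h | h
        · exact Or.inr (Or.inl h)
        · exact Or.inr (Or.inr h.symm)
  split := by
    intro S hS hcard
    rw [mem_graftClusters] at hS
    rcases hS with ⟨C, hC, hi, rfl⟩ | ⟨A, hA, rfl⟩ | ⟨D, rfl⟩
    · have hC1 : 1 < C.card := by
        obtain ⟨k, hk, k', hk', hne⟩ := Finset.one_lt_card.1 hcard
        obtain ⟨z, rfl⟩ := e.surjective k
        obtain ⟨z', rfl⟩ := e.surjective k'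
        rcases z with x | y <;> rcases z' with x' | y' <;> simp at hk hk'
        refine Finset.one_lt_card.2 ⟨x, hk, x', hk', fun h => hne ?_⟩
        rw [Subtype.ext h]
      obtain ⟨B, hB, B', hB', hd, hu⟩ := F.split C hC hC1
      refine ⟨glue e B ∅, (mem_graftClusters F G c e).2 (Or.inl ⟨B, hB, fun h => hi ?_, rfl⟩),
        glue e B' ∅, (mem_graftClusters F G c e).2 (Or.inl ⟨B', hB', fun h => hi ?_, rfl⟩),
        (glue_disjoint e).2 ⟨fun x hx _ => Finset.disjoint_left.1 hd hx, by simp⟩, ?_⟩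
      · exact hu ▸ Finset.mem_union_left _ h
      · exact hu ▸ Finset.mem_union_right _ h
      · rw [glue_union, hu]; simp
    · have hC1 : 1 < A.card := by
        obtain ⟨k, hk, k', hk', hne⟩ := Finset.one_lt_card.1 hcard
        obtain ⟨z, rfl⟩ := e.surjective k
        obtain ⟨z', rfl⟩ := e.surjective k'
        rcases z with x | y <;> rcases z' with x' | y' <;> simp at hk hk'
        exact Finset.one_lt_card.2 ⟨y, hk, y', hk', fun h => hne (by rw [h])⟩
      obtain ⟨B, hB, B', hB', hd, hu⟩ := G.split A hA hC1
      refine ⟨glue e ∅ B, (mem_graftClusters F G c e).2 (Or.inr (Or.inl ⟨B, hB, rfl⟩)),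
        glue e ∅ B', (mem_graftClusters F G c e).2 (Or.inr (Or.inl ⟨B', hB', rfl⟩)),
        (glue_disjoint e).2 ⟨by simp, hd⟩, ?_⟩
      rw [glue_union, hu]; simp
    · have hb : glue e (F.branch i D.1) ∅ ∈ graftClusters F G c e :=
        (mem_graftClusters F G c e).2
          (Or.inl ⟨_, F.branch_mem D.2, F.notMem_branch D.2, rfl⟩)
      by_cases hE : ∃ E : {D // D ∈ F.path i}, E.1 ⊂ D.1 ∧ c E = c D
      · obtain ⟨E, hE, hm⟩ := (Finset.univ.filter fun E : {D // D ∈ F.path i} =>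
          E.1 ⊂ D.1 ∧ c E = c D).exists_max_image (fun E => E.1.card)
          (by obtain ⟨E, hE⟩ := hE; exact ⟨E, by simpa using hE⟩)
        simp only [Finset.mem_filter, Finset.mem_univ, true_and, and_imp] at hE hm
        have hl : lump F i G c D.1 (c D).1 = lump F i G c E.1 (c E).1 ∪ F.branch i D.1 := by
          ext x
          rw [Finset.mem_union, mem_lump, mem_lump]
          constructor
          · rintro ⟨E', ⟨h1, h2⟩, h3⟩
            rcases h1.eq_or_ssubset with h1 | h1
            · exact Or.inr (h1 ▸ h3)
            · refine Or.inl ⟨E', ⟨?_, h2.trans (by rw [hE.2])⟩, h3⟩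
              have p1 := F.mem_path.1 E.2
              have p2 := F.mem_path.1 E'.2
              rcases F.chain p2.1 p1.1 p2.2.2 p1.2.2 with h4 | h4
              · exact h4
              · exact (Finset.eq_of_subset_of_card_le h4
                  (hm E' h1 (Subtype.ext h2))).ge
          · rintro (⟨E', ⟨h1, h2⟩, h3⟩ | h)
            · exact ⟨E', ⟨h1.trans hE.1.1, h2.trans (by rw [hE.2])⟩, h3⟩
            · exact ⟨D, ⟨subset_rfl, rfl⟩, h⟩
        refine ⟨_, (mem_graftClusters F G c e).2 (Or.inr (Or.inr ⟨E, rfl⟩)), _, hb, ?_, ?_⟩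
        · rw [glue_disjoint]
          refine ⟨fun x hx _ hx' => ?_, by simp⟩
          rw [mem_lump] at hx
          obtain ⟨E', ⟨h1, h2⟩, h3⟩ := hx
          have := F.branch_unique E'.2 D.2 h3 hx'
          rw [this] at h1
          exact hE.1.2 h1
        · rw [glue_union, hl, hE.2]
          simp
      · push Not at hE
        have hl : lump F i G c D.1 (c D).1 = F.branch i D.1 := by
          ext x
          rw [mem_lump]
          constructor
          · rintro ⟨E', ⟨h1, h2⟩, h3⟩
            rcases h1.eq_or_ssubset with h1 | h1
            · exact h1 ▸ h3
            · exact absurd (Subtype.ext h2) (hE E' h1)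
          · intro h
            exact ⟨D, ⟨subset_rfl, rfl⟩, h⟩
        refine ⟨glue e ∅ (c D).1, (mem_graftClusters F G c e).2
          (Or.inr (Or.inl ⟨_, (G.mem_roots.1 (c D).2).1, rfl⟩)), _, hb,
          (glue_disjoint e).2 ⟨by simp, by simp⟩, ?_⟩
        rw [glue_union, hl]
        simp

/-- The root, in the graft, of the tree that contains the tree `A` of `G`. -/
def graftRoot (A : Finset J) : Finset K := glue e (lump F i G c Finset.univ A) A

theorem mem_roots_graft {S : Finset K} : S ∈ (graft F G c e).roots ↔
    (∃ r ∈ F.roots, r ≠ F.rootOf i ∧ glue e r ∅ = S) ∨ ∃ A ∈ G.roots, graftRoot F G c e A = S := by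
  have : (graft F G c e).roots =
      ((F.roots.filter fun r => i ∉ r).image fun r => glue e r ∅) ∪
        G.roots.image (graftRoot F G c e) := by
    apply roots_eq
    · intro S hS
      simp only [Finset.mem_union, Finset.mem_image, Finset.mem_filter] at hS
      change S ∈ graftClusters F G c e
      rw [mem_graftClusters]
      rcases hS with ⟨r, ⟨hr, hi⟩, rfl⟩ | ⟨A, hA, rfl⟩
      · exact Or.inl ⟨r, (F.mem_roots.1 hr).1, hi, rfl⟩
      · right
        by_cases h : ∃ D, c D = ⟨A, hA⟩
        · right
          obtain ⟨D, hD, hm⟩ := (Finset.univ.filter fun D => c D = ⟨A, hA⟩).exists_max_image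
            (fun E => E.1.card) (by obtain ⟨D, hD⟩ := h; exact ⟨D, by simpa using hD⟩)
          simp only [Finset.mem_filter, Finset.mem_univ, true_and] at hD hm
          refine ⟨D, ?_⟩
          rw [hD, graftRoot]
          congr 1
          ext x
          rw [mem_lump, mem_lump]
          constructor
          · rintro ⟨E, ⟨-, h1⟩, h2⟩
            refine ⟨E, ⟨?_, h1⟩, h2⟩
            have p1 := F.mem_path.1 E.2
            have p2 := F.mem_path.1 D.2
            rcases F.chain p1.1 p2.1 p1.2.2 p2.2.2 with h4 | h4
            · exact h4
            · exact (Finset.eq_of_subset_of_card_le h4 (hm E (Subtype.ext h1))).ge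
          · rintro ⟨E, ⟨-, h1⟩, h2⟩
            exact ⟨E, ⟨Finset.subset_univ _, h1⟩, h2⟩
        · left
          refine ⟨A, (G.mem_roots.1 hA).1, ?_⟩
          rw [graftRoot]
          congr 1
          rw [Finset.eq_empty_iff_forall_notMem]
          intro x hx
          rw [mem_lump] at hx
          obtain ⟨E, ⟨-, h1⟩, h2⟩ := hx
          exact h ⟨E, Subtype.ext h1⟩
    · intro S hS
      change S ∈ graftClusters F G c e at hS
      have key : ∀ A ∈ G.roots, graftRoot F G c e A ∈
          ((F.roots.filter fun r => i ∉ r).image fun r => glue e r ∅) ∪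
            G.roots.image (graftRoot F G c e) := fun A hA =>
        Finset.mem_union_right _ (Finset.mem_image_of_mem _ hA)
      rw [mem_graftClusters] at hS
      rcases hS with ⟨C, hC, hi, rfl⟩ | ⟨A, hA, rfl⟩ | ⟨D, rfl⟩
      · obtain ⟨r, hr, hCr⟩ := F.exists_root hC
        by_cases hir : i ∈ r
        · obtain ⟨x, hx⟩ := F.nonempty C hC
          obtain ⟨D, hD, -, hxD⟩ := F.exists_mem_branch (F.mem_roots.1 hr).1 hir (hCr hx)
            (fun h => hi (h ▸ hx))
          refine ⟨_, key _ (c ⟨D, hD⟩).2, ?_⟩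
          rw [graftRoot, glue_subset]
          refine ⟨fun y hy _ => ?_, by simp⟩
          rw [mem_lump]
          exact ⟨⟨D, hD⟩, ⟨Finset.subset_univ _, rfl⟩, F.subset_branch hD hC hi hxD hx hy⟩
        · refine ⟨glue e r ∅, Finset.mem_union_left _ (Finset.mem_image_of_mem _ ?_), ?_⟩
          · simp [hr, hir]
          · exact (glue_subset e).2 ⟨fun x hx _ => hCr hx, subset_rfl⟩
      · obtain ⟨r, hr, hCr⟩ := G.exists_root hA
        exact ⟨_, key r hr, (glue_subset e).2 ⟨by simp, hCr⟩⟩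
      · refine ⟨_, key _ (c D).2, (glue_subset e).2 ⟨fun x hx _ => ?_, subset_rfl⟩⟩
        rw [mem_lump] at hx ⊢
        obtain ⟨E, ⟨-, h1⟩, h2⟩ := hx
        exact ⟨E, ⟨Finset.subset_univ _, h1⟩, h2⟩
    · have c12 : ∀ r ∈ F.roots, i ∉ r → ∀ A x, x ∈ glue e r ∅ →
          x ∉ graftRoot F G c e A := by
        intro r hr hi A x hx0
        have hd : Disjoint (glue e r ∅) (graftRoot F G c e A) := by
          rw [graftRoot, glue_disjoint]
          refine ⟨fun x hx _ hx' => hi ?_, Finset.disjoint_empty_left A⟩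
          rw [mem_lump] at hx'
          obtain ⟨E, -, h2⟩ := hx'
          have p := F.mem_path.1 E.2
          exact F.subset_root hr p.1 hx (F.branch_subset h2) p.2.2
        exact Finset.disjoint_left.1 hd hx0
      intro S hS S' hS' k hk hk'
      simp only [Finset.mem_union, Finset.mem_image, Finset.mem_filter] at hS hS'
      rcases hS with ⟨r, ⟨hr, hi⟩, rfl⟩ | ⟨A, hA, rfl⟩ <;>
        rcases hS' with ⟨r', ⟨hr', hi'⟩, rfl⟩ | ⟨A', hA', rfl⟩
      · obtain ⟨z, rfl⟩ := e.surjective k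
        rcases z with x | y <;> simp at hk hk'
        rw [F.root_unique hr hr' hk hk']
      · exact absurd hk' (c12 r hr hi _ _ hk)
      · exact absurd hk (c12 r' hr' hi' _ _ hk')
      · by_contra hne
        have hAA : A ≠ A' := fun h => hne (by rw [h])
        exact Finset.disjoint_left.1 ((glue_disjoint e).2
          ⟨fun x hx _ => lump_disjoint F G c hAA hx, root_disjoint G hA hA' hAA⟩) hk hk'
  rw [this]
  simp only [Finset.mem_union, Finset.mem_image, Finset.mem_filter]
  refine or_congr (exists_congr fun r => ?_) Iff.rfl
  constructor
  · rintro ⟨⟨h1, h2⟩, h3⟩; exact ⟨h1, (F.ne_rootOf h1).2 h2, h3⟩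
  · rintro ⟨h1, h2, h3⟩; exact ⟨⟨h1, (F.ne_rootOf h1).1 h2⟩, h3⟩

/-- The composition rule of determinants sends root-orientations of `F` and of `G` to
root-orientations of the graft. -/
theorem extComp_graft_mem {x : Ext (Finset I)} {y : Ext (Finset J)} (hx : x ∈ detSpace F.roots)
    (hy : y ∈ detSpace G.roots) :
    extComp (F.rootOf i) (fun r => some (glue e r ∅)) (graftRoot F G c e) x y ∈
      detSpace (graft F G c e).roots := by
  refine extComp_mem _ _ _ F.roots G.roots _ (F.rootOf_mem i) (fun r _ _ => ⟨_, rfl⟩) ?_ ?_ ?_ ?_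
    hx hy
  · intro r hr hri r' hr' hri' h
    obtain ⟨x, hx⟩ := F.nonempty r (F.mem_roots.1 hr).1
    have hxi : x ≠ i := fun h => (F.ne_rootOf hr).1 hri (h ▸ hx)
    have h1 : e (Sum.inl ⟨x, hxi⟩) ∈ glue e r ∅ := by simpa using hx
    rw [Option.some.inj h] at h1
    exact F.root_unique hr hr' hx (by simpa using h1)
  · intro A hA A' hA' h
    obtain ⟨y, hy⟩ := G.nonempty A (G.mem_roots.1 hA).1
    have h1 : e (Sum.inr y) ∈ graftRoot F G c e A := by simpa [graftRoot] using hy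
    rw [h] at h1
    exact G.root_unique hA hA' hy (by simpa [graftRoot] using h1)
  · intro r hr hri A hA h
    obtain ⟨y, hy⟩ := G.nonempty A (G.mem_roots.1 hA).1
    have h1 : e (Sum.inr y) ∈ graftRoot F G c e A := by simpa [graftRoot] using hy
    rw [← Option.some.inj h] at h1
    simp at h1
  · intro S
    rw [mem_roots_graft]
    simp

end graft

end Forest

/-! ### The operads -/

section operads

variable {I J K : Type*} [Fintype I] [DecidableEq I] [Fintype J] [DecidableEq J]
  [Fintype K] [DecidableEq K]

variable (I) in
/-- The space `Det(I)` of the operad `Det`. It is in degree `|I| - 1`. -/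
abbrev OpDet : Submodule ℚ (Ext I) := detSpace (Finset.univ : Finset I)

variable (I) in
/-- The space `B(I)` of the operad `B`, with basis the root-oriented forests `o ⊗ F` on `I`
(one of the two orientations `o` of the roots of `F` being fixed for each forest `F`): an element
is given by its components in the determinant lines of the sets of roots of the forests. The
component of `F` is in degree `|roots of F| - 1`. -/
abbrev OpB : Submodule ℚ (Forest I → Ext (Finset I)) :=
  Submodule.pi Set.univ fun F : Forest I => detSpace F.roots

variable (I) in
/-- The space `Bess(I)` of the operad `Bess = Det ⊗ B`. -/
abbrev Bess : Type _ := OpDet I ⊗[ℚ] OpB I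

variable {i : I} (e : {x : I // x ≠ i} ⊕ J ≃ K)

/-- The inclusion of `I ∖ {i}` in `K`. -/
def leafInl (x : I) : Option K := if h : x ≠ i then some (e (Sum.inl ⟨x, h⟩)) else none

theorem extComp_leaf_mem {x : Ext I} {y : Ext J} (hx : x ∈ OpDet I) (hy : y ∈ OpDet J) :
    extComp i (leafInl e) (fun y => e (Sum.inr y)) x y ∈ OpDet K := by
  refine extComp_mem _ _ _ Finset.univ Finset.univ _ (Finset.mem_univ _) ?_ ?_ ?_ ?_ ?_ hx hy
  · intro x _ hx
    simp [leafInl, hx]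
  · intro x _ hx x' _ hx'
    simp [leafInl, hx, hx']
  · simp
  · intro x _ hx
    simp [leafInl, hx]
  · intro z
    obtain ⟨z, rfl⟩ := e.surjective z
    rcases z with ⟨x, hx⟩ | y
    · simp only [Finset.mem_univ, true_and, true_iff]
      exact Or.inl ⟨x, hx, by simp [leafInl, hx]⟩
    · simp

/-- The composition `∘_i : Det(I) ⊗ Det(J) → Det(K)`, where `K` is the set `(I ∖ {i}) ⊔ J`, with
`(x ∧ i) ∘_i y = x ∧ y`. -/
def detComp : OpDet I →ₗ[ℚ] OpDet J →ₗ[ℚ] OpDet K :=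
  LinearMap.mk₂ ℚ
    (fun x y => ⟨extComp i (leafInl e) (fun y => e (Sum.inr y)) x y, extComp_leaf_mem e x.2 y.2⟩)
    (fun x x' y => Subtype.ext (by simp)) (fun a x y => Subtype.ext (by simp))
    (fun x y y' => Subtype.ext (by simp)) (fun a x y => Subtype.ext (by simp))

/-- The composition of `B` on families of elements of exterior algebras. -/
def bCompAux : (Forest I → Ext (Finset I)) →ₗ[ℚ] (Forest J → Ext (Finset J)) →ₗ[ℚ]
    (Forest K → Ext (Finset K)) :=
  ∑ F : Forest I, ∑ G : Forest J, ∑ c : {D // D ∈ F.path i} → {A // A ∈ G.roots},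
    ((extComp (F.rootOf i) (fun r => some (Forest.glue e r ∅)) (Forest.graftRoot F G c e)).compl₁₂
      (LinearMap.proj F) (LinearMap.proj G)).compr₂
      (LinearMap.single ℚ (fun _ : Forest K => Ext (Finset K)) (Forest.graft F G c e))

theorem bCompAux_mem {x : Forest I → Ext (Finset I)} {y : Forest J → Ext (Finset J)}
    (hx : x ∈ OpB I) (hy : y ∈ OpB J) : bCompAux e x y ∈ OpB K := by
  simp only [bCompAux, LinearMap.sum_apply]
  refine Submodule.sum_mem _ fun F _ => Submodule.sum_mem _ fun G _ =>
    Submodule.sum_mem _ fun c _ => ?_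
  simp only [LinearMap.compr₂_apply, LinearMap.compl₁₂_apply, LinearMap.proj_apply]
  intro H _
  by_cases hH : H = Forest.graft F G c e
  · subst hH
    rw [LinearMap.single_apply, Pi.single_eq_same]
    exact Forest.extComp_graft_mem F G c e (hx F trivial) (hy G trivial)
  · rw [LinearMap.single_apply, Pi.single_eq_of_ne hH]
    exact Submodule.zero_mem _

/-- The composition `∘_i : B(I) ⊗ B(J) → B(K)`, where `K` is the set `(I ∖ {i}) ⊔ J`. If `T` is the
tree of `F` that contains `i`, then `((t ∧ T) ⊗ F) ∘_i (o ⊗ G)` is obtained by composition in `Det`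
from `t` and from the composition of the tree `T` with `o ⊗ G`. The latter is given by the
distributive law of `B`, i.e. by iteration, along the path from `i` to the root of `T`, of the rule
`ω(S, t₁ ∧ ⋯ ∧ tₙ) = ∑ₖ t₁ ∧ ⋯ ∧ ω(S, tₖ) ∧ ⋯ ∧ tₙ`, which for `n = 2` is the defining relation
`ω_{i,⋆} ∘_⋆ e_{j,k} = e_{j,⋆} ∘_⋆ ω_{i,k} - e_{k,⋆} ∘_⋆ ω_{i,j}`. Hence it is a sum over all
assignments `c` of a tree of `G` to each inner vertex of this path. -/
def bComp : OpB I →ₗ[ℚ] OpB J →ₗ[ℚ] OpB K :=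
  LinearMap.mk₂ ℚ (fun x y => ⟨bCompAux e x y, bCompAux_mem e x.2 y.2⟩)
    (fun x x' y => Subtype.ext (by simp)) (fun a x y => Subtype.ext (by simp))
    (fun x y y' => Subtype.ext (by simp)) (fun a x y => Subtype.ext (by simp))

variable (I) in
/-- The map `x ↦ (-1) ^ (d * deg x) x` on `B(I)`. (The degree `|roots of F| - 1` is replaced here by
`|roots of F| + 1`, of the same parity.) -/
def bSign (d : ℕ) : OpB I →ₗ[ℚ] OpB I where
  toFun x := ⟨fun F => (-1 : ℚ) ^ (d * (F.roots.card + 1)) • x.1 F,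
    fun F _ => Submodule.smul_mem _ _ (x.2 F trivial)⟩
  map_add' _ _ := Subtype.ext (funext fun _ => smul_add _ _ _)
  map_smul' a x := Subtype.ext (funext fun F =>
    smul_comm ((-1 : ℚ) ^ (d * (F.roots.card + 1))) a (x.1 F))

/-- The composition `∘_i` of the operad `Bess = Det ⊗ B`, with the usual sign of a tensor product of
graded operads: `(a ⊗ x) ∘_i (b ⊗ y) = (-1) ^ (deg x * deg b) (a ∘_i b) ⊗ (x ∘_i y)`. The degree
`|J| - 1` of `b` is replaced by `|J| + 1`, of the same parity. -/
def bessComp : Bess I →ₗ[ℚ] Bess J →ₗ[ℚ] Bess K :=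
  TensorProduct.map₂ (detComp e) (bComp e ∘ₗ bSign I (Fintype.card J + 1))

/-- The element `o ⊗ F` of `B(I)`. -/
def rootOriented (F : Forest I) (o : detSpace F.roots) : OpB I :=
  ⟨Pi.single F o.1, fun G _ => by
    by_cases h : G = F
    · subst h
      simp
    · simp [h]⟩

end operads

/-! ### The generator `Ω` -/

/-- The tree with one inner vertex and the two leaves `⋆ = false` and `# = true`. -/
def omegaTree : Forest Bool where
  clusters := {{false}, {true}, {false, true}}
  singleton_mem := by decide
  nonempty := by decide
  laminar := by decide
  split := by decide

theorem roots_omegaTree : omegaTree.roots = {{false, true}} := by decide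

/-- The generator `Ω_{⋆,#} = (⋆ ∧ #) ⊗ ω_{⋆,#}` of `Bess`, with `⋆ = false` and `# = true`. -/
def Omega : Bess Bool :=
  (⟨wedge [false, true], (isOrientation_wedge (by simp) (by simp)).mem⟩ : OpDet Bool) ⊗ₜ[ℚ]
    rootOriented omegaTree
      ⟨gen {false, true}, by rw [roots_omegaTree]; exact (isOrientation_gen _).mem⟩

/-- The set `{⋆,#} ∖ {⋆} ⊔ I`, as the set `{#} ⊔ I`, where `#` is `none`. -/
def starEquiv (I : Type*) : {s : Bool // s ≠ false} ⊕ I ≃ Option I where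
  toFun := Sum.elim (fun _ => none) some
  invFun := fun o => o.elim (Sum.inl ⟨true, by decide⟩) Sum.inr
  left_inv := by
    rintro (⟨_ | _, h⟩ | x)
    · exact absurd rfl h
    · rfl
    · rfl
  right_inv := by rintro (_ | x) <;> rfl

/-- The set `({#} ⊔ I) ∖ {#} ⊔ J`, as the set `I ⊔ J`. -/
def sharpEquiv (I J : Type*) : {s : Option I // s ≠ none} ⊕ J ≃ I ⊕ J where
  toFun := Sum.map (fun s => s.1.get (Option.isSome_iff_ne_none.2 s.2)) id
  invFun := Sum.map (fun x => ⟨some x, by simp⟩) id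
  left_inv := by rintro (⟨_ | x, h⟩ | y) <;> simp at *
  right_inv := by rintro (x | y) <;> rfl

/-! ### Inner-oriented forests -/

section inner

variable {I J : Type*} [Fintype I] [DecidableEq I] [Fintype J] [DecidableEq J]

/-- The half-edges at the inner vertex `v`. The half-edges of the edge `C` are `(C, true)`, the
upper one, and `(C, false)`, the lower one. -/
def Forest.halfEdges (F : Forest I) (v : Finset I) : Finset (Finset I × Bool) :=
  insert (v, true) ((F.children v).image fun C => (C, false))

theorem Forest.mem_halfEdges (F : Forest I) {v : Finset I} {h : Finset I × Bool} :
    h ∈ F.halfEdges v ↔ h = (v, true) ∨ ∃ C ∈ F.children v, h = (C, false) := by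
  simp [Forest.halfEdges, eq_comm]

theorem Forest.card_halfEdges (F : Forest I) {v : Finset I} (hv : v ∈ F.verts) :
    (F.halfEdges v).card = 3 := by
  obtain ⟨B, -, C, -, -, -, hne, h⟩ := F.exists_children hv
  rw [Forest.halfEdges, h, Finset.card_insert_of_notMem (by simp), Finset.image_insert,
    Finset.image_singleton, Finset.card_pair (by simpa using hne)]

variable (I) in
/-- An inner-oriented forest: a forest `F` with a global orientation, i.e. an orientation of the set
of its inner vertices (`some v`) and the auxiliary element `R` (`none`), and with a local
orientation at each inner vertex `v`, i.e. an orientation of the three half-edges at `v`. -/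
structure InnerOrientedForest where
  forest : Forest I
  glob : Ext (Option (Finset I))
  isOrientation_glob : IsOrientation (Finset.insertNone forest.verts) glob
  loc : Finset I → Ext (Finset I × Bool)
  isOrientation_loc : ∀ v ∈ forest.verts, IsOrientation (forest.halfEdges v) (loc v)

namespace InnerOrientedForest

/-- What replaces `R` and the inner vertices in the global orientation: `R` itself, and the local
orientations. -/
def expand (x : InnerOrientedForest I) : Option (Finset I) → Ext (Option (Finset I × Bool))
  | none => gen none
  | some v => if v ∈ x.forest.verts then rename (fun h => some (some h)) (x.loc v) else 0

/-- The set of half-edges that replaces an inner vertex. -/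
def expandSet (F : Forest I) : Option (Finset I) → Finset (Option (Finset I × Bool))
  | none => {none}
  | some v => (F.halfEdges v).map Function.Embedding.some

theorem isOrientation_expand (x : InnerOrientedForest I) (v : Option (Finset I))
    (hv : v ∈ Finset.insertNone x.forest.verts) :
    IsOrientation (expandSet x.forest v) (x.expand v) := by
  rcases v with _ | v
  · exact isOrientation_gen _
  · have hv' : v ∈ x.forest.verts := by simpa using hv
    simp only [expand, hv', if_true]
    refine (x.isOrientation_loc v hv').rename _ _ (by simp) (by simp) (by simp [expandSet])

theorem expand_swap (x : InnerOrientedForest I) (v w : Option (Finset I)) :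
    x.expand v * x.expand w = -(x.expand w * x.expand v) := by
  have key : ∀ v : Option (Finset I), v ∈ Finset.insertNone x.forest.verts ∨ x.expand v = 0 := by
    rintro (_ | v)
    · simp
    · by_cases h : v ∈ x.forest.verts
      · left; simpa using h
      · right; simp [expand, h]
  have card : ∀ v ∈ Finset.insertNone x.forest.verts, Odd (expandSet x.forest v).card := by
    rintro (_ | v) hv
    · simp [expandSet]
    · have hv' : v ∈ x.forest.verts := by simpa using hv
      simp only [expandSet, Finset.card_map, x.forest.card_halfEdges hv']
      decide
  rcases key v with hv | hv
  · rcases key w with hw | hw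
    · exact (x.isOrientation_expand v hv).anticomm (x.isOrientation_expand w hw) (card v hv)
        (card w hw)
    · simp [hw]
  · simp [hv]

end InnerOrientedForest

/-- The product of the pairs `C⁺ ∧ C⁻` of half-edges, over all edges `C` between two inner vertices
(in any order, the factors being of even degree). -/
def innerEdgePairs (F : Forest I) : Ext (Option (Finset I × Bool)) :=
  (F.innerEdges.toList.map fun C => gen (some (C, true)) * gen (some (C, false))).prod

/-- The product of the pairs `ℓ ∧ r`, over all leaves `ℓ` and roots `r` that are related by an
edge (in any order, the factors being of even degree). -/
def leafRootPairs (F : Forest I) : Ext (Option (Finset I × Bool)) :=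
  (F.trivialTrees.toList.map fun C => gen (some (C, false)) * gen (some (C, true))).prod

/-- The exterior product `o₁ ∧ R ∧ o₂` of an outer orientation, where the leaf `x` is
identified with the lower half-edge of its edge, and a root with the upper half-edge of its edge. -/
def outerProduct (o₁ : Ext I) (o₂ : Ext (Finset I)) : Ext (Option (Finset I × Bool)) :=
  rename (fun x => some (some ({x}, false))) o₁ * gen none *
    rename (fun C => some (some (C, true))) o₂

namespace InnerOrientedForest

/-- The outer orientation `o₁ ⊗ o₂` is identified with the inner orientation of `x`: after removing
the pairs `ℓ ∧ r` from `o₁ ∧ R ∧ o₂` and adding the pairs `C⁺ ∧ C⁻`, one gets the exterior product of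
`R` and all half-edges that is obtained from the global orientation by replacing each inner vertex
by its local orientation. -/
def Matches (x : InnerOrientedForest I) (o₁ : Ext I) (o₂ : Ext (Finset I)) : Prop :=
  outerProduct o₁ o₂ * innerEdgePairs x.forest =
    leafRootPairs x.forest * substHom x.expand x.expand_swap x.glob

/-- `t` is the element `o₁ ⊗ o₂ ⊗ F` of `Bess(I)`, where `o₁ ⊗ o₂` is the outer orientation
identified with the inner orientation of `x`, and `F` is the forest of `x`. -/
def IsOuterForm (x : InnerOrientedForest I) (t : Bess I) : Prop :=
  ∃ (o₁ : OpDet I) (o₂ : detSpace x.forest.roots), IsOrientation Finset.univ o₁.1 ∧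
    IsOrientation x.forest.roots o₂.1 ∧ x.Matches o₁ o₂ ∧ t = o₁ ⊗ₜ[ℚ] rootOriented x.forest o₂

/-- The half-edges, with the leaves and the roots of the trees without inner vertex, and `R`. -/
def allHalfEdges (F : Forest I) : Finset (Option (Finset I × Bool)) :=
  F.trivialTrees.biUnion (fun C => {some (C, false), some (C, true)}) ∪
    (Finset.insertNone F.verts).biUnion (expandSet F)

theorem mem_expandSet_some {F : Forest I} {v : Finset I} {h : Finset I × Bool} :
    some h ∈ expandSet F (some v) ↔ h ∈ F.halfEdges v := by
  simp [expandSet]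

theorem none_notMem_expandSet {F : Forest I} {v : Finset I} : none ∉ expandSet F (some v) := by
  simp [expandSet]

theorem isOrientation_right (x : InnerOrientedForest I) : IsOrientation (allHalfEdges x.forest)
    (leafRootPairs x.forest * substHom x.expand x.expand_swap x.glob) := by
  have h1 : IsOrientation (x.forest.trivialTrees.biUnion
      (fun C => ({some (C, false), some (C, true)} : Finset (Option (Finset I × Bool)))))
      (leafRootPairs x.forest) := by
    refine isOrientation_list_prod _ (fun C => {some (C, false), some (C, true)}) _
      (Finset.nodup_toList _) ?_ ?_ _ (by simp)
    · intro C _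
      exact (isOrientation_gen _).mul (isOrientation_gen _) (by simp)
    · intro C _ D _ hCD
      simp [hCD.symm]
  have h2 := x.isOrientation_glob.substHom x.expand x.expand_swap (expandSet x.forest)
    (fun v hv => x.isOrientation_expand v hv) (by
      rintro (_ | v) hv (_ | w) hw hne
      · exact absurd rfl hne
      · rw [Finset.disjoint_left]
        intro a ha
        have : a = none := by simpa [expandSet] using ha
        rw [this]
        exact none_notMem_expandSet
      · rw [Finset.disjoint_right]
        intro a ha
        have : a = none := by simpa [expandSet] using ha
        rw [this]
        exact none_notMem_expandSet
      · have hv' : v ∈ x.forest.verts := by simpa using hv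
        have hw' : w ∈ x.forest.verts := by simpa using hw
        rw [Finset.disjoint_left]
        rintro (_ | h) ha hb
        · exact none_notMem_expandSet ha
        · rw [mem_expandSet_some, Forest.mem_halfEdges] at ha hb
          rcases ha with rfl | ⟨C, hC, rfl⟩
          · rcases hb with h | ⟨D, hD, h⟩
            · exact hne (by rw [(Prod.mk.inj h).1])
            · simp at h
          · rcases hb with h | ⟨D, hD, h⟩
            · simp at h
            · rw [← (Prod.mk.inj h).1] at hD
              exact hne (by rw [x.forest.children_unique (x.forest.mem_verts.1 hv').1
                (x.forest.mem_verts.1 hw').1 hC hD]))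
  refine h1.mul h2 ?_
  rw [Finset.disjoint_left]
  intro a ha hb
  simp only [Finset.mem_biUnion, Finset.mem_insert, Finset.mem_singleton] at ha hb
  obtain ⟨C, hC, ha⟩ := ha
  obtain ⟨w, hw, hb⟩ := hb
  have hC' := Finset.mem_filter.1 hC
  rcases w with _ | w
  · rcases ha with rfl | rfl <;> simp [expandSet] at hb
  · have hw' : w ∈ x.forest.verts := by simpa using hw
    rcases ha with rfl | rfl <;> rw [mem_expandSet_some, Forest.mem_halfEdges] at hb
    · rcases hb with h | ⟨D, hD, h⟩
      · simp at h
      · rw [← (Prod.mk.inj h).1] at hD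
        exact x.forest.notMem_roots_of_mem_children (x.forest.mem_verts.1 hw').1 hD hC'.1
    · rcases hb with h | ⟨D, hD, h⟩
      · rw [(Prod.mk.inj h).1] at hC'
        exact hC'.2 hw'
      · simp at h

theorem isOrientation_left (F : Forest I) {o₁ : Ext I} {o₂ : Ext (Finset I)}
    (h₁ : IsOrientation Finset.univ o₁) (h₂ : IsOrientation F.roots o₂) :
    IsOrientation (allHalfEdges F) (outerProduct o₁ o₂ * innerEdgePairs F) := by
  have a1 := h₁.rename (fun x => some (some (({x} : Finset I), false)))
    (Finset.univ.image fun x => some ({x}, false)) (by simp) (by simp) (by simp)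
  have a2 := h₂.rename (fun C => some (some (C, true)))
    (F.roots.image fun C => some (C, true)) (by simp) (by simp) (by simp)
  have a3 : IsOrientation (F.innerEdges.biUnion
      (fun C => ({some (C, true), some (C, false)} : Finset (Option (Finset I × Bool)))))
      (innerEdgePairs F) := by
    refine isOrientation_list_prod _ (fun C => {some (C, true), some (C, false)}) _
      (Finset.nodup_toList _) ?_ ?_ _ (by simp)
    · intro C _
      exact (isOrientation_gen _).mul (isOrientation_gen _) (by simp)
    · intro C _ D _ hCD
      simp [hCD.symm]
  have single : ∀ x : I, ({x} : Finset I) ∉ F.verts := by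
    intro x h
    have := (F.mem_verts.1 h).2
    simp at this
  have b1 := a1.mul (isOrientation_gen (none : Option (Finset I × Bool))) (by simp)
  have b2 := b1.mul a2 (by
    rw [Finset.disjoint_left]
    simp)
  have b3 := b2.mul a3 (by
    rw [Finset.disjoint_left]
    simp only [Finset.mem_union, Finset.mem_image, Finset.mem_univ, true_and,
      Finset.mem_singleton, Finset.mem_biUnion, Finset.mem_insert, Forest.innerEdges,
      Finset.mem_filter]
    rintro a ((⟨x, rfl⟩ | rfl) | ⟨C, hC, rfl⟩) ⟨D, ⟨hD, hD'⟩, h⟩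
    · have : {x} = D := by simpa using h
      exact single x (this ▸ hD)
    · simp at h
    · have : C = D := by simpa using h
      exact hD' (this ▸ hC))
  have hset : allHalfEdges F = (Finset.univ.image fun x => some ({x}, false)) ∪ {none} ∪
      (F.roots.image fun C => some (C, true)) ∪
      F.innerEdges.biUnion fun C => {some (C, true), some (C, false)} := ?_
  · rw [hset]
    exact b3
  ext a
  simp only [allHalfEdges, Finset.mem_union, Finset.mem_image, Finset.mem_univ, true_and,
      Finset.mem_singleton, Finset.mem_biUnion, Finset.mem_insert, Forest.innerEdges,
      Forest.trivialTrees, Finset.mem_filter]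
  have hsingle : ∀ C ∈ F.clusters, C ∉ F.verts → ∃ x, {x} = C := by
    intro C hC hv
    have h1 := Finset.card_pos.2 (F.nonempty C hC)
    have h2 : ¬ 1 < C.card := fun h => hv (F.mem_verts.2 ⟨hC, h⟩)
    obtain ⟨x, hx⟩ := Finset.card_eq_one.1 (show C.card = 1 by omega)
    exact ⟨x, hx.symm⟩
  have hparent : ∀ C ∈ F.clusters, C ∉ F.roots →
      ∃ v ∈ Finset.insertNone F.verts, some (C, false) ∈ expandSet F v := by
    intro C hC hr
    obtain ⟨v, hv, h⟩ := F.exists_parent hC hr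
    exact ⟨some v, by simpa using hv, mem_expandSet_some.2 (F.mem_halfEdges.2 (Or.inr ⟨C, h, rfl⟩))⟩
  have hvert : ∀ C ∈ F.verts, ∃ v ∈ Finset.insertNone F.verts, some (C, true) ∈ expandSet F v :=
    fun C hC => ⟨some C, by simpa using hC, mem_expandSet_some.2 (F.mem_halfEdges.2 (Or.inl rfl))⟩
  constructor
  · rintro (⟨C, ⟨hC, hC'⟩, h⟩ | ⟨v, hv, h⟩)
    · obtain ⟨x, rfl⟩ := hsingle C (F.mem_roots.1 hC).1 hC'
      rcases h with rfl | rfl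
      · exact Or.inl (Or.inl (Or.inl ⟨x, rfl⟩))
      · exact Or.inl (Or.inr ⟨_, hC, rfl⟩)
    · rcases v with _ | v
      · exact Or.inl (Or.inl (Or.inr (by simpa [expandSet] using h)))
      · have hv' : v ∈ F.verts := by simpa using hv
        rcases a with _ | a
        · exact absurd h none_notMem_expandSet
        · rw [mem_expandSet_some, Forest.mem_halfEdges] at h
          rcases h with rfl | ⟨C, hC, rfl⟩
          · by_cases hr : v ∈ F.roots
            · exact Or.inl (Or.inr ⟨v, hr, rfl⟩)
            · exact Or.inr ⟨v, ⟨hv', hr⟩, Or.inl rfl⟩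
          · by_cases hCv : C ∈ F.verts
            · exact Or.inr ⟨C, ⟨hCv, F.notMem_roots_of_mem_children (F.mem_verts.1 hv').1 hC⟩,
                Or.inr rfl⟩
            · obtain ⟨x, rfl⟩ := hsingle C (F.mem_children.1 hC).1 hCv
              exact Or.inl (Or.inl (Or.inl ⟨x, rfl⟩))
  · rintro (((⟨x, rfl⟩ | rfl) | ⟨C, hC, rfl⟩) | ⟨C, ⟨hC, hC'⟩, rfl | rfl⟩)
    · by_cases hr : {x} ∈ F.roots
      · exact Or.inl ⟨_, ⟨hr, single x⟩, Or.inl rfl⟩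
      · exact Or.inr (hparent _ (F.singleton_mem x) hr)
    · exact Or.inr ⟨none, by simp, by simp [expandSet]⟩
    · by_cases hv : C ∈ F.verts
      · exact Or.inr (hvert C hv)
      · exact Or.inl ⟨C, ⟨hC, hv⟩, Or.inr rfl⟩
    · exact Or.inr (hvert C hC)
    · exact Or.inr (hparent C (F.mem_verts.1 hC).1 hC')

theorem existsUnique_isOuterForm (x : InnerOrientedForest I) : ∃! t, x.IsOuterForm t := by
  have hl : ∀ (o₁ : Ext I) (o₂ : Ext (Finset I)),
      outerProduct (-o₁) o₂ * innerEdgePairs x.forest =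
        -(outerProduct o₁ o₂ * innerEdgePairs x.forest) := by
    intro o₁ o₂
    simp [outerProduct]
  have hr : ∀ (o₁ : Ext I) (o₂ : Ext (Finset I)),
      outerProduct o₁ (-o₂) * innerEdgePairs x.forest =
        -(outerProduct o₁ o₂ * innerEdgePairs x.forest) := by
    intro o₁ o₂
    simp [outerProduct]
  have hR := x.isOrientation_right
  refine existsUnique_of_exists_of_unique ?_ ?_
  · have h1 : IsOrientation (Finset.univ : Finset I) (wedge Finset.univ.toList) :=
      isOrientation_wedge (Finset.nodup_toList _) (by simp)
    have h2 : IsOrientation x.forest.roots (wedge x.forest.roots.toList) :=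
      isOrientation_wedge (Finset.nodup_toList _) (by simp)
    rcases (isOrientation_left x.forest h1 h2).eq_or_neg hR with h | h
    · exact ⟨_, ⟨_, h1.mem⟩, ⟨_, h2.mem⟩, h1, h2, h.symm, rfl⟩
    · exact ⟨_, ⟨_, h1.neg.mem⟩, ⟨_, h2.mem⟩, h1.neg, h2, (hl _ _).trans h.symm, rfl⟩
  · rintro t t' ⟨o₁, o₂, h1, h2, hm, rfl⟩ ⟨o₁', o₂', h1', h2', hm', rfl⟩
    have hne := hR.ne_zero
    have hrn : ∀ o : detSpace x.forest.roots,
        rootOriented x.forest (-o) = -rootOriented x.forest o := by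
      intro o
      exact Subtype.ext (Pi.single_neg (f := fun _ : Forest I => Ext (Finset I)) x.forest o.1)
    have absurd' : ∀ z : Ext (Option (Finset I × Bool)), z ≠ 0 → -z = z → False := by
      intro z hz h
      have h2 : (2 : ℚ) • z = 0 := by
        rw [two_smul]
        nth_rewrite 1 [← h]
        simp
      exact hz ((smul_eq_zero.1 h2).resolve_left two_ne_zero)
    unfold Matches at hm hm'
    rcases h1.eq_or_neg h1' with ha | ha <;> rcases h2.eq_or_neg h2' with hb | hb
    · rw [Subtype.ext ha, Subtype.ext hb]
    · rw [ha, hb, hr, hm] at hm'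
      exact (absurd' _ hne hm').elim
    · rw [ha, hb, hl, hm] at hm'
      exact (absurd' _ hne hm').elim
    · have ha' : o₁' = -o₁ := Subtype.ext ha
      have hb' : o₂' = -o₂ := Subtype.ext hb
      rw [ha', hb', hrn, TensorProduct.neg_tmul, TensorProduct.tmul_neg]
      exact (neg_neg (o₁ ⊗ₜ[ℚ] rootOriented x.forest o₂ : Bess I)).symm

/-- The element of `Bess(I)` given by an inner-oriented forest. -/
def toBess (x : InnerOrientedForest I) : Bess I := x.existsUnique_isOuterForm.choose

theorem isOuterForm_toBess (x : InnerOrientedForest I) : x.IsOuterForm x.toBess :=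
  x.existsUnique_isOuterForm.choose_spec.1

end InnerOrientedForest
/-! ### The operation `∨` -/

/-- The subset `A ⊔ B` of `I ⊔ J`. -/
def sumSet (A : Finset I) (B : Finset J) : Finset (I ⊕ J) := A.disjSum B

@[simp] theorem inl_mem_sumSet {A : Finset I} {B : Finset J} {x : I} :
    Sum.inl x ∈ sumSet A B ↔ x ∈ A := Finset.inl_mem_disjSum

@[simp] theorem inr_mem_sumSet {A : Finset I} {B : Finset J} {x : J} :
    Sum.inr x ∈ sumSet A B ↔ x ∈ B := Finset.inr_mem_disjSum

theorem sumSet_subset {A A' : Finset I} {B B' : Finset J} :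
    sumSet A B ⊆ sumSet A' B' ↔ A ⊆ A' ∧ B ⊆ B' := by
  simp [Finset.subset_iff]

theorem sumSet_disjoint {A A' : Finset I} {B B' : Finset J} :
    Disjoint (sumSet A B) (sumSet A' B') ↔ Disjoint A A' ∧ Disjoint B B' := by
  simp [Finset.disjoint_left]

theorem sumSet_union {A A' : Finset I} {B B' : Finset J} :
    sumSet A B ∪ sumSet A' B' = sumSet (A ∪ A') (B ∪ B') := by
  ext (x | x) <;> simp

@[simp] theorem toLeft_sumSet {A : Finset I} {B : Finset J} : (sumSet A B).toLeft = A := by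
  ext x; simp

@[simp] theorem toRight_sumSet {A : Finset I} {B : Finset J} : (sumSet A B).toRight = B := by
  ext x; simp

@[simp] theorem card_sumSet {A : Finset I} {B : Finset J} :
    (sumSet A B).card = A.card + B.card := Finset.card_disjSum _ _

theorem sumSet_inj {A A' : Finset I} {B B' : Finset J} :
    sumSet A B = sumSet A' B' ↔ A = A' ∧ B = B' := by
  constructor
  · intro h
    exact ⟨by simpa using congrArg Finset.toLeft h, by simpa using congrArg Finset.toRight h⟩
  · rintro ⟨rfl, rfl⟩
    rfl

/-- The forest obtained from the disjoint union of the forests `F` and `G` by replacing the tree of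
`F` with root `A` and the tree of `G` with root `B` by the tree where they are grafted on the two
leaves of the tree with one inner vertex. -/
def Forest.vee (F : Forest I) (G : Forest J) (A : {A // A ∈ F.roots}) (B : {B // B ∈ G.roots}) :
    Forest (I ⊕ J) where
  clusters := insert (sumSet A.1 B.1) ((F.clusters.image fun C => sumSet C ∅) ∪
    G.clusters.image fun D => sumSet ∅ D)
  singleton_mem := by
    rintro (x | y)
    · refine Finset.mem_insert_of_mem (Finset.mem_union_left _
        (Finset.mem_image.2 ⟨{x}, F.singleton_mem x, ?_⟩))
      ext (z | z) <;> simp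
    · refine Finset.mem_insert_of_mem (Finset.mem_union_right _
        (Finset.mem_image.2 ⟨{y}, G.singleton_mem y, ?_⟩))
      ext (z | z) <;> simp
  nonempty := by
    have hA := F.nonempty A.1 (F.mem_roots.1 A.2).1
    intro S hS
    simp only [Finset.mem_insert, Finset.mem_union, Finset.mem_image] at hS
    rcases hS with rfl | ⟨C, hC, rfl⟩ | ⟨D, hD, rfl⟩
    · obtain ⟨x, hx⟩ := hA
      exact ⟨Sum.inl x, by simpa using hx⟩
    · obtain ⟨x, hx⟩ := F.nonempty C hC
      exact ⟨Sum.inl x, by simpa using hx⟩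
    · obtain ⟨x, hx⟩ := G.nonempty D hD
      exact ⟨Sum.inr x, by simpa using hx⟩
  laminar := by
    have hl : ∀ C ∈ F.clusters, C ⊆ A.1 ∨ Disjoint C A.1 := by
      intro C hC
      by_cases h : ∃ x ∈ C, x ∈ A.1
      · obtain ⟨x, hx, hx'⟩ := h
        exact Or.inl (F.subset_root A.2 hC hx' hx)
      · push Not at h
        exact Or.inr (Finset.disjoint_left.2 h)
    have hr : ∀ C ∈ G.clusters, C ⊆ B.1 ∨ Disjoint C B.1 := by
      intro C hC
      by_cases h : ∃ x ∈ C, x ∈ B.1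
      · obtain ⟨x, hx, hx'⟩ := h
        exact Or.inl (G.subset_root B.2 hC hx' hx)
      · push Not at h
        exact Or.inr (Finset.disjoint_left.2 h)
    intro S hS S' hS'
    simp only [Finset.mem_insert, Finset.mem_union, Finset.mem_image] at hS hS'
    rcases hS with rfl | ⟨C, hC, rfl⟩ | ⟨D, hD, rfl⟩ <;>
      rcases hS' with rfl | ⟨C', hC', rfl⟩ | ⟨D', hD', rfl⟩ <;>
      simp only [sumSet_subset, sumSet_disjoint, Finset.empty_subset, and_true, true_and,
        Finset.disjoint_empty_left, Finset.disjoint_empty_right, or_true, subset_rfl, true_or]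
    · rcases hl C' hC' with h | h
      · simp [h]
      · simp [h.symm]
    · rcases hr D' hD' with h | h
      · simp [h]
      · simp [h.symm]
    · rcases hl C hC with h | h <;> simp [h]
    · exact F.laminar C hC C' hC'
    · rcases hr D hD with h | h <;> simp [h]
    · exact G.laminar D hD D' hD'
  split := by
    intro S hS hcard
    simp only [Finset.mem_insert, Finset.mem_union, Finset.mem_image] at hS ⊢
    rcases hS with rfl | ⟨C, hC, rfl⟩ | ⟨D, hD, rfl⟩
    · exact ⟨_, Or.inr (Or.inl ⟨A.1, (F.mem_roots.1 A.2).1, rfl⟩), _,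
        Or.inr (Or.inr ⟨B.1, (G.mem_roots.1 B.2).1, rfl⟩),
        by simp [sumSet_disjoint], by simp [sumSet_union]⟩
    · obtain ⟨C₁, h₁, C₂, h₂, hd, hu⟩ := F.split C hC (by simpa using hcard)
      exact ⟨_, Or.inr (Or.inl ⟨C₁, h₁, rfl⟩), _, Or.inr (Or.inl ⟨C₂, h₂, rfl⟩),
        by simpa [sumSet_disjoint] using hd, by simp [sumSet_union, hu]⟩
    · obtain ⟨C₁, h₁, C₂, h₂, hd, hu⟩ := G.split D hD (by simpa using hcard)
      exact ⟨_, Or.inr (Or.inr ⟨C₁, h₁, rfl⟩), _, Or.inr (Or.inr ⟨C₂, h₂, rfl⟩),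
        by simpa [sumSet_disjoint] using hd, by simp [sumSet_union, hu]⟩

namespace Forest

section vee

variable (F : Forest I) (G : Forest J) (A : {A // A ∈ F.roots}) (B : {B // B ∈ G.roots})

theorem mem_clusters_vee {S : Finset (I ⊕ J)} : S ∈ (F.vee G A B).clusters ↔
    S = sumSet A.1 B.1 ∨ (∃ C ∈ F.clusters, sumSet C ∅ = S) ∨
      ∃ D ∈ G.clusters, sumSet ∅ D = S := by
  simp [vee]

theorem root_nonempty {A : Finset I} (h : A ∈ F.roots) : A.Nonempty :=
  F.nonempty A (F.mem_roots.1 h).1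

theorem mem_verts_vee {S : Finset (I ⊕ J)} : S ∈ (F.vee G A B).verts ↔
    S = sumSet A.1 B.1 ∨ (∃ C ∈ F.verts, sumSet C ∅ = S) ∨
      ∃ D ∈ G.verts, sumSet ∅ D = S := by
  have hA := Finset.card_pos.2 (F.root_nonempty A.2)
  have hB := Finset.card_pos.2 (G.root_nonempty B.2)
  rw [mem_verts, mem_clusters_vee]
  constructor
  · rintro ⟨rfl | ⟨C, hC, rfl⟩ | ⟨D, hD, rfl⟩, h⟩
    · exact Or.inl rfl
    · exact Or.inr (Or.inl ⟨C, F.mem_verts.2 ⟨hC, by simpa using h⟩, rfl⟩)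
    · exact Or.inr (Or.inr ⟨D, G.mem_verts.2 ⟨hD, by simpa using h⟩, rfl⟩)
  · rintro (rfl | ⟨C, hC, rfl⟩ | ⟨D, hD, rfl⟩)
    · refine ⟨Or.inl rfl, ?_⟩
      rw [card_sumSet]
      omega
    · rw [mem_verts] at hC
      exact ⟨Or.inr (Or.inl ⟨C, hC.1, rfl⟩), by simpa using hC.2⟩
    · rw [mem_verts] at hD
      exact ⟨Or.inr (Or.inr ⟨D, hD.1, rfl⟩), by simpa using hD.2⟩

theorem sumSet_ssubset_left {C D : Finset I} :
    sumSet C (∅ : Finset J) ⊂ sumSet D ∅ ↔ C ⊂ D := by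
  simp [Finset.ssubset_def, sumSet_subset]

theorem sumSet_ssubset_right {C D : Finset J} :
    sumSet (∅ : Finset I) C ⊂ sumSet ∅ D ↔ C ⊂ D := by
  simp [Finset.ssubset_def, sumSet_subset]

theorem cluster_left {S : Finset (I ⊕ J)} (hS : S ∈ (F.vee G A B).clusters) {C : Finset I}
    (h : S ⊆ sumSet C ∅) : ∃ D ∈ F.clusters, sumSet D ∅ = S := by
  rw [mem_clusters_vee] at hS
  rcases hS with rfl | h1 | ⟨D, hD, rfl⟩
  · rw [sumSet_subset, Finset.subset_empty] at h
    exact absurd h.2 (G.root_nonempty B.2).ne_empty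
  · exact h1
  · rw [sumSet_subset, Finset.subset_empty] at h
    exact absurd h.2 (G.nonempty D hD).ne_empty

theorem cluster_right {S : Finset (I ⊕ J)} (hS : S ∈ (F.vee G A B).clusters) {C : Finset J}
    (h : S ⊆ sumSet ∅ C) : ∃ D ∈ G.clusters, sumSet ∅ D = S := by
  rw [mem_clusters_vee] at hS
  rcases hS with rfl | ⟨D, hD, rfl⟩ | h1
  · rw [sumSet_subset, Finset.subset_empty] at h
    exact absurd h.1 (F.root_nonempty A.2).ne_empty
  · rw [sumSet_subset, Finset.subset_empty] at h
    exact absurd h.1 (F.nonempty D hD).ne_empty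
  · exact h1

theorem children_vee_left (C : Finset I) : (F.vee G A B).children (sumSet C ∅) =
    (F.children C).image fun D => sumSet D ∅ := by
  ext S
  rw [mem_children, Finset.mem_image]
  constructor
  · rintro ⟨h1, h2, h3⟩
    obtain ⟨D, hD, rfl⟩ := cluster_left F G A B h1 h2.1
    refine ⟨D, F.mem_children.2 ⟨hD, sumSet_ssubset_left.1 h2, fun E hE hDE hEC => ?_⟩, rfl⟩
    exact h3 (sumSet E ∅) ((mem_clusters_vee F G A B).2 (Or.inr (Or.inl ⟨E, hE, rfl⟩)))
      (sumSet_ssubset_left.2 hDE) (sumSet_ssubset_left.2 hEC)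
  · rintro ⟨D, hD, rfl⟩
    rw [mem_children] at hD
    refine ⟨(mem_clusters_vee F G A B).2 (Or.inr (Or.inl ⟨D, hD.1, rfl⟩)),
      sumSet_ssubset_left.2 hD.2.1, fun E hE hDE hEC => ?_⟩
    obtain ⟨E, hE', rfl⟩ := cluster_left F G A B hE hEC.1
    exact hD.2.2 E hE' (sumSet_ssubset_left.1 hDE) (sumSet_ssubset_left.1 hEC)

theorem children_vee_right (C : Finset J) : (F.vee G A B).children (sumSet ∅ C) =
    (G.children C).image fun D => sumSet ∅ D := by
  ext S
  rw [mem_children, Finset.mem_image]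
  constructor
  · rintro ⟨h1, h2, h3⟩
    obtain ⟨D, hD, rfl⟩ := cluster_right F G A B h1 h2.1
    refine ⟨D, G.mem_children.2 ⟨hD, sumSet_ssubset_right.1 h2, fun E hE hDE hEC => ?_⟩, rfl⟩
    exact h3 (sumSet ∅ E) ((mem_clusters_vee F G A B).2 (Or.inr (Or.inr ⟨E, hE, rfl⟩)))
      (sumSet_ssubset_right.2 hDE) (sumSet_ssubset_right.2 hEC)
  · rintro ⟨D, hD, rfl⟩
    rw [mem_children] at hD
    refine ⟨(mem_clusters_vee F G A B).2 (Or.inr (Or.inr ⟨D, hD.1, rfl⟩)),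
      sumSet_ssubset_right.2 hD.2.1, fun E hE hDE hEC => ?_⟩
    obtain ⟨E, hE', rfl⟩ := cluster_right F G A B hE hEC.1
    exact hD.2.2 E hE' (sumSet_ssubset_right.1 hDE) (sumSet_ssubset_right.1 hEC)

theorem children_vee_new : (F.vee G A B).children (sumSet A.1 B.1) =
    {sumSet A.1 ∅, sumSet ∅ B.1} := by
  have hA := (F.root_nonempty A.2).ne_empty
  have hB := (G.root_nonempty B.2).ne_empty
  have sA : sumSet A.1 (∅ : Finset J) ⊂ sumSet A.1 B.1 := by
    simp [Finset.ssubset_def, sumSet_subset, hB]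
  have sB : sumSet (∅ : Finset I) B.1 ⊂ sumSet A.1 B.1 := by
    simp [Finset.ssubset_def, sumSet_subset, hA]
  have cA : sumSet A.1 (∅ : Finset J) ∈ (F.vee G A B).clusters :=
    (mem_clusters_vee F G A B).2 (Or.inr (Or.inl ⟨A.1, (F.mem_roots.1 A.2).1, rfl⟩))
  have cB : sumSet (∅ : Finset I) B.1 ∈ (F.vee G A B).clusters :=
    (mem_clusters_vee F G A B).2 (Or.inr (Or.inr ⟨B.1, (G.mem_roots.1 B.2).1, rfl⟩))
  have sub : ∀ S ∈ (F.vee G A B).clusters, S ⊂ sumSet A.1 B.1 →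
      S ⊆ sumSet A.1 ∅ ∨ S ⊆ sumSet ∅ B.1 := by
    intro S hS h
    rw [mem_clusters_vee] at hS
    rcases hS with rfl | ⟨D, hD, rfl⟩ | ⟨D, hD, rfl⟩
    · exact absurd h (ssubset_irrefl _)
    · exact Or.inl (sumSet_subset.2 ⟨(sumSet_subset.1 h.1).1, subset_rfl⟩)
    · exact Or.inr (sumSet_subset.2 ⟨subset_rfl, (sumSet_subset.1 h.1).2⟩)
  ext S
  rw [mem_children, Finset.mem_insert, Finset.mem_singleton]
  constructor
  · rintro ⟨h1, h2, h3⟩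
    rcases sub S h1 h2 with h | h
    · rcases h.eq_or_ssubset with h | h
      · exact Or.inl h
      · exact absurd sA (h3 _ cA h)
    · rcases h.eq_or_ssubset with h | h
      · exact Or.inr h
      · exact absurd sB (h3 _ cB h)
  · rintro (rfl | rfl)
    · refine ⟨cA, sA, fun E hE h1 h2 => ?_⟩
      rcases sub E hE h2 with h | h
      · exact h1.2 h
      · exact hA (Finset.subset_empty.1 (sumSet_subset.1 (h1.1.trans h)).1)
    · refine ⟨cB, sB, fun E hE h1 h2 => ?_⟩
      rcases sub E hE h2 with h | h
      · exact hB (Finset.subset_empty.1 (sumSet_subset.1 (h1.1.trans h)).2)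
      · exact h1.2 h

end vee

end Forest

namespace InnerOrientedForest

variable (x : InnerOrientedForest I) (y : InnerOrientedForest J)
  (A : {A // A ∈ x.forest.roots}) (B : {B // B ∈ y.forest.roots})

/-- The global orientation `o₁ ∨ o₂` of the forest where the trees with roots `A` and `B` are
replaced by their `∨` product: the exterior product `(-1) ^ (deg o₁) o₁ ∧ o₂`, where `R₁ ∧ R₂` is
replaced by `R ∧ v` (i.e. `R₁` by `R` and `R₂` by `v`) for the new inner vertex `v`. The degree of
`o₁` is its number of wedge signs, i.e. the number of inner vertices of the first forest. -/
def veeGlob : Ext (Option (Finset (I ⊕ J))) :=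
  (-1 : ℚ) ^ x.forest.verts.card •
    (rename (fun v => some (v.elim none fun C => some (sumSet C ∅))) x.glob *
      rename (fun v => some (v.elim (some (sumSet A.1 B.1)) fun C => some (sumSet ∅ C)))
        y.glob)

/-- The local orientations: they are unchanged at the inner vertices of the two forests, and
`v⁺ ∧ e₁⁻ ∧ e₂⁻` at the new inner vertex `v`, where `v⁺` is its outgoing half-edge, and `e₁⁻` and
`e₂⁻` its incoming half-edges on the side of the first and of the second forest. -/
def veeLoc (v : Finset (I ⊕ J)) : Ext (Finset (I ⊕ J) × Bool) :=
  if v = sumSet A.1 B.1 then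
    gen (v, true) * gen (sumSet A.1 ∅, false) * gen (sumSet ∅ B.1, false)
  else if v.toRight = ∅ then
    rename (fun h => some (h.1.disjSum ∅, h.2)) (x.loc v.toLeft)
  else
    rename (fun h => some (sumSet ∅ h.1, h.2)) (y.loc v.toRight)

/-- The inner-oriented forest `(o₁ ∨ o₂) ⊗ F`, where `F` is the term of `F₁ ∨ F₂` that belongs to
the tree of `F₁` with root `A` and the tree of `F₂` with root `B`. -/
def vee : InnerOrientedForest (I ⊕ J) where
  forest := x.forest.vee y.forest A B
  glob := veeGlob x y A B
  isOrientation_glob := by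
    have hA := (x.forest.root_nonempty A.2).ne_empty
    have hB := (y.forest.root_nonempty B.2).ne_empty
    have h1 := x.isOrientation_glob.rename
      (fun v => some (v.elim none fun C => some (sumSet C (∅ : Finset J))))
      (Finset.insertNone (x.forest.verts.image fun C => sumSet C ∅)) (by simp)
      (by
        rintro (_ | v) _ (_ | w) _ h <;> simp [sumSet_inj] at h ⊢
        exact h)
      (by
        rintro (_ | S)
        · simp only [Finset.none_mem_insertNone, true_iff]
          exact ⟨none, by simp, rfl⟩
        · simp [Finset.mem_insertNone, Option.exists])
    have h2 := y.isOrientation_glob.rename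
      (fun v => some (v.elim (some (sumSet A.1 B.1)) fun C =>
        some (sumSet (∅ : Finset I) C)))
      ((insert (sumSet A.1 B.1) (y.forest.verts.image fun C => sumSet ∅ C)).map
        Function.Embedding.some) (by simp)
      (by
        rintro (_ | v) _ (_ | w) _ h <;> simp [sumSet_inj, hA, Ne.symm hA] at h ⊢
        exact h)
      (by
        rintro (_ | S)
        · simp [Finset.mem_insertNone, Option.forall]
        · simp [Finset.mem_insertNone, Option.exists, eq_comm])
    have h3 := (h1.mul h2 (by
      rw [Finset.disjoint_right]
      rintro (_ | S)
      · simp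
      · simp only [Finset.mem_map, Finset.mem_insert, Finset.mem_image,
          Function.Embedding.some_apply, Option.some.injEq, exists_eq_right,
          Finset.some_mem_insertNone]
        rintro (rfl | ⟨D, hD, rfl⟩) ⟨C, hC, h⟩
        · exact hB (sumSet_inj.1 h).2.symm
        · have := (y.forest.mem_verts.1 hD).1
          exact (y.forest.nonempty D this).ne_empty (sumSet_inj.1 h).2.symm)).sign_smul
            x.forest.verts.card
    have hset : Finset.insertNone (x.forest.vee y.forest A B).verts =
        Finset.insertNone (x.forest.verts.image fun C => sumSet C ∅) ∪
        (insert (sumSet A.1 B.1) (y.forest.verts.image fun C => sumSet ∅ C)).map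
          Function.Embedding.some := by
      ext (_ | S)
      · simp
      · simp only [Finset.some_mem_insertNone, Forest.mem_verts_vee, Finset.mem_union,
          Finset.mem_image, Finset.mem_map, Finset.mem_insert, Function.Embedding.some_apply,
          Option.some.injEq, exists_eq_right]
        rw [or_left_comm]
    rw [hset]
    exact h3
  loc := veeLoc x y A B
  isOrientation_loc := by
    have hA := (x.forest.root_nonempty A.2).ne_empty
    have hB := (y.forest.root_nonempty B.2).ne_empty
    intro S hS
    rw [Forest.mem_verts_vee] at hS
    rcases hS with rfl | ⟨C, hC, rfl⟩ | ⟨D, hD, rfl⟩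
    · rw [veeLoc, if_pos rfl, Forest.halfEdges, Forest.children_vee_new]
      have h := ((isOrientation_gen (sumSet A.1 B.1, true)).mul
        (isOrientation_gen (sumSet A.1 (∅ : Finset J), false)) (by simp)).mul
        (isOrientation_gen (sumSet (∅ : Finset I) B.1, false))
        (by simp [sumSet_inj, Ne.symm hA])
      have hset : (insert (sumSet A.1 B.1, true) (Finset.image (fun C => (C, false))
          {sumSet A.1 (∅ : Finset J), sumSet (∅ : Finset I) B.1})) =
          ({(sumSet A.1 B.1, true)} ∪ {(sumSet A.1 ∅, false)}) ∪
            {(sumSet ∅ B.1, false)} := by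
        ext a
        simp only [Finset.mem_insert, Finset.mem_image, Finset.mem_union, Finset.mem_singleton]
        constructor
        · rintro (h | ⟨_, rfl | rfl, rfl⟩)
          · exact Or.inl (Or.inl h)
          · exact Or.inl (Or.inr rfl)
          · exact Or.inr rfl
        · rintro ((h | h) | h)
          · exact Or.inl h
          · exact Or.inr ⟨_, Or.inl rfl, h.symm⟩
          · exact Or.inr ⟨_, Or.inr rfl, h.symm⟩
      rw [hset]
      exact h
    · have hne : sumSet C ∅ ≠ sumSet A.1 B.1 := fun h => hB (sumSet_inj.1 h).2.symm
      rw [veeLoc, if_neg hne, if_pos (by simp), toLeft_sumSet]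
      refine (x.isOrientation_loc C hC).rename _ _ (by simp) ?_ ?_
      · rintro ⟨C₁, b₁⟩ _ ⟨C₂, b₂⟩ _ h
        simpa [sumSet_inj] using h
      · intro a
        rw [Forest.mem_halfEdges, Forest.children_vee_left]
        constructor
        · rintro (rfl | ⟨S, hS, rfl⟩)
          · exact ⟨(C, true), (Forest.mem_halfEdges _).2 (Or.inl rfl), rfl⟩
          · obtain ⟨D, hD, rfl⟩ := Finset.mem_image.1 hS
            exact ⟨(D, false), (Forest.mem_halfEdges _).2 (Or.inr ⟨D, hD, rfl⟩), rfl⟩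
        · rintro ⟨h, hh, h'⟩
          rw [← Option.some.inj h']
          rcases (Forest.mem_halfEdges _).1 hh with rfl | ⟨D, hD, rfl⟩
          · exact Or.inl rfl
          · exact Or.inr ⟨_, Finset.mem_image_of_mem _ hD, rfl⟩
    · have hne : sumSet ∅ D ≠ sumSet A.1 B.1 := fun h => hA (sumSet_inj.1 h).1.symm
      have hD0 : D ≠ ∅ :=
        (y.forest.nonempty D (y.forest.mem_verts.1 hD).1).ne_empty
      rw [veeLoc, if_neg hne, if_neg (by simpa using hD0), toRight_sumSet]
      refine (y.isOrientation_loc D hD).rename _ _ (by simp) ?_ ?_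
      · rintro ⟨C₁, b₁⟩ _ ⟨C₂, b₂⟩ _ h
        simpa [sumSet_inj] using h
      · intro a
        rw [Forest.mem_halfEdges, Forest.children_vee_right]
        constructor
        · rintro (rfl | ⟨S, hS, rfl⟩)
          · exact ⟨(D, true), (Forest.mem_halfEdges _).2 (Or.inl rfl), rfl⟩
          · obtain ⟨E, hE, rfl⟩ := Finset.mem_image.1 hS
            exact ⟨(E, false), (Forest.mem_halfEdges _).2 (Or.inr ⟨E, hE, rfl⟩), rfl⟩
        · rintro ⟨h, hh, h'⟩
          rw [← Option.some.inj h']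
          rcases (Forest.mem_halfEdges _).1 hh with rfl | ⟨E, hE, rfl⟩
          · exact Or.inl rfl
          · exact Or.inr ⟨_, Finset.mem_image_of_mem _ hE, rfl⟩

end InnerOrientedForest

end inner

end BesselOperad

end

/-!
On the level of supports both sides are sums over pairs `(A, B)` of a root of `F₁` and a root of
`F₂`: the path from a grafted leaf of `Ω` to the root has a single inner vertex, so that an
assignment of roots to the path is just a root. It remains to compare orientations for a fixed pair.

In the identity `o' ∧ R ∧ o'' ∧ ∏ (e⁺ ∧ e⁻) = ∏ (ℓ ∧ r) ∧ o` that determines `o' ⊗ o''`, move the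
root `A` to the end of `o''` and detach it: multiplication by the lower half-edge `A⁻` turns the
identity into one whose edges are those of `F₁` with `A` grafted on a new vertex. The product of the
opened identities for `(F₁, A)` and `(F₂, B)`, where `R_{F₂}` becomes the outgoing half-edge `v⁺`,
is the identity for `F₁ ∨ F₂` up to a sign. All signs are determined by numbers of leaves, roots and
inner vertices, and these cancel because the degrees in the identity itself give
`|I| + |roots| ≡ |V(F)|` modulo 2.
-/

noncomputable section

namespace BesselOperad

section exterior

variable {X Y Z : Type*}

theorem algHom_ext {A : Type*} [Semiring A] [Algebra ℚ A] {φ ψ : Ext X →ₐ[ℚ] A}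
    (h : ∀ x, φ (gen x) = ψ (gen x)) : φ = ψ :=
  ExteriorAlgebra.hom_ext (Finsupp.lhom_ext' fun x => LinearMap.ext_ring (h x))

@[simp] theorem rename_gen (p : X → Option Y) (x : X) :
    rename p (gen x) = (p x).elim 0 gen := substHom_gen _ _ _

theorem rename_rename (p : X → Option Y) (q : Y → Option Z) (z : Ext X) :
    rename q (rename p z) = rename (fun x => (p x).bind q) z := by
  refine DFunLike.congr_fun (f := (rename q).comp (rename p)) (algHom_ext fun x => ?_) z
  rcases h : p x with _ | y <;> simp [h]

/-- The subalgebra of the exterior algebra generated by the basis vectors in `s`, that is, the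
exterior algebra on `s`. -/
def supported (s : Set X) : Subalgebra ℚ (Ext X) := Algebra.adjoin ℚ (gen '' s)

theorem gen_mem_supported {s : Set X} {x : X} (hx : x ∈ s) : gen x ∈ supported s :=
  Algebra.subset_adjoin ⟨x, hx, rfl⟩

theorem IsOrientation.mem_supported {s : Finset X} {o : Ext X} (h : IsOrientation s o) :
    o ∈ supported (s : Set X) := by
  obtain ⟨l, -, hl, ho⟩ := h
  have hw : wedge l ∈ supported (s : Set X) := Subalgebra.list_prod_mem _ fun z hz => by
    obtain ⟨x, hx, rfl⟩ := List.mem_map.1 hz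
    exact gen_mem_supported ((hl x).1 hx)
  rcases ho with rfl | rfl
  exacts [hw, neg_mem hw]

theorem algHom_congr_of_mem_supported {A : Type*} [Semiring A] [Algebra ℚ A]
    {φ ψ : Ext X →ₐ[ℚ] A} {s : Set X} {z : Ext X} (hz : z ∈ supported s)
    (h : ∀ x ∈ s, φ (gen x) = ψ (gen x)) : φ z = ψ z :=
  AlgHom.eqOn_adjoin_iff.2 (Set.forall_mem_image.2 h) hz

theorem algHom_mem_of_mem_supported {A : Type*} [Semiring A] [Algebra ℚ A] (φ : Ext X →ₐ[ℚ] A)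
    {s : Set X} {S : Subalgebra ℚ A} (h : ∀ x ∈ s, φ (gen x) ∈ S) {z : Ext X}
    (hz : z ∈ supported s) : φ z ∈ S :=
  (Algebra.adjoin_le (Set.forall_mem_image.2 h) : supported s ≤ S.comap φ) hz

theorem rename_mem_supported (q : X → Y) {s : Set X} {t : Set Y} (h : Set.MapsTo q s t)
    {z : Ext X} (hz : z ∈ supported s) : rename (fun x => some (q x)) z ∈ supported t :=
  algHom_mem_of_mem_supported _ (fun x hx => by simpa using gen_mem_supported (h hx)) hz

theorem contractRight_mul_gen (x y : X) (z : Ext X) :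
    CliffordAlgebra.contractRight (z * gen y) (Finsupp.lapply x) =
      Finsupp.single y (1 : ℚ) x • z -
        CliffordAlgebra.contractRight z (Finsupp.lapply x) * gen y :=
  CliffordAlgebra.contractRight_mul_ι (Q := (0 : QuadraticForm ℚ (X →₀ ℚ))) _ _ _

theorem contractRight_eq_zero_of_mem_supported {s : Set X} {x : X} (hx : x ∉ s) {z : Ext X}
    (hz : z ∈ supported s) : CliffordAlgebra.contractRight z (Finsupp.lapply x) = 0 := by
  suffices h : ∀ w : Ext X, CliffordAlgebra.contractRight w (Finsupp.lapply x) = 0 →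
      CliffordAlgebra.contractRight (w * z) (Finsupp.lapply x) = 0 by
    simpa using h 1 (CliffordAlgebra.contractRight_one ..)
  induction hz using Algebra.adjoin_induction with
  | mem _ h =>
    obtain ⟨y, hy, rfl⟩ := h
    intro w hw
    rw [contractRight_mul_gen, Finsupp.single_eq_of_ne (by rintro rfl; exact hx hy), hw, zero_smul,
      zero_mul, sub_zero]
  | algebraMap r =>
    intro w hw
    rw [CliffordAlgebra.contractRight_mul_algebraMap, hw, zero_mul]
  | add a b _ _ ha hb =>
    intro w hw
    rw [mul_add, map_add, LinearMap.add_apply, ha w hw, hb w hw, add_zero]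
  | mul a b _ _ ha hb =>
    intro w hw
    rw [← mul_assoc]
    exact hb _ (ha w hw)

theorem contractRight_mul_gen_self {s : Set X} {x : X} (hx : x ∉ s) {z : Ext X}
    (hz : z ∈ supported s) :
    CliffordAlgebra.contractRight (z * gen x) (Finsupp.lapply x) = z := by
  rw [contractRight_mul_gen, contractRight_eq_zero_of_mem_supported hx hz, Finsupp.single_eq_same,
    one_smul, zero_mul, sub_zero]

theorem mul_gen_cancel {s : Set X} {x : X} (hx : x ∉ s) {z w : Ext X} (hz : z ∈ supported s)
    (hw : w ∈ supported s) (h : z * gen x = w * gen x) : z = w := by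
  rw [← contractRight_mul_gen_self hx hz, h, contractRight_mul_gen_self hx hw]

theorem extComp_mul_gen {s : Set X} {x : X} (hx : x ∉ s) {z : Ext X} (hz : z ∈ supported s)
    (p : X → Option Z) (q : Y → Z) (w : Ext Y) :
    extComp x p q (z * gen x) w = rename p z * rename (fun y => some (q y)) w := by
  rw [extComp_apply, contractRight_mul_gen_self hx hz]

theorem IsOrientation.exists_mul_gen [DecidableEq X] {s : Finset X} {o : Ext X}
    (h : IsOrientation s o) {x : X} (hx : x ∈ s) :
    ∃ o', IsOrientation (s.erase x) o' ∧ o = o' * gen x := by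
  obtain ⟨l, hnodup, hl, ho⟩ := h
  have hw : IsOrientation (s.erase x) (wedge (l.erase x)) :=
    isOrientation_wedge (hnodup.erase x) fun y => by
      rw [hnodup.mem_erase_iff, Finset.mem_erase, hl]
  have hperm : l.Perm (l.erase x ++ [x]) :=
    (List.perm_cons_erase ((hl x).2 hx)).trans (List.perm_append_singleton x _).symm
  have ho' : o = wedge (l.erase x) * gen x ∨ o = -wedge (l.erase x) * gen x := by
    have hlast : wedge (l.erase x ++ [x]) = wedge (l.erase x) * gen x := by simp
    rw [neg_mul, ← hlast]
    rcases wedge_perm hperm with h | h <;> rcases ho with rfl | rfl <;> simp [h]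
  rcases ho' with h | h
  exacts [⟨_, hw, h⟩, ⟨_, hw.neg, h⟩]

/-- The elements of degree `n` modulo 2 of the exterior algebra. -/
abbrev evenOdd (X : Type*) (n : ZMod 2) : Submodule ℚ (Ext X) :=
  CliffordAlgebra.evenOdd (0 : QuadraticForm ℚ (X →₀ ℚ)) n

theorem gen_mem_evenOdd (x : X) : gen x ∈ evenOdd X 1 :=
  CliffordAlgebra.ι_mem_evenOdd_one _ _

theorem mul_mem_evenOdd {m n : ZMod 2} {z w : Ext X} (hz : z ∈ evenOdd X m)
    (hw : w ∈ evenOdd X n) : z * w ∈ evenOdd X (m + n) :=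
  SetLike.mul_mem_graded hz hw

theorem IsOrientation.mem_evenOdd {s : Finset X} {o : Ext X} (h : IsOrientation s o) :
    o ∈ evenOdd X s.card := by
  classical
  obtain ⟨l, hnodup, hl, ho⟩ := h
  have hs : l.toFinset = s := Finset.ext fun x => by rw [List.mem_toFinset, hl]
  have hw : wedge l ∈ evenOdd X s.card := by
    have := SetLike.list_prod_map_mem_graded l (fun _ => (1 : ZMod 2)) gen
      (A := evenOdd X) fun x _ => gen_mem_evenOdd x
    rwa [List.map_const', List.sum_replicate, nsmul_one,
      ← List.toFinset_card_of_nodup hnodup, hs] at this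
  rcases ho with rfl | rfl
  exacts [hw, neg_mem hw]

theorem algHom_mem_evenOdd {φ : Ext X →ₐ[ℚ] Ext Y} (h : ∀ x, φ (gen x) ∈ evenOdd Y 1)
    {n : ZMod 2} {z : Ext X} (hz : z ∈ evenOdd X n) : φ z ∈ evenOdd Y n := by
  have hι : ∀ m, φ (ExteriorAlgebra.ι ℚ m) ∈ evenOdd Y 1 := fun m => by
    induction m using Finsupp.induction_linear with
    | zero => simp
    | add a b ha hb => simpa using add_mem ha hb
    | single x r =>
      have : ExteriorAlgebra.ι ℚ (Finsupp.single x r) = r • gen x := by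
        rw [gen, ← map_smul, Finsupp.smul_single_one]
      rw [this, map_smul]
      exact Submodule.smul_mem _ _ (h x)
  have hpow : ∀ k : ℕ, ∀ w ∈ LinearMap.range (ExteriorAlgebra.ι ℚ (M := X →₀ ℚ)) ^ k,
      φ w ∈ evenOdd Y k := fun k w hw => by
    induction hw using Submodule.pow_induction_on_left' with
    | algebraMap r =>
      simpa [Algebra.algebraMap_eq_smul_one] using
        Submodule.smul_mem _ r SetLike.GradedOne.one_mem
    | add a b _ _ _ ha hb => simpa using add_mem ha hb
    | mem_mul a ha i b _ hb =>
      obtain ⟨m, rfl⟩ := ha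
      rw [map_mul, Nat.succ_eq_add_one, Nat.cast_add, Nat.cast_one, add_comm]
      exact mul_mem_evenOdd (hι m) hb
  induction hz using Submodule.iSup_induction' with
  | mem k w hw => exact k.2 ▸ hpow k w hw
  | zero => simp
  | add a b _ _ ha hb => simpa using add_mem ha hb

theorem rename_mem_evenOdd (q : X → Y) {n : ZMod 2} {z : Ext X} (hz : z ∈ evenOdd X n) :
    rename (fun x => some (q x)) z ∈ evenOdd Y n :=
  algHom_mem_evenOdd (fun x => by simpa using gen_mem_evenOdd (q x)) hz

theorem mul_comm_of_mem_evenOdd {m n : ℕ} {z w : Ext X} (hz : z ∈ evenOdd X m)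
    (hw : w ∈ evenOdd X n) : z * w = (-1 : ℚ) ^ (m * n) • (w * z) := by
  have h := CliffordAlgebra.map_mul_map_of_isOrtho_of_mem_evenOdd
    (.id (0 : QuadraticForm ℚ (X →₀ ℚ))) (.id _) (fun _ _ => by simp [QuadraticMap.IsOrtho])
    z w hz hw
  rw [CliffordAlgebra.map_id, ← Nat.cast_mul, uzpow_natCast, mul_comm n] at h
  simpa [Units.smul_def, ← Int.cast_smul_eq_zsmul ℚ] using h

theorem mem_center_of_mem_evenOdd {z : Ext X} (hz : z ∈ evenOdd X 0) :
    z ∈ Subalgebra.center ℚ (Ext X) := by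
  refine Subalgebra.mem_center_iff.2 fun w => ?_
  induction w using DirectSum.Decomposition.inductionOn (evenOdd X) with
  | zero => simp
  | @homogeneous i w =>
    have hw : (w : Ext X) ∈ evenOdd X i.val := by simp
    simpa using mul_comm_of_mem_evenOdd (n := 0) hw (by simpa using hz)
  | add a b ha hb => rw [add_mul, ha, hb, mul_add]

theorem neg_one_pow_congr_of_cast_eq {m n : ℕ} (h : (m : ZMod 2) = n) :
    (-1 : ℚ) ^ m = (-1) ^ n :=
  neg_one_pow_congr <| by rw [← ZMod.natCast_eq_zero_iff_even, h, ZMod.natCast_eq_zero_iff_even]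

theorem cast_eq_of_mem_evenOdd {m n : ZMod 2} {z : Ext X} (hm : z ∈ evenOdd X m)
    (hn : z ∈ evenOdd X n) (hz : z ≠ 0) : m = n :=
  DirectSum.degree_eq_of_mem_mem _ hm hn hz

theorem gen_mul_gen_mem_evenOdd (x y : X) : gen x * gen y ∈ evenOdd X 0 :=
  CliffordAlgebra.ι_mul_ι_mem_evenOdd_zero _ _ _

/-- The product `x ∧ y` as an element of the center of the exterior algebra, which is commutative,
so that there are products of such pairs over finite sets. -/
def genPair (x y : X) : Subalgebra.center ℚ (Ext X) :=
  ⟨gen x * gen y, mem_center_of_mem_evenOdd (gen_mul_gen_mem_evenOdd x y)⟩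

variable {D : Type*} (f g : D → X) (s : Finset D)

theorem coe_prod_genPair :
    ((∏ C ∈ s, genPair (f C) (g C) : Subalgebra.center ℚ (Ext X)) : Ext X) =
      (s.toList.map fun C => gen (f C) * gen (g C)).prod := by
  rw [← Finset.prod_map_toList, SubmonoidClass.coe_list_prod, List.map_map]
  rfl

theorem rename_prod_genPair (q : X → Y) :
    rename (fun x => some (q x))
        (∏ C ∈ s, genPair (f C) (g C) : Subalgebra.center ℚ (Ext X)) =
      (∏ C ∈ s, genPair (q (f C)) (q (g C)) : Subalgebra.center ℚ (Ext Y)) := by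
  simp only [coe_prod_genPair, map_list_prod, List.map_map, Function.comp_def, map_mul, rename_gen,
    Option.elim_some]

theorem prod_genPair_mem_evenOdd :
    ((∏ C ∈ s, genPair (f C) (g C) : Subalgebra.center ℚ (Ext X)) : Ext X) ∈ evenOdd X 0 :=
  Finset.prod_induction _ (fun z : Subalgebra.center ℚ (Ext X) => (z : Ext X) ∈ evenOdd X 0)
    (fun _ _ => mul_mem_evenOdd) SetLike.GradedOne.one_mem
    fun C _ => gen_mul_gen_mem_evenOdd (f C) (g C)

theorem prod_genPair_mem_supported {t : Set X} (h : ∀ C ∈ s, f C ∈ t ∧ g C ∈ t) :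
    ((∏ C ∈ s, genPair (f C) (g C) : Subalgebra.center ℚ (Ext X)) : Ext X) ∈ supported t :=
  Finset.prod_induction _ (fun z : Subalgebra.center ℚ (Ext X) => (z : Ext X) ∈ supported t)
    (fun _ _ => mul_mem) (one_mem _)
    fun C hC => mul_mem (gen_mem_supported (h C hC).1) (gen_mem_supported (h C hC).2)

end exterior

namespace Forest

theorem glue_erase {I J K : Type*} [DecidableEq I] {i : I} (e : {x : I // x ≠ i} ⊕ J ≃ K)
    (S : Finset I) (A : Finset J) : glue e (S.erase i) A = glue e S A := by
  have : (S.erase i).subtype (fun x => x ≠ i) = S.subtype fun x => x ≠ i := by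
    ext ⟨x, hx⟩
    simp [hx]
  rw [glue, glue, this]

section singletonPath

variable {I J K : Type*} [Fintype I] [DecidableEq I] [Fintype J] [DecidableEq J]
  {i : I} {e : {x : I // x ≠ i} ⊕ J ≃ K} {F : Forest I} {D : Finset I}
  {G : Forest J} {A : {A // A ∈ G.roots}}

theorem branch_eq_erase_of_path_eq (hD : F.path i = {D}) : F.branch i D = D.erase i := by
  obtain ⟨-, hcard, hi⟩ := F.mem_path.1 (hD ▸ Finset.mem_singleton_self D)
  ext x
  rw [mem_branch, Finset.mem_erase, and_comm]
  refine and_congr_left fun _ => ⟨?_, fun hx E hE hiE hED hxE => ?_⟩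
  · rintro h rfl
    refine h {x} (F.singleton_mem x) (Finset.mem_singleton_self x)
      (Finset.ssubset_iff_subset_ne.2 ⟨Finset.singleton_subset_iff.2 hi, ?_⟩)
      (Finset.mem_singleton_self x)
    rintro rfl
    simp at hcard
  · have hE' : E ∈ F.path i := F.mem_path.2 ⟨hE, Finset.one_lt_card.2 ⟨x, hxE, i, hiE, hx⟩, hiE⟩
    rw [hD, Finset.mem_singleton] at hE'
    exact hED.ne hE'

theorem rootOf_eq_of_path_eq (hD : F.path i = {D}) : F.rootOf i = D := by
  obtain ⟨hmem, hcard, hi⟩ := F.mem_path.1 (hD ▸ Finset.mem_singleton_self D)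
  refine F.rootOf_eq (F.mem_roots.2 ⟨hmem, fun B hB hDB => ?_⟩) hi
  have hB' : B ∈ F.path i :=
    F.mem_path.2 ⟨hB, hcard.trans_le (Finset.card_le_card hDB), hDB hi⟩
  rw [hD, Finset.mem_singleton] at hB'
  exact hB'.symm

theorem lump_of_path_eq (hD : F.path i = {D}) (C : Finset I) (A' : Finset J) :
    lump F i G (fun _ => A) C A' = if D ⊆ C ∧ A.1 = A' then D.erase i else ∅ := by
  ext x
  rw [mem_lump, Subtype.exists]
  simp only [hD, Finset.mem_singleton, exists_prop, exists_eq_left, branch_eq_erase_of_path_eq hD]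
  split_ifs with h <;> simp [h]

theorem graftRoot_of_path_eq (hD : F.path i = {D}) (A' : Finset J) :
    graftRoot F G (fun _ => A) e A' = glue e (if A' = A.1 then D else ∅) A' := by
  rw [graftRoot, lump_of_path_eq hD]
  by_cases h : A' = A.1
  · rw [if_pos ⟨Finset.subset_univ _, h.symm⟩, if_pos h, glue_erase]
  · rw [if_neg fun h' => h h'.2.symm, if_neg h]

theorem rename_graftRoot_of_path_eq (hD : F.path i = {D}) {t : Ext (Finset J)}
    (ht : IsOrientation (G.roots.erase A.1) t) :
    rename (fun C => some (graftRoot F G (fun _ => A) e C)) (t * gen A.1) =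
      rename (fun C => some (glue e ∅ C)) t * gen (glue e D A.1) := by
  rw [map_mul, rename_gen, Option.elim_some, graftRoot_of_path_eq hD, if_pos rfl]
  congr 1
  refine algHom_congr_of_mem_supported ht.mem_supported fun C hC => ?_
  rw [rename_gen, rename_gen, graftRoot_of_path_eq hD, if_neg (Finset.ne_of_mem_erase hC)]

variable [Fintype K] [DecidableEq K]

theorem mem_clusters_graft_of_path_eq (hD : F.path i = {D}) {S : Finset K} :
    S ∈ (graft F G (fun _ => A) e).clusters ↔ (∃ C ∈ F.clusters, i ∉ C ∧ S = glue e C ∅) ∨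
      (∃ C ∈ G.clusters, S = glue e ∅ C) ∨ S = glue e D A.1 := by
  refine (mem_graftClusters F G (fun _ => A) e).trans (or_congr_right (or_congr_right ?_))
  have hglue : ∀ E : {E // E ∈ F.path i},
      glue e (lump F i G (fun _ => A) E.1 A.1) A.1 = glue e D A.1 := by
    rintro ⟨E, hE⟩
    rw [hD, Finset.mem_singleton] at hE
    rw [lump_of_path_eq hD, if_pos ⟨hE.ge, rfl⟩, glue_erase]
  have : Nonempty {E // E ∈ F.path i} := ⟨D, hD ▸ Finset.mem_singleton_self D⟩
  simp only [hglue, exists_const]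

theorem roots_graft_of_path_eq (hD : F.path i = {D}) :
    (graft F G (fun _ => A) e).roots = (F.roots.erase D).image (glue e · ∅) ∪
      insert (glue e D A.1) ((G.roots.erase A.1).image (glue e ∅)) := by
  have hG : G.roots.image (graftRoot F G (fun _ => A) e) =
      insert (glue e D A.1) ((G.roots.erase A.1).image (glue e ∅)) := by
    conv_lhs => rw [← Finset.insert_erase A.2, Finset.image_insert, graftRoot_of_path_eq hD,
      if_pos rfl]
    congr 1
    refine Finset.image_congr fun C hC => ?_
    rw [graftRoot_of_path_eq hD, if_neg (Finset.ne_of_mem_erase hC)]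
  rw [← hG]
  ext S
  simp only [mem_roots_graft, rootOf_eq_of_path_eq hD, Finset.mem_union, Finset.mem_image,
    Finset.mem_erase, and_assoc, and_left_comm (a := _ ∈ F.roots)]

end singletonPath

section glue

theorem insertNone_ne_map_some {I : Type*} (A C : Finset I) :
    Finset.insertNone A ≠ C.map Function.Embedding.some := fun h => by
  have hnone := Finset.none_mem_insertNone (s := A)
  simp [h] at hnone

variable {I J : Type*} [Fintype I] [DecidableEq I] [Fintype J] [DecidableEq J]

theorem glue_starEquiv_of_mem {S : Finset Bool} (h : true ∈ S) (A : Finset I) :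
    glue (starEquiv I) S A = Finset.insertNone A := by
  ext k
  obtain ⟨⟨_ | _, hx⟩ | y, rfl⟩ := (starEquiv I).surjective k
  · exact absurd rfl hx
  · rw [mem_glue_inl]
    simpa [starEquiv] using h
  · rw [mem_glue_inr]
    simp [starEquiv]

theorem glue_starEquiv_of_notMem {S : Finset Bool} (h : true ∉ S) (A : Finset I) :
    glue (starEquiv I) S A = A.map Function.Embedding.some := by
  ext k
  obtain ⟨⟨_ | _, hx⟩ | y, rfl⟩ := (starEquiv I).surjective k
  · exact absurd rfl hx
  · rw [mem_glue_inl]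
    simpa [starEquiv] using h
  · rw [mem_glue_inr]
    simp [starEquiv]

@[simp] theorem glue_sharpEquiv (S : Finset (Option I)) (B : Finset J) :
    glue (sharpEquiv I J) S B = sumSet (Finset.eraseNone S) B := by
  ext k
  obtain ⟨⟨_ | x, hx⟩ | y, rfl⟩ := (sharpEquiv I J).surjective k
  · exact absurd rfl hx
  · rw [mem_glue_inl]
    simp [sharpEquiv]
  · rw [mem_glue_inr]
    simp [sharpEquiv]

end glue

section omega

variable {I J : Type*} [Fintype I] [DecidableEq I] [Fintype J] [DecidableEq J]

theorem path_omegaTree : omegaTree.path false = {{false, true}} := by decide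

variable (F : Forest I) (G : Forest J) (A : {A // A ∈ F.roots}) (B : {B // B ∈ G.roots})

/-- The forest on `{#} ⊔ I` obtained from `F` by joining the root `A` to the new leaf `#`, which
is `none`. This is the term of `ω_{⋆,#} ∘_⋆ F` given by `A`. -/
abbrev starGraft : Forest (Option I) := graft omegaTree F (fun _ => A) (starEquiv I)

theorem mem_clusters_starGraft {S : Finset (Option I)} : S ∈ (starGraft F A).clusters ↔
    S = {none} ∨ (∃ C ∈ F.clusters, S = C.map Function.Embedding.some) ∨
      S = Finset.insertNone A.1 := by
  have hΩ : ∀ C, C ∈ omegaTree.clusters ∧ false ∉ C ↔ C = {true} := by decide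
  have hnone : Finset.insertNone (∅ : Finset I) = {none} := rfl
  rw [mem_clusters_graft_of_path_eq path_omegaTree, glue_starEquiv_of_mem (by simp)]
  simp only [← and_assoc, hΩ, exists_eq_left, glue_starEquiv_of_notMem (Finset.notMem_empty true),
    glue_starEquiv_of_mem (Finset.mem_singleton_self true), hnone]

theorem roots_starGraft : (starGraft F A).roots = insert (Finset.insertNone A.1)
    ((F.roots.erase A.1).image (Finset.map Function.Embedding.some)) := by
  rw [roots_graft_of_path_eq path_omegaTree, roots_omegaTree, glue_starEquiv_of_mem (by simp)]
  simp only [Finset.erase_singleton, Finset.image_empty, Finset.empty_union]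
  simp only [Finset.image, glue_starEquiv_of_notMem (Finset.notMem_empty true)]

theorem card_roots_starGraft : (starGraft F A).roots.card = F.roots.card := by
  rw [roots_starGraft, Finset.card_insert_of_notMem,
    Finset.card_image_of_injective _ (Finset.map_injective _), Finset.card_erase_add_one A.2]
  intro h
  obtain ⟨C, -, hC⟩ := Finset.mem_image.1 h
  exact insertNone_ne_map_some _ _ hC.symm

theorem path_starGraft : (starGraft F A).path none = {Finset.insertNone A.1} := by
  ext S
  rw [mem_path, mem_clusters_starGraft, Finset.mem_singleton]
  constructor
  · rintro ⟨rfl | ⟨C, hC, rfl⟩ | rfl, hcard, hnone⟩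
    · simp at hcard
    · simp at hnone
    · rfl
  · rintro rfl
    refine ⟨.inr (.inr rfl), ?_, Finset.none_mem_insertNone⟩
    rw [Finset.card_insertNone, Nat.lt_add_left_iff_pos]
    exact Finset.card_pos.2 (F.root_nonempty A.2)

theorem graft_starGraft :
    graft (starGraft F A) G (fun _ => B) (sharpEquiv I J) = F.vee G A B := by
  ext S
  have hF : (∃ C ∈ (starGraft F A).clusters, none ∉ C ∧ S = glue (sharpEquiv I J) C ∅) ↔
      ∃ C ∈ F.clusters, sumSet C ∅ = S := by
    constructor
    · rintro ⟨C, hC, hnone, rfl⟩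
      rcases (mem_clusters_starGraft F A).1 hC with rfl | ⟨C, hC, rfl⟩ | rfl
      · simp at hnone
      · exact ⟨_, ‹_›, by simp⟩
      · simp at hnone
    · rintro ⟨C, hC, rfl⟩
      exact ⟨C.map Function.Embedding.some,
        (mem_clusters_starGraft F A).2 (.inr (.inl ⟨C, hC, rfl⟩)), by simp, by simp⟩
  rw [mem_clusters_graft_of_path_eq (path_starGraft F A), mem_clusters_vee, hF]
  simp only [glue_sharpEquiv, Finset.eraseNone_empty, Finset.eraseNone_insertNone,
    eq_comm (a := S)]
  exact or_rotate.symm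

theorem roots_vee : (F.vee G A B).roots = (F.roots.erase A.1).image (sumSet · ∅) ∪
    insert (sumSet A.1 B.1) ((G.roots.erase B.1).image (sumSet ∅)) := by
  have herase : (starGraft F A).roots.erase (Finset.insertNone A.1) =
      (F.roots.erase A.1).image (Finset.map Function.Embedding.some) := by
    rw [roots_starGraft, Finset.erase_insert]
    intro h
    obtain ⟨C, -, hC⟩ := Finset.mem_image.1 h
    exact insertNone_ne_map_some _ _ hC.symm
  rw [← graft_starGraft, roots_graft_of_path_eq (path_starGraft F A), herase, Finset.image_image]
  simp [Function.comp_def, Finset.image]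

end omega

end Forest

section halfEdgePairs

variable {D E : Type*}

/-- The product of the pairs formed by the two half-edges of each of the edges `C ∈ s`, the upper
one being the first factor if `b` is `true` and the second factor if `b` is `false`. -/
def halfEdgePairs (b : Bool) (s : Finset D) : Subalgebra.center ℚ (Ext (Option (D × Bool))) :=
  ∏ C ∈ s, genPair (some (C, b)) (some (C, !b))

theorem mul_halfEdgePairs (b : Bool) (s : Finset D) (z : Ext (Option (D × Bool))) :
    z * halfEdgePairs b s = halfEdgePairs b s * z :=
  Subalgebra.mem_center_iff.1 (halfEdgePairs b s).2 z

theorem halfEdgePairs_mem_evenOdd (b : Bool) (s : Finset D) :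
    (halfEdgePairs b s : Ext (Option (D × Bool))) ∈ evenOdd _ 0 :=
  prod_genPair_mem_evenOdd _ _ s

theorem halfEdgePairs_mem_supported {b : Bool} {s : Finset D} {C : D} (hC : C ∉ s) (b' : Bool) :
    (halfEdgePairs b s : Ext (Option (D × Bool))) ∈ supported {h | h ≠ some (C, b')} :=
  prod_genPair_mem_supported _ _ s fun E hE => by
    have hne : E ≠ C := ne_of_mem_of_not_mem hE hC
    simp [hne]

theorem halfEdgePairs_insert [DecidableEq D] (b : Bool) {s : Finset D} {C : D} (hC : C ∉ s) :
    (halfEdgePairs b (insert C s) : Ext (Option (D × Bool))) =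
      gen (some (C, b)) * gen (some (C, !b)) * halfEdgePairs b s := by
  rw [halfEdgePairs, Finset.prod_insert hC]
  rfl

theorem halfEdgePairs_union [DecidableEq D] (b : Bool) {s t : Finset D} (h : Disjoint s t) :
    (halfEdgePairs b (s ∪ t) : Ext (Option (D × Bool))) =
      halfEdgePairs b s * halfEdgePairs b t := by
  rw [halfEdgePairs, Finset.prod_union h]
  rfl

theorem rename_halfEdgePairs [DecidableEq E] (b : Bool) (s : Finset D) {q : D → E}
    (hq : q.Injective) {p : Option (D × Bool) → Option (E × Bool)}
    (hp : ∀ h, p (some h) = some (h.map q id)) :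
    rename (fun h => some (p h)) (halfEdgePairs b s) = halfEdgePairs b (s.image q) := by
  rw [halfEdgePairs, rename_prod_genPair, halfEdgePairs, Finset.prod_image hq.injOn]
  simp only [hp, Prod.map_apply, id]

end halfEdgePairs

section outerProduct

variable {I : Type*}

theorem outerProduct_mem_evenOdd {m n : ZMod 2} {a : Ext I} {r : Ext (Finset I)}
    (ha : a ∈ evenOdd I m) (hr : r ∈ evenOdd (Finset I) n) :
    outerProduct a r ∈ evenOdd _ (m + 1 + n) :=
  mul_mem_evenOdd (mul_mem_evenOdd (rename_mem_evenOdd _ ha) (gen_mem_evenOdd _))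
    (rename_mem_evenOdd _ hr)

theorem outerProduct_mem_supported [Fintype I] {s : Finset (Finset I)} {A : Finset I} (hA : A ∉ s)
    {a : Ext I} {r : Ext (Finset I)} (ha : IsOrientation Finset.univ a) (hr : IsOrientation s r) :
    outerProduct a r ∈ supported {h | h ≠ some (A, true)} :=
  mul_mem (mul_mem (rename_mem_supported _ (by simp [Set.MapsTo]) ha.mem_supported)
    (gen_mem_supported (by simp)))
    (rename_mem_supported _ (fun C hC => by simpa using ne_of_mem_of_not_mem hC hA)
      hr.mem_supported)

end outerProduct

section inner

variable {I : Type*} [Fintype I] [DecidableEq I]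

theorem innerEdgePairs_eq (F : Forest I) : innerEdgePairs F = halfEdgePairs true F.innerEdges :=
  (coe_prod_genPair _ _ _).symm

theorem leafRootPairs_eq (F : Forest I) : leafRootPairs F = halfEdgePairs false F.trivialTrees :=
  (coe_prod_genPair _ _ _).symm

namespace Forest

variable (F : Forest I) (A : Finset I)

/-- The edges above the inner vertices that are inner edges once the root `A` is joined to a new
inner vertex. -/
def openEdges : Finset (Finset I) := F.verts.filter fun C => C ∉ F.roots.erase A

variable {F A}

theorem openEdges_of_mem (hA : A ∈ F.verts) : F.openEdges A = insert A F.innerEdges := by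
  ext C
  rcases eq_or_ne C A with rfl | h
  · simp [openEdges, hA]
  · simp [openEdges, innerEdges, h]

theorem openEdges_of_notMem (hA : A ∉ F.verts) : F.openEdges A = F.innerEdges :=
  Finset.filter_congr fun C hC => by
    rw [Finset.mem_erase, and_iff_right (ne_of_mem_of_not_mem hC hA)]

end Forest

namespace InnerOrientedForest

variable (x : InnerOrientedForest I)

/-- The exterior product obtained from the global orientation by replacing each inner vertex by its
local orientation. -/
def expansion : Ext (Option (Finset I × Bool)) := substHom x.expand x.expand_swap x.glob

theorem expand_mem_evenOdd (v : Option (Finset I)) : x.expand v ∈ evenOdd _ 1 := by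
  by_cases hv : v ∈ Finset.insertNone x.forest.verts
  · have hcard : ((expandSet x.forest v).card : ZMod 2) = 1 := by
      rcases v with _ | v
      · simp [expandSet]
      · rw [expandSet, Finset.card_map, x.forest.card_halfEdges (by simpa using hv)]
        rfl
    exact hcard ▸ (x.isOrientation_expand v hv).mem_evenOdd
  · rcases v with _ | v
    · simp at hv
    · simp_all [expand]

theorem expansion_mem_evenOdd : x.expansion ∈ evenOdd _ (x.forest.verts.card + 1) := by
  have hglob := x.isOrientation_glob.mem_evenOdd
  rw [Finset.card_insertNone, Nat.cast_succ] at hglob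
  exact algHom_mem_evenOdd (fun v => by simpa using x.expand_mem_evenOdd v) hglob

variable {x}

theorem expansion_mem_supported {A : Finset I} (hA : A ∉ x.forest.verts) :
    x.expansion ∈ supported {h | h ≠ some (A, true)} := by
  refine algHom_mem_of_mem_supported _ (fun v hv => ?_) x.isOrientation_glob.mem_supported
  rw [substHom_gen]
  rcases v with _ | v
  · exact gen_mem_supported (by simp)
  · have hv' : v ∈ x.forest.verts := by simpa using hv
    rw [expand, if_pos hv']
    refine rename_mem_supported _ (fun h hh => ?_) (x.isOrientation_loc v hv').mem_supported
    rcases x.forest.mem_halfEdges.1 hh with rfl | ⟨C, -, rfl⟩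
    · simpa using ne_of_mem_of_not_mem hv' hA
    · simp

theorem Matches.halfEdgePairs_eq {a : Ext I} {r : Ext (Finset I)} (h : x.Matches a r) :
    outerProduct a r * halfEdgePairs true x.forest.innerEdges =
      halfEdgePairs false x.forest.trivialTrees * x.expansion := by
  rw [← innerEdgePairs_eq, ← leafRootPairs_eq]
  exact h

theorem Matches.card_add_card_roots {a : Ext I} {r : Ext (Finset I)}
    (ha : IsOrientation Finset.univ a) (hr : IsOrientation x.forest.roots r)
    (h : x.Matches a r) :
    (Fintype.card I + x.forest.roots.card : ZMod 2) = x.forest.verts.card := by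
  have hleft := mul_mem_evenOdd (outerProduct_mem_evenOdd ha.mem_evenOdd hr.mem_evenOdd)
    (halfEdgePairs_mem_evenOdd true x.forest.innerEdges)
  have hright := mul_mem_evenOdd (halfEdgePairs_mem_evenOdd false x.forest.trivialTrees)
    x.expansion_mem_evenOdd
  have hne : (halfEdgePairs false x.forest.trivialTrees : Ext (Option (Finset I × Bool))) *
      x.expansion ≠ 0 := by
    rw [← leafRootPairs_eq]
    exact x.isOrientation_right.ne_zero
  rw [h.halfEdgePairs_eq] at hleft
  have hdeg := cast_eq_of_mem_evenOdd hleft hright hne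
  rw [Finset.card_univ] at hdeg
  linear_combination hdeg

variable {A : Finset I} {a : Ext I} {s : Ext (Finset I)}

theorem Matches.outerProduct_mul_gen (h : x.Matches a (s * gen A)) :
    outerProduct a s * gen (some (A, true)) * halfEdgePairs true x.forest.innerEdges =
      halfEdgePairs false x.forest.trivialTrees * x.expansion := by
  rw [← h.halfEdgePairs_eq]
  simp only [outerProduct, map_mul, rename_gen, Option.elim_some, mul_assoc]

theorem Matches.open_root_of_mem_verts (hA : A ∈ x.forest.roots) (hv : A ∈ x.forest.verts)
    (h : x.Matches a (s * gen A)) :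
    outerProduct a s * halfEdgePairs true (x.forest.openEdges A) =
      halfEdgePairs false (x.forest.trivialTrees.erase A) * x.expansion *
        gen (some (A, false)) := by
  have hinner : A ∉ x.forest.innerEdges := by simp [Forest.innerEdges, hA]
  have htrivial : A ∉ x.forest.trivialTrees := by simp [Forest.trivialTrees, hv]
  rw [Finset.erase_eq_of_notMem htrivial, ← h.outerProduct_mul_gen, Forest.openEdges_of_mem hv,
    halfEdgePairs_insert true hinner]
  simp only [mul_assoc, ← mul_halfEdgePairs, Bool.not_true]

theorem Matches.open_root_of_notMem_verts (hA : A ∈ x.forest.roots) (hv : A ∉ x.forest.verts)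
    (ha : IsOrientation Finset.univ a) (hs : IsOrientation (x.forest.roots.erase A) s)
    (h : x.Matches a (s * gen A)) :
    outerProduct a s * halfEdgePairs true (x.forest.openEdges A) =
      halfEdgePairs false (x.forest.trivialTrees.erase A) * x.expansion *
        gen (some (A, false)) := by
  have htrivial : A ∈ x.forest.trivialTrees := Finset.mem_filter.2 ⟨hA, hv⟩
  have hinner : A ∉ x.forest.innerEdges := fun h => hv (Finset.mem_filter.1 h).1
  have hpair := h.outerProduct_mul_gen
  rw [← Finset.insert_erase htrivial, halfEdgePairs_insert false (Finset.notMem_erase _ _)] at hpair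
  rw [Forest.openEdges_of_notMem hv]
  refine mul_gen_cancel (s := {h | h ≠ some (A, true)}) (x := some (A, true)) (by simp)
    (mul_mem (outerProduct_mem_supported (Finset.notMem_erase A _) ha hs)
      (halfEdgePairs_mem_supported hinner true))
    (mul_mem (mul_mem (halfEdgePairs_mem_supported (Finset.notMem_erase A _) true)
      (expansion_mem_supported hv)) (gen_mem_supported (by simp))) ?_
  set z := halfEdgePairs false (x.forest.trivialTrees.erase A) * x.expansion with hz
  have hcomm : z * (gen (some (A, false)) * gen (some (A, true))) =
      gen (some (A, false)) * gen (some (A, true)) * z :=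
    Subalgebra.mem_center_iff.1 (genPair (some (A, false)) (some (A, true))).2 z
  rw [mul_assoc, ← mul_halfEdgePairs, ← mul_assoc, hpair, mul_assoc, ← hz, mul_assoc z, hcomm,
    Bool.not_false]

/-- The upper half-edge of `A` is an open end on the outer side of the identification. Multiplying
by the lower half-edge turns it into the end of an inner edge if `A` is an inner vertex; otherwise
`A` is a leaf and the pair `ℓ ∧ r` is resolved instead. -/
theorem Matches.open_root (hA : A ∈ x.forest.roots) (ha : IsOrientation Finset.univ a)
    (hs : IsOrientation (x.forest.roots.erase A) s) (h : x.Matches a (s * gen A)) :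
    outerProduct a s * halfEdgePairs true (x.forest.openEdges A) =
      halfEdgePairs false (x.forest.trivialTrees.erase A) * x.expansion *
        gen (some (A, false)) := by
  by_cases hv : A ∈ x.forest.verts
  exacts [h.open_root_of_mem_verts hA hv, h.open_root_of_notMem_verts hA hv ha hs]

end InnerOrientedForest

end inner

section vee

variable {I J : Type*} [Fintype I] [DecidableEq I] [Fintype J] [DecidableEq J]

namespace Forest

variable (F : Forest I) (G : Forest J) (A : {A // A ∈ F.roots}) (B : {B // B ∈ G.roots})

theorem verts_vee : (F.vee G A B).verts = insert (sumSet A.1 B.1)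
    (F.verts.image (sumSet · ∅) ∪ G.verts.image (sumSet ∅)) := by
  ext S
  simp only [mem_verts_vee, Finset.mem_insert, Finset.mem_union, Finset.mem_image]

theorem sumSet_left_mem_roots_vee {C : Finset I} (hC : C.Nonempty) :
    sumSet C ∅ ∈ (F.vee G A B).roots ↔ C ∈ F.roots.erase A.1 := by
  have hB := (G.root_nonempty B.2).ne_empty
  simp [roots_vee, sumSet_inj, hB.symm, hC.ne_empty.symm]

theorem sumSet_right_mem_roots_vee {D : Finset J} (hD : D.Nonempty) :
    sumSet ∅ D ∈ (F.vee G A B).roots ↔ D ∈ G.roots.erase B.1 := by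
  have hA := (F.root_nonempty A.2).ne_empty
  simp [roots_vee, sumSet_inj, hA.symm, hD.ne_empty.symm]

theorem sumSet_left_mem_verts_vee {C : Finset I} (hC : C.Nonempty) :
    sumSet C ∅ ∈ (F.vee G A B).verts ↔ C ∈ F.verts := by
  have hB := (G.root_nonempty B.2).ne_empty
  simp [verts_vee, sumSet_inj, hB.symm, hC.ne_empty.symm]

theorem sumSet_right_mem_verts_vee {D : Finset J} (hD : D.Nonempty) :
    sumSet ∅ D ∈ (F.vee G A B).verts ↔ D ∈ G.verts := by
  have hA := (F.root_nonempty A.2).ne_empty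
  simp [verts_vee, sumSet_inj, hA.symm, hD.ne_empty.symm]

theorem verts_nonempty {C : Finset I} (hC : C ∈ F.verts) : C.Nonempty :=
  F.nonempty C (F.mem_verts.1 hC).1

theorem innerEdges_vee : (F.vee G A B).innerEdges =
    (F.openEdges A.1).image (sumSet · ∅) ∪ (G.openEdges B.1).image (sumSet ∅) := by
  rw [innerEdges, verts_vee, Finset.filter_insert, if_neg (by simp [roots_vee]),
    Finset.filter_union, Finset.filter_image, Finset.filter_image, openEdges, openEdges]
  congr 2
  · exact Finset.filter_congr fun C hC =>
      not_congr (F.sumSet_left_mem_roots_vee G A B (F.verts_nonempty hC))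
  · exact Finset.filter_congr fun D hD =>
      not_congr (F.sumSet_right_mem_roots_vee G A B (G.verts_nonempty hD))

theorem trivialTrees_vee : (F.vee G A B).trivialTrees =
    (F.trivialTrees.erase A.1).image (sumSet · ∅) ∪
      (G.trivialTrees.erase B.1).image (sumSet ∅) := by
  rw [trivialTrees, roots_vee, Finset.filter_union, Finset.filter_insert,
    if_neg (by simp [verts_vee]), Finset.filter_image, Finset.filter_image, trivialTrees,
    trivialTrees, ← Finset.filter_erase, ← Finset.filter_erase]
  congr 2
  · exact Finset.filter_congr fun C hC => not_congr <|
      F.sumSet_left_mem_verts_vee G A B (F.root_nonempty (Finset.mem_of_mem_erase hC))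
  · exact Finset.filter_congr fun D hD => not_congr <|
      F.sumSet_right_mem_verts_vee G A B (G.root_nonempty (Finset.mem_of_mem_erase hD))

end Forest

end vee

section halfEdges

variable {I J : Type*}

/-- A half-edge of the first forest, as a half-edge of the `∨` product. -/
def veeInl (h : Option (Finset I × Bool)) : Option (Finset (I ⊕ J) × Bool) :=
  h.map (Prod.map (sumSet · ∅) id)

/-- A half-edge of the second forest, as a half-edge of the `∨` product with new inner vertex `v`.
The auxiliary element is replaced by the upper half-edge at `v`. -/
def veeInr (v : Finset (I ⊕ J)) (h : Option (Finset J × Bool)) : Option (Finset (I ⊕ J) × Bool) :=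
  some (h.elim (v, true) (Prod.map (sumSet ∅) id))

/-- The orientation of the leaves of the `∨` product. -/
def veeLeaves (a : Ext I) (b : Ext J) : Ext (I ⊕ J) :=
  rename (fun i => some (Sum.inl i)) a * rename (fun j => some (Sum.inr j)) b

/-- The orientation of the roots of the `∨` product at the roots `A` and `B`, where the new root
replaces `B`, and `s` and `t` orient the roots other than `A` and `B`. -/
def veeRoots (A : Finset I) (B : Finset J) (s : Ext (Finset I)) (t : Ext (Finset J)) :
    Ext (Finset (I ⊕ J)) :=
  rename (fun C => some (sumSet C ∅)) s *
    (rename (fun D => some (sumSet ∅ D)) t * gen (sumSet A B))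

theorem disjoint_image_sumSet [Fintype I] [DecidableEq I] [Fintype J] [DecidableEq J]
    {s : Finset (Finset I)} {t : Finset (Finset J)} (hs : ∀ C ∈ s, C.Nonempty) :
    Disjoint (s.image (sumSet · (∅ : Finset J))) (t.image (sumSet ∅)) := by
  rw [Finset.disjoint_left]
  intro S hS hS'
  obtain ⟨C, hC, rfl⟩ := Finset.mem_image.1 hS
  obtain ⟨D, -, h⟩ := Finset.mem_image.1 hS'
  exact (hs C hC).ne_empty (sumSet_inj.1 h).1.symm

section rename_halfEdgePairs

variable [Fintype I] [DecidableEq I] [Fintype J] [DecidableEq J] (b : Bool)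

theorem rename_veeInl_halfEdgePairs (s : Finset (Finset I)) :
    rename (fun h : Option (Finset I × Bool) => some (veeInl (J := J) h)) (halfEdgePairs b s) =
      halfEdgePairs b (s.image (sumSet · (∅ : Finset J))) :=
  rename_halfEdgePairs b s (fun _ _ h => (sumSet_inj.1 h).1) fun _ => rfl

theorem rename_veeInr_halfEdgePairs (v : Finset (I ⊕ J)) (t : Finset (Finset J)) :
    rename (fun h => some (veeInr v h)) (halfEdgePairs b t) =
      halfEdgePairs b (t.image (sumSet (∅ : Finset I))) :=
  rename_halfEdgePairs b t (fun _ _ h => (sumSet_inj.1 h).2) fun _ => rfl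

end rename_halfEdgePairs

theorem mul_mul_eq_smul_of_smul_comm {E : Type*} [Ring E] [Algebra ℚ E] {a b r s t v : E}
    {c d : ℚ} (hb : b * (r * s) = c • (r * s * b)) (ht : t * v = d • (v * t)) :
    a * b * r * (s * (t * v)) = (c * d) • (a * r * s * (b * v * t)) := by
  calc a * b * r * (s * (t * v)) = a * (b * (r * s)) * (t * v) := by simp only [mul_assoc]
    _ = (c * d) • (a * (r * s * b) * (v * t)) := by
      rw [hb, ht, mul_smul_comm, mul_smul_comm, smul_mul_assoc, smul_smul, mul_comm d]
    _ = _ := by simp only [mul_assoc]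

theorem outerProduct_veeLeaves_veeRoots (A : Finset I) (B : Finset J) (a : Ext I) {b : Ext J}
    {s : Ext (Finset I)} {t : Ext (Finset J)} {l m n : ℕ} (hb : b ∈ evenOdd J l)
    (hs : s ∈ evenOdd (Finset I) m) (ht : t ∈ evenOdd (Finset J) n) :
    outerProduct (veeLeaves a b) (veeRoots A B s t) = (-1 : ℚ) ^ ((1 + m) * l + n) •
      (rename (fun h => some (veeInl h)) (outerProduct a s) *
        rename (fun h => some (veeInr (sumSet A B) h)) (outerProduct b t)) := by
  have hinl (i : I) : ({Sum.inl i} : Finset (I ⊕ J)) = sumSet {i} ∅ := by simp [sumSet]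
  have hinr (j : J) : ({Sum.inr j} : Finset (I ⊕ J)) = sumSet ∅ {j} := by simp [sumSet]
  have hRs : gen none * rename (fun C => some (some (sumSet C (∅ : Finset J), true))) s ∈
      evenOdd _ (1 + m : ℕ) := by
    push_cast
    exact mul_mem_evenOdd (gen_mem_evenOdd none) (rename_mem_evenOdd _ hs)
  have hbRs := mul_comm_of_mem_evenOdd
    (rename_mem_evenOdd (fun j => some (sumSet (∅ : Finset I) {j}, false)) hb) hRs
  have htv := mul_comm_of_mem_evenOdd
    (rename_mem_evenOdd (fun D => some (sumSet (∅ : Finset I) D, true)) ht)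
    (n := 1) (by simpa using gen_mem_evenOdd (some (sumSet A B, true)))
  simp only [outerProduct, veeLeaves, veeRoots, map_mul, rename_rename, rename_gen, veeInl, veeInr,
    hinl, hinr, Option.bind_some, Option.map_some, Option.map_none, Option.elim_some,
    Option.elim_none, Prod.map_apply, id]
  rw [mul_mul_eq_smul_of_smul_comm hbRs htv, ← pow_add, mul_one, mul_comm l]

end halfEdges

section expansion

variable {I J : Type*} [Fintype I] [DecidableEq I] [Fintype J] [DecidableEq J]

namespace InnerOrientedForest

variable (x : InnerOrientedForest I) (y : InnerOrientedForest J)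
  (A : {A // A ∈ x.forest.roots}) (B : {B // B ∈ y.forest.roots})

theorem expand_of_mem {v : Finset I} (hv : v ∈ x.forest.verts) :
    x.expand (some v) = rename (fun h => some (some h)) (x.loc v) := if_pos hv

theorem expand_vee_left {C : Finset I} (hC : C ∈ x.forest.verts) :
    (x.vee y A B).expand (some (sumSet C ∅)) =
      rename (fun h => some (veeInl h)) (x.expand (some C)) := by
  have hB := (y.forest.root_nonempty B.2).ne_empty
  have hmem := (Forest.sumSet_left_mem_verts_vee _ _ A B (x.forest.verts_nonempty hC)).2 hC
  have hloc : (x.vee y A B).loc (sumSet C ∅) =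
      rename (fun h => some (sumSet h.1 ∅, h.2)) (x.loc C) := by
    refine (if_neg (by simp [sumSet_inj, hB.symm])).trans ((if_pos (by simp)).trans ?_)
    rw [toLeft_sumSet]
    rfl
  rw [expand_of_mem _ hmem, expand_of_mem _ hC, hloc, rename_rename, rename_rename]
  rfl

theorem expand_vee_right {D : Finset J} (hD : D ∈ y.forest.verts) :
    (x.vee y A B).expand (some (sumSet ∅ D)) =
      rename (fun h => some (veeInr (sumSet A.1 B.1) h)) (y.expand (some D)) := by
  have hA := (x.forest.root_nonempty A.2).ne_empty
  have hD' := y.forest.verts_nonempty hD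
  have hmem := (Forest.sumSet_right_mem_verts_vee _ _ A B hD').2 hD
  have hloc : (x.vee y A B).loc (sumSet ∅ D) =
      rename (fun h => some (sumSet ∅ h.1, h.2)) (y.loc D) := by
    refine (if_neg (by simp [sumSet_inj, hA.symm])).trans
      ((if_neg (by simpa using hD'.ne_empty)).trans ?_)
    rw [toRight_sumSet]
  rw [expand_of_mem _ hmem, expand_of_mem _ hD, hloc, rename_rename, rename_rename]
  rfl

theorem expand_vee_new : (x.vee y A B).expand (some (sumSet A.1 B.1)) =
    gen (some (sumSet A.1 B.1, true)) *
      (gen (some (sumSet A.1 ∅, false)) * gen (some (sumSet ∅ B.1, false))) := by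
  have hmem : sumSet A.1 B.1 ∈ (x.vee y A B).forest.verts :=
    (Forest.mem_verts_vee _ _ A B).2 (Or.inl rfl)
  have hloc : (x.vee y A B).loc (sumSet A.1 B.1) = gen (sumSet A.1 B.1, true) *
      gen (sumSet A.1 ∅, false) * gen (sumSet ∅ B.1, false) := if_pos rfl
  rw [expand_of_mem _ hmem, hloc]
  simp [mul_assoc]

theorem substHom_expand_vee_left :
    substHom (x.vee y A B).expand (x.vee y A B).expand_swap
        (rename (fun v => some (v.elim none fun C => some (sumSet C ∅))) x.glob) =
      rename (fun h => some (veeInl h)) x.expansion := by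
  refine algHom_congr_of_mem_supported
    (φ := (substHom (x.vee y A B).expand (x.vee y A B).expand_swap).comp (rename _))
    (ψ := (rename _).comp (substHom x.expand x.expand_swap)) x.isOrientation_glob.mem_supported ?_
  rintro (_ | C) hC
  · simp [expand, veeInl]
  · simpa using x.expand_vee_left y A B (by simpa using hC)

/-- The factor `e₁⁻ ∧ e₂⁻` is what the local orientation `v⁺ ∧ e₁⁻ ∧ e₂⁻` at the new vertex adds to
the half-edge `v⁺`, which takes the place of the auxiliary element of `y`. -/
theorem substHom_expand_vee_right :
    substHom (x.vee y A B).expand (x.vee y A B).expand_swap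
        (rename (fun v => some (v.elim (some (sumSet A.1 B.1)) fun D => some (sumSet ∅ D)))
          y.glob) =
      rename (fun h => some (veeInr (sumSet A.1 B.1) h)) y.expansion *
        (gen (some (sumSet A.1 ∅, false)) * gen (some (sumSet ∅ B.1, false))) := by
  obtain ⟨o, ho, hglob⟩ := y.isOrientation_glob.exists_mul_gen (x := none) (by simp)
  have ho' : substHom (x.vee y A B).expand (x.vee y A B).expand_swap
      (rename (fun v => some (v.elim (some (sumSet A.1 B.1)) fun D => some (sumSet ∅ D))) o) =
      rename (fun h => some (veeInr (sumSet A.1 B.1) h)) (substHom y.expand y.expand_swap o) := by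
    refine algHom_congr_of_mem_supported
      (φ := (substHom (x.vee y A B).expand (x.vee y A B).expand_swap).comp (rename _))
      (ψ := (rename _).comp (substHom y.expand y.expand_swap)) ho.mem_supported ?_
    rintro (_ | D) hD
    · simp at hD
    · simpa using x.expand_vee_right y A B (by simpa using hD)
  have hnone : rename (fun h => some (veeInr (sumSet A.1 B.1) h)) (y.expand none) =
      gen (some (sumSet A.1 B.1, true)) := rename_gen _ _
  rw [expansion, hglob]
  simp only [map_mul, ho', rename_gen, substHom_gen, Option.elim_some, Option.elim_none,
    expand_vee_new, hnone, mul_assoc]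

theorem expansion_vee : (x.vee y A B).expansion =
    (-1 : ℚ) ^ (x.forest.verts.card + y.forest.verts.card + 1) •
      (rename (fun h => some (veeInl h)) (x.expansion * gen (some (A.1, false))) *
        rename (fun h => some (veeInr (sumSet A.1 B.1) h))
          (y.expansion * gen (some (B.1, false)))) := by
  have hcomm := mul_comm_of_mem_evenOdd (n := 1) (m := y.forest.verts.card + 1)
    (rename_mem_evenOdd (veeInr (sumSet A.1 B.1)) (by exact_mod_cast y.expansion_mem_evenOdd))
    (by simpa using gen_mem_evenOdd (some (sumSet A.1 (∅ : Finset J), false)))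
  have hglob : (x.vee y A B).expansion = (-1 : ℚ) ^ x.forest.verts.card •
      (rename (fun h => some (veeInl h)) x.expansion *
        (rename (fun h => some (veeInr (sumSet A.1 B.1) h)) y.expansion *
          (gen (some (sumSet A.1 ∅, false)) * gen (some (sumSet ∅ B.1, false))))) := by
    rw [← x.substHom_expand_vee_left y A B, ← x.substHom_expand_vee_right y A B, ← map_mul,
      ← map_smul]
    rfl
  rw [hglob, ← mul_assoc (rename _ y.expansion), hcomm, mul_one, smul_mul_assoc, mul_smul_comm,
    smul_smul, ← pow_add, ← add_assoc]
  simp [veeInl, veeInr, mul_assoc]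

end InnerOrientedForest

end expansion

section matching

variable {I J : Type*} [Fintype I] [DecidableEq I] [Fintype J] [DecidableEq J]

theorem isOrientation_veeLeaves {a : Ext I} {b : Ext J} (ha : IsOrientation Finset.univ a)
    (hb : IsOrientation Finset.univ b) : IsOrientation Finset.univ (veeLeaves a b) := by
  have hinl := ha.rename (fun i => some (Sum.inl i : I ⊕ J)) (Finset.univ.image Sum.inl)
    (by simp) (by simp) (by simp)
  have hinr := hb.rename (fun j => some (Sum.inr j : I ⊕ J)) (Finset.univ.image Sum.inr)
    (by simp) (by simp) (by simp)
  have huniv : (Finset.univ : Finset (I ⊕ J)) =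
      Finset.univ.image Sum.inl ∪ Finset.univ.image Sum.inr := by
    ext (z | z) <;> simp
  rw [huniv]
  exact hinl.mul hinr (by simp [Finset.disjoint_left])

theorem isOrientation_veeRoots {F : Forest I} {G : Forest J} (A : {A // A ∈ F.roots})
    (B : {B // B ∈ G.roots}) {s : Ext (Finset I)} {t : Ext (Finset J)}
    (hs : IsOrientation (F.roots.erase A.1) s) (ht : IsOrientation (G.roots.erase B.1) t) :
    IsOrientation (F.vee G A B).roots (veeRoots A.1 B.1 s t) := by
  have hA := (F.root_nonempty A.2).ne_empty
  have hB := (G.root_nonempty B.2).ne_empty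
  have hleft := hs.rename (fun C => some (sumSet C (∅ : Finset J)))
    ((F.roots.erase A.1).image (sumSet · ∅)) (by simp) (by simp +contextual [sumSet_inj]) (by simp)
  have hright := ht.rename (fun D => some (sumSet (∅ : Finset I) D))
    ((G.roots.erase B.1).image (sumSet ∅)) (by simp) (by simp +contextual [sumSet_inj]) (by simp)
  have hdisj : Disjoint ((F.roots.erase A.1).image (sumSet · (∅ : Finset J)))
      ((G.roots.erase B.1).image (sumSet ∅)) :=
    disjoint_image_sumSet fun C hC => F.root_nonempty (Finset.mem_of_mem_erase hC)
  rw [Forest.roots_vee, Finset.insert_eq, Finset.union_comm {_}]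
  exact hleft.mul (hright.mul (isOrientation_gen _) (by simp [sumSet_inj, hA.symm]))
    (Finset.disjoint_union_right.2 ⟨hdisj, by simp [sumSet_inj, hB.symm]⟩)

namespace InnerOrientedForest

variable {x : InnerOrientedForest I} {y : InnerOrientedForest J}
  {A : {A // A ∈ x.forest.roots}} {B : {B // B ∈ y.forest.roots}}
  {a : Ext I} {s : Ext (Finset I)} {b : Ext J} {t : Ext (Finset J)}

theorem Matches.mul_halfEdgePairs_vee (ha : IsOrientation Finset.univ a)
    (hs : IsOrientation (x.forest.roots.erase A.1) s) (hx : x.Matches a (s * gen A.1))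
    (hb : IsOrientation Finset.univ b) (ht : IsOrientation (y.forest.roots.erase B.1) t)
    (hy : y.Matches b (t * gen B.1)) :
    rename (fun h => some (veeInl h)) (outerProduct a s) *
        rename (fun h => some (veeInr (sumSet A.1 B.1) h)) (outerProduct b t) *
          (halfEdgePairs true (x.forest.vee y.forest A B).innerEdges : Ext _) =
      (halfEdgePairs false (x.forest.vee y.forest A B).trivialTrees : Ext _) *
        (rename (fun h => some (veeInl h)) (x.expansion * gen (some (A.1, false))) *
          rename (fun h => some (veeInr (sumSet A.1 B.1) h))
            (y.expansion * gen (some (B.1, false)))) := by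
  have hX := congrArg (rename fun h => some (veeInl (J := J) h)) (hx.open_root A.2 ha hs)
  have hY := congrArg (rename fun h => some (veeInr (sumSet A.1 B.1) h)) (hy.open_root B.2 hb ht)
  rw [mul_assoc, map_mul, map_mul, rename_veeInl_halfEdgePairs, rename_veeInl_halfEdgePairs] at hX
  rw [mul_assoc, map_mul, map_mul, rename_veeInr_halfEdgePairs, rename_veeInr_halfEdgePairs] at hY
  have hinner : Disjoint ((x.forest.openEdges A.1).image (sumSet · (∅ : Finset J)))
      ((y.forest.openEdges B.1).image (sumSet ∅)) :=
    disjoint_image_sumSet fun C hC => x.forest.verts_nonempty (Finset.mem_filter.1 hC).1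
  have htrivial : Disjoint ((x.forest.trivialTrees.erase A.1).image (sumSet · (∅ : Finset J)))
      ((y.forest.trivialTrees.erase B.1).image (sumSet ∅)) :=
    disjoint_image_sumSet fun C hC =>
      x.forest.root_nonempty (Finset.mem_filter.1 (Finset.mem_of_mem_erase hC)).1
  rw [Forest.innerEdges_vee, Forest.trivialTrees_vee, halfEdgePairs_union true hinner,
    halfEdgePairs_union false htrivial, Commute.mul_mul_mul_comm (mul_halfEdgePairs _ _ _), hX, hY,
    Commute.mul_mul_mul_comm (mul_halfEdgePairs _ _ _)]

theorem sign_vee {i j v w m n : ℕ} (hv : (i + (m + 1 : ℕ) : ZMod 2) = v)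
    (hw : (j + (n + 1 : ℕ) : ZMod 2) = w) :
    (-1 : ℚ) ^ ((j + 1) * (m + 1 + 1) + (i + 1)) * (-1) ^ ((1 + m) * j + n) =
      (-1) ^ (v + w + 1) := by
  rw [← pow_add]
  refine neg_one_pow_congr_of_cast_eq ?_
  have htwo : (2 : ZMod 2) = 0 := rfl
  push_cast at hv hw ⊢
  linear_combination hv + hw + (m * j + j : ZMod 2) * htwo

theorem Matches.vee (ha : IsOrientation Finset.univ a)
    (hs : IsOrientation (x.forest.roots.erase A.1) s)
    (hr : IsOrientation x.forest.roots (s * gen A.1)) (hx : x.Matches a (s * gen A.1))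
    (hb : IsOrientation Finset.univ b) (ht : IsOrientation (y.forest.roots.erase B.1) t)
    (hw : IsOrientation y.forest.roots (t * gen B.1)) (hy : y.Matches b (t * gen B.1)) :
    (x.vee y A B).Matches
      ((-1 : ℚ) ^ ((Fintype.card J + 1) * (x.forest.roots.card + 1) + (Fintype.card I + 1)) •
        veeLeaves a b) (veeRoots A.1 B.1 s t) := by
  have hcx := hx.card_add_card_roots ha hr
  have hcy := hy.card_add_card_roots hb hw
  rw [← Finset.card_erase_add_one A.2] at hcx ⊢
  rw [← Finset.card_erase_add_one B.2] at hcy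
  have hsmul (q : ℚ) (z : Ext (I ⊕ J)) (r) : outerProduct (q • z) r = q • outerProduct z r := by
    simp only [outerProduct, map_smul, smul_mul_assoc]
  change outerProduct _ _ * innerEdgePairs (x.forest.vee y.forest A B) =
    leafRootPairs (x.forest.vee y.forest A B) * (x.vee y A B).expansion
  rw [hsmul, outerProduct_veeLeaves_veeRoots A.1 B.1 a hb.mem_evenOdd hs.mem_evenOdd
      ht.mem_evenOdd, smul_smul, Finset.card_univ, sign_vee hcx hcy, innerEdgePairs_eq,
    leafRootPairs_eq, expansion_vee, smul_mul_assoc, mul_smul_comm,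
    mul_halfEdgePairs_vee ha hs hx hb ht hy]

end InnerOrientedForest

end matching

section composition

theorem bSign_rootOriented {I : Type*} [Fintype I] [DecidableEq I] (d : ℕ) (F : Forest I)
    (o : detSpace F.roots) :
    bSign I d (rootOriented F o) = (-1 : ℚ) ^ (d * (F.roots.card + 1)) • rootOriented F o := by
  apply Subtype.ext
  funext G
  change (-1 : ℚ) ^ (d * (G.roots.card + 1)) • (Pi.single F o.1 : Forest I → Ext (Finset I)) G =
    (-1 : ℚ) ^ (d * (F.roots.card + 1)) • (Pi.single F o.1 : Forest I → Ext (Finset I)) G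
  rcases eq_or_ne G F with rfl | h
  · rfl
  · rw [Pi.single_eq_of_ne h, smul_zero, smul_zero]

variable {I J K : Type*} [Fintype I] [DecidableEq I] [Fintype J] [DecidableEq J]
  [Fintype K] [DecidableEq K] {i : I} (e : {x : I // x ≠ i} ⊕ J ≃ K)

theorem bCompAux_single (F : Forest I) (G : Forest J) (u : Ext (Finset I)) (w : Ext (Finset J)) :
    bCompAux e (Pi.single F u) (Pi.single G w) =
      ∑ c : {D // D ∈ F.path i} → {A // A ∈ G.roots},
        Pi.single (Forest.graft F G c e) (extComp (F.rootOf i)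
          (fun r => some (Forest.glue e r ∅)) (Forest.graftRoot F G c e) u w) := by
  simp only [bCompAux, LinearMap.sum_apply, LinearMap.compr₂_apply, LinearMap.compl₁₂_apply,
    LinearMap.proj_apply, LinearMap.single_apply]
  rw [Finset.sum_eq_single F, Finset.sum_eq_single G]
  · simp only [Pi.single_eq_same]
  · intro G' _ h
    refine Finset.sum_eq_zero fun c _ => ?_
    rw [Pi.single_eq_of_ne (M := fun _ => Ext (Finset J)) h, map_zero, Pi.single_zero]
  · simp
  · intro F' _ h
    refine Finset.sum_eq_zero fun G' _ => Finset.sum_eq_zero fun c _ => ?_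
    rw [Pi.single_eq_of_ne (M := fun _ => Ext (Finset I)) h, map_zero, LinearMap.zero_apply,
      Pi.single_zero]
  · simp

/-- The orientation of the roots of a graft that is composed from orientations of the roots. -/
def graftOrientation (F : Forest I) (G : Forest J)
    (c : {D // D ∈ F.path i} → {A // A ∈ G.roots}) (u : detSpace F.roots)
    (w : detSpace G.roots) : detSpace (Forest.graft F G c e).roots :=
  ⟨extComp (F.rootOf i) (fun r => some (Forest.glue e r ∅)) (Forest.graftRoot F G c e) u.1 w.1,
    Forest.extComp_graft_mem F G c e u.2 w.2⟩

theorem bComp_rootOriented_of_path_eq {F : Forest I} {D : Finset I} (hD : F.path i = {D})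
    (G : Forest J) (u : detSpace F.roots) (w : detSpace G.roots) :
    bComp e (rootOriented F u) (rootOriented G w) =
      ∑ A : {A // A ∈ G.roots}, rootOriented (Forest.graft F G (fun _ => A) e)
        (graftOrientation e F G (fun _ => A) u w) := by
  apply Subtype.ext
  refine (bCompAux_single e F G u.1 w.1).trans ?_
  rw [AddSubmonoidClass.coe_finsetSum]
  have : Unique {D // D ∈ F.path i} :=
    ⟨⟨⟨D, by simp [hD]⟩⟩, fun E => Subtype.ext (by simpa [hD] using E.2)⟩
  exact (Fintype.sum_equiv (Equiv.funUnique {D // D ∈ F.path i} {A // A ∈ G.roots}).symm _ _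
    fun A => rfl).symm

theorem rootOriented_congr {F G : Forest I} (h : F = G) {o : detSpace F.roots}
    {o' : detSpace G.roots} (ho : o.1 = o'.1) : rootOriented F o = rootOriented G o' := by
  subst h
  rw [Subtype.ext ho]

end composition

section omega

variable {I J : Type*} [Fintype I] [DecidableEq I]

/-- The orientation `⋆ ∧ #` of the leaves in `Ω`. -/
def omegaLeaves : OpDet Bool :=
  ⟨wedge [false, true], (isOrientation_wedge (by simp) (by simp)).mem⟩

/-- The orientation of the single root in `Ω`. -/
def omegaRoots : detSpace omegaTree.roots :=
  ⟨gen {false, true}, by rw [roots_omegaTree]; exact (isOrientation_gen _).mem⟩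

theorem Omega_eq : Omega = omegaLeaves ⊗ₜ[ℚ] rootOriented omegaTree omegaRoots := rfl

/-- The sign comes from moving `⋆` past `#` and `#` past the leaves of the first forest, so that
each contraction takes place at the last factor. -/
theorem extComp_omegaLeaves {a : Ext I} (ha : IsOrientation Finset.univ a) (b : Ext J) :
    extComp none (leafInl (sharpEquiv I J)) (fun y => sharpEquiv I J (Sum.inr y))
      (extComp false (leafInl (starEquiv I)) (fun y => starEquiv I (Sum.inr y))
        omegaLeaves.1 a) b = (-1 : ℚ) ^ (Fintype.card I + 1) • veeLeaves a b := by
  have hΩ : omegaLeaves.1 = -(gen true * gen false) := by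
    rw [gen_swap, neg_neg]
    simp [omegaLeaves]
  have hsharp : rename (leafInl (starEquiv I)) (gen true) = gen none := by
    simp [leafInl, starEquiv]
  have hcomm : gen none * rename (fun i => some (some i)) a =
      (-1 : ℚ) ^ Fintype.card I • (rename (fun i => some (some i)) a * gen none) := by
    simpa using mul_comm_of_mem_evenOdd (m := 1) (by simpa using gen_mem_evenOdd none)
      (rename_mem_evenOdd some ha.mem_evenOdd)
  have hstar : extComp false (leafInl (starEquiv I)) (fun y => starEquiv I (Sum.inr y))
      omegaLeaves.1 a = (-1 : ℚ) ^ (Fintype.card I + 1) •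
        (rename (fun i => some (some i)) a * gen none) := by
    rw [hΩ, map_neg, LinearMap.neg_apply,
      extComp_mul_gen (s := {true}) (by simp) (gen_mem_supported rfl), hsharp]
    refine (congrArg _ hcomm).trans ?_
    rw [pow_succ, mul_neg_one, neg_smul]
  have hsome : rename (fun i => some (some i)) a ∈ supported {z | z ≠ none} :=
    rename_mem_supported some (by simp [Set.MapsTo]) ha.mem_supported
  rw [hstar, map_smul, LinearMap.smul_apply, extComp_mul_gen (by simp) hsome, rename_rename]
  simp [veeLeaves, leafInl, sharpEquiv]

variable [Fintype J] [DecidableEq J]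

theorem extComp_omegaRoots {F : Forest I} {G : Forest J} (A : {A // A ∈ F.roots})
    (B : {B // B ∈ G.roots}) {s : Ext (Finset I)} (hs : IsOrientation (F.roots.erase A.1) s)
    {t : Ext (Finset J)} (ht : IsOrientation (G.roots.erase B.1) t) :
    extComp ((Forest.starGraft F A).rootOf none)
      (fun r => some (Forest.glue (sharpEquiv I J) r ∅))
      (Forest.graftRoot (Forest.starGraft F A) G (fun _ => B) (sharpEquiv I J))
      (extComp (omegaTree.rootOf false) (fun r => some (Forest.glue (starEquiv I) r ∅))
        (Forest.graftRoot omegaTree F (fun _ => A) (starEquiv I)) omegaRoots.1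
        (s * gen A.1)) (t * gen B.1) = veeRoots A.1 B.1 s t := by
  have hΩ : omegaRoots.1 = 1 * gen {false, true} := (one_mul _).symm
  have hmap : rename (fun C => some (C.map Function.Embedding.some)) s ∈
      supported {C | C ≠ Finset.insertNone A.1} :=
    rename_mem_supported _ (fun C _ => (Forest.insertNone_ne_map_some _ _).symm) hs.mem_supported
  rw [Forest.rootOf_eq_of_path_eq Forest.path_omegaTree,
    Forest.rootOf_eq_of_path_eq (Forest.path_starGraft F A), hΩ,
    extComp_mul_gen (Set.notMem_empty _) (one_mem _), map_one, one_mul,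
    Forest.rename_graftRoot_of_path_eq Forest.path_omegaTree hs,
    Forest.glue_starEquiv_of_mem (by simp)]
  simp only [Forest.glue_starEquiv_of_notMem (Finset.notMem_empty true)]
  rw [extComp_mul_gen (by simp) hmap, rename_rename,
    Forest.rename_graftRoot_of_path_eq (Forest.path_starGraft F A) ht]
  simp [veeRoots]

theorem bessComp_Omega_tmul (a : OpDet I) (F : Forest I) (r : detSpace F.roots) :
    bessComp (i := false) (starEquiv I) Omega (a ⊗ₜ[ℚ] rootOriented F r) =
      ∑ A : {A // A ∈ F.roots}, detComp (starEquiv I) omegaLeaves a ⊗ₜ[ℚ]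
        rootOriented (Forest.starGraft F A)
          (graftOrientation (starEquiv I) omegaTree F (fun _ => A) omegaRoots r) := by
  have hsign : (-1 : ℚ) ^ ((Fintype.card I + 1) * (omegaTree.roots.card + 1)) = 1 := by
    rw [roots_omegaTree, Finset.card_singleton, pow_mul']
    simp
  rw [Omega_eq, bessComp, TensorProduct.map₂_apply_tmul, LinearMap.comp_apply, bSign_rootOriented,
    hsign, one_smul, TensorProduct.map_tmul, bComp_rootOriented_of_path_eq _ Forest.path_omegaTree,
    TensorProduct.tmul_sum]

theorem bessComp_starGraft_tmul (d : OpDet (Option I)) (b : OpDet J) (F : Forest I)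
    (A : {A // A ∈ F.roots}) (r : detSpace (Forest.starGraft F A).roots) (G : Forest J)
    (w : detSpace G.roots) :
    bessComp (i := none) (sharpEquiv I J) (d ⊗ₜ[ℚ] rootOriented (Forest.starGraft F A) r)
        (b ⊗ₜ[ℚ] rootOriented G w) =
      ∑ B : {B // B ∈ G.roots},
        ((-1 : ℚ) ^ ((Fintype.card J + 1) * (F.roots.card + 1)) •
          detComp (sharpEquiv I J) d b) ⊗ₜ[ℚ]
          rootOriented (Forest.graft (Forest.starGraft F A) G (fun _ => B) (sharpEquiv I J))
            (graftOrientation (sharpEquiv I J) (Forest.starGraft F A) G (fun _ => B) r w) := by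
  rw [bessComp, TensorProduct.map₂_apply_tmul, LinearMap.comp_apply, bSign_rootOriented,
    map_smul, TensorProduct.map_tmul, LinearMap.smul_apply,
    bComp_rootOriented_of_path_eq _ (Forest.path_starGraft F A), Forest.card_roots_starGraft,
    ← TensorProduct.smul_tmul, TensorProduct.tmul_sum]

end omega

section outerForm

variable {I J : Type*} [Fintype I] [DecidableEq I] [Fintype J] [DecidableEq J]

namespace InnerOrientedForest

theorem isOuterForm_vee {x : InnerOrientedForest I} {y : InnerOrientedForest J}
    {a : OpDet I} {r : detSpace x.forest.roots} {b : OpDet J} {w : detSpace y.forest.roots}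
    (ha : IsOrientation Finset.univ a.1) (hr : IsOrientation x.forest.roots r.1)
    (hx : x.Matches a r) (hb : IsOrientation Finset.univ b.1)
    (hw : IsOrientation y.forest.roots w.1) (hy : y.Matches b w)
    (A : {A // A ∈ x.forest.roots}) (B : {B // B ∈ y.forest.roots}) :
    (x.vee y A B).IsOuterForm
      (((-1 : ℚ) ^ ((Fintype.card J + 1) * (x.forest.roots.card + 1)) •
        detComp (sharpEquiv I J) (detComp (starEquiv I) omegaLeaves a) b) ⊗ₜ[ℚ]
        rootOriented (Forest.graft (Forest.starGraft x.forest A) y.forest (fun _ => B)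
            (sharpEquiv I J))
          (graftOrientation (sharpEquiv I J) (Forest.starGraft x.forest A) y.forest (fun _ => B)
            (graftOrientation (starEquiv I) omegaTree x.forest (fun _ => A) omegaRoots r) w)) := by
  obtain ⟨s, hs, hrs⟩ := hr.exists_mul_gen A.2
  obtain ⟨t, ht, hwt⟩ := hw.exists_mul_gen B.2
  have hleaves : ((-1 : ℚ) ^ ((Fintype.card J + 1) * (x.forest.roots.card + 1)) •
        detComp (sharpEquiv I J) (detComp (starEquiv I) omegaLeaves a) b).1 =
      (-1 : ℚ) ^ ((Fintype.card J + 1) * (x.forest.roots.card + 1) + (Fintype.card I + 1)) •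
        veeLeaves a.1 b.1 := by
    rw [pow_add, mul_smul]
    exact congrArg _ (extComp_omegaLeaves ha b.1)
  have hroots : (graftOrientation (sharpEquiv I J) (Forest.starGraft x.forest A) y.forest
      (fun _ => B) (graftOrientation (starEquiv I) omegaTree x.forest (fun _ => A) omegaRoots r)
      w).1 = veeRoots A.1 B.1 s t := by
    rw [← extComp_omegaRoots A B hs ht, ← hrs, ← hwt]
    rfl
  have ho := isOrientation_veeRoots A B hs ht
  refine ⟨_, ⟨_, ho.mem⟩, ?_, ho, ?_, congrArg _ (rootOriented_congr
    (Forest.graft_starGraft x.forest y.forest A B) hroots)⟩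
  · rw [hleaves]
    exact (isOrientation_veeLeaves ha hb).sign_smul _
  · rw [hleaves]
    rw [hrs] at hr hx
    rw [hwt] at hw hy
    exact .vee ha hs hr hx hb ht hw hy

theorem IsOuterForm.eq_toBess {x : InnerOrientedForest I} {t : Bess I} (h : x.IsOuterForm t) :
    t = x.toBess :=
  x.existsUnique_isOuterForm.unique h x.isOuterForm_toBess

end InnerOrientedForest

end outerForm

end BesselOperad

end

theorem mainTheorem11 {I₁ I₂ : Type*} [Fintype I₁] [DecidableEq I₁] [Fintype I₂] [DecidableEq I₂]
    (x₁ : BesselOperad.InnerOrientedForest I₁) (x₂ : BesselOperad.InnerOrientedForest I₂) :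
    BesselOperad.bessComp (i := none) (BesselOperad.sharpEquiv I₁ I₂)
        (BesselOperad.bessComp (i := false) (BesselOperad.starEquiv I₁)
          BesselOperad.Omega x₁.toBess)
        x₂.toBess =
      ∑ A : {A // A ∈ x₁.forest.roots}, ∑ B : {B // B ∈ x₂.forest.roots},
        (x₁.vee x₂ A B).toBess := by
  obtain ⟨a, r, ha, hr, hx, ex⟩ := x₁.isOuterForm_toBess
  obtain ⟨b, w, hb, hw, hy, ey⟩ := x₂.isOuterForm_toBess
  rw [ex, ey, BesselOperad.bessComp_Omega_tmul, map_sum, LinearMap.sum_apply]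
  refine Finset.sum_congr rfl fun A _ => ?_
  rw [BesselOperad.bessComp_starGraft_tmul]
  exact Finset.sum_congr rfl fun B _ =>
    (BesselOperad.InnerOrientedForest.isOuterForm_vee ha hr hx hb hw hy A B).eq_toBess
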